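/- **Setting.** For an integrable $f:\mathbb R\to\mathbb R$ write $f^{\rm ft}(t)=\int e^{itx}f(x)\,dx$. One observes $W_j=X_j+\delta_j$, $1\le j\le n$, where $X_1,\dots,X_n,\delta_1,\dots,\delta_n$ are independent real random variables, the $X_j$ have unknown density $f_X$ and the $\delta_j$ have known density $f_\delta$; $E_{X\delta}$ denotes the expectation under these densities. An estimator $\hat f$ is a sequence of (jointly measurable) maps $\hat f_n(w_1,\dots,w_n;x)$, evaluated at $(W_1,\dots,W_n)$; $\|\cdot\|$ is the $L_2(\mathbb R)$ norm, and risks and suprema take values in $[0,\infty]$. Let $\beta>1/2$ and $\mu\ge 1$. For $C>0$ let $\mathcal F^2_{\beta C}$ be the set of probability densities $f$ for which $f^{\rm ft}$ is differentiable and $$\int\{|f^{\rm ft}(t)|^2+|f^{\rm ft}(t)|\,|(f^{\rm ft})'(t)|\}(1+t^2)^\beta\,dt\le C,$$ and let $\mathcal F^3_{\beta C}$ be the set of probability densities $f$ with $|f^{\rm ft}(t)|\le C|t|^{-\beta-1/2}$ for all $t\ne 0$. For $\nu,\lambda>0$ let $\mathcal G_{\nu\mu\lambda}$ be the set of probability densities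 $g$ for which there are $0<C_1<C_2<\infty$ and $S>0$ such that $$C_1|\sin(\lambda t)|^\mu|t|^{-\nu}\le|g^{\rm ft}(t)|\le C_2|\sin(\lambda t)|^\mu|t|^{-\nu}\quad\text{for all }|t|>S,$$ and $g^{\rm ft}(t)\ne0$ for $|t|\le S$. **Theorem 4.3.** Let $f_\delta$ be a probability density, and suppose that there is at least one $T>0$ such that $f_\delta^{\rm ft}$ is differentiable in a punctured neighbourhood of $T$ and $$\limsup_{t\to T}\frac{|f_\delta^{\rm ft}(t)|}{|t-T|^{\mu}}<\infty,\qquad \limsup_{t\to T}\frac{|(f_\delta^{\rm ft})'(t)|}{|t-T|^{\mu-1}}<\infty.\tag{4.9}$$ Then, for $j=2,3$, every $C>0$ for which $\mathcal F^j_{\beta C}$ is non-empty (this restricts $C$ only when $j=2$), and every estimator $\hat f$, $$\limsup_{n\to\infty}\ \sup_{f_X\in\mathcal F^j_{\beta C}} n^{1/(2\mu)}\,E_{X\delta}\|\hat f-f_X\|^2>0.\tag{4.10}$$ If, in addition, $\nu,\lambda>0$, $f_\delta\in\mathcal G_{\nu\mu\lambda}$, and, for some $c>0$ and all $t\neq0$,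 $f_\delta^{\rm ft}$ is differentiable at $t$ with $|(f_\delta^{\rm ft})'(t)|\le c|t|^{-\nu}$, then there is $C_0>0$, not depending on the estimator, such that for every $C\ge C_0$ and every estimator $\hat f$, $$\limsup_{n\to\infty}\ \sup_{f_X\in\mathcal F^3_{\beta C}} n^{2\beta/(2\beta+2\nu+1)}\,E_{X\delta}\|\hat f-f_X\|^2>0.\tag{4.11}$$ -/

import Mathlib

open MeasureTheory Filter Topology
open scoped ENNReal

noncomputable section

namespace Deconvolution

/-- `f` is a probability density on the real line. -/
structure IsProbDensity (f : ℝ → ℝ) : Prop where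
  measurable : Measurable f
  nonneg : ∀ x, 0 ≤ f x
  integrable : Integrable f
  integral_eq_one : ∫ x, f x = 1

/-- The Fourier transform `f^ft(t) = ∫ exp(itx) f(x) dx`. -/
def ft (f : ℝ → ℝ) (t : ℝ) : ℂ :=
  ∫ x : ℝ, Complex.exp (((t * x : ℝ) : ℂ) * Complex.I) * (f x : ℂ)

/-- The distribution with Lebesgue density `f`. -/
def law (f : ℝ → ℝ) : Measure ℝ :=
  volume.withDensity fun x => ENNReal.ofReal (f x)

/-- The class of densities whose Fourier transform `φ` has a derivative and satisfies
`∫ (|φ(t)|² + |φ(t)| |φ'(t)|) (1 + t²)^β dt ≤ C`.  The integral takes values in `[0, ∞]`. -/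
def classF2 (β C : ℝ) : Set (ℝ → ℝ) :=
  {f | IsProbDensity f ∧ Differentiable ℝ (ft f) ∧
    ∫⁻ t : ℝ, ENNReal.ofReal
      ((‖ft f t‖ ^ 2 + ‖ft f t‖ * ‖deriv (ft f) t‖) * (1 + t ^ 2) ^ β) ≤ ENNReal.ofReal C}

/-- The class of densities whose Fourier transform satisfies `|f^ft(t)| ≤ C |t|^(-β - 1/2)`.
At `t = 0` the right-hand side is `+∞`, so there is no condition there. -/
def classF3 (β C : ℝ) : Set (ℝ → ℝ) :=
  {f | IsProbDensity f ∧ ∀ t : ℝ, t ≠ 0 → ‖ft f t‖ ≤ C * |t| ^ (-β - 1 / 2)}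

/-- The class of error densities whose Fourier transform behaves like
`|sin (lam * t)|^μ |t|^(-ν)` for `|t| > S` and does not vanish for `|t| ≤ S`,
for some constants `0 < C₁ < C₂` and `S > 0`. -/
def classG (ν μ lam : ℝ) : Set (ℝ → ℝ) :=
  {g | IsProbDensity g ∧ ∃ C₁ C₂ S : ℝ, 0 < C₁ ∧ C₁ < C₂ ∧ 0 < S ∧
    (∀ t : ℝ, S < |t| →
      C₁ * |Real.sin (lam * t)| ^ μ * |t| ^ (-ν) ≤ ‖ft g t‖ ∧
      ‖ft g t‖ ≤ C₂ * |Real.sin (lam * t)| ^ μ * |t| ^ (-ν)) ∧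
    ∀ t : ℝ, |t| ≤ S → ft g t ≠ 0}

/-- The Fourier transform of `g` vanishes to order `μ` at `T`: near `T` (except possibly at `T`)
it has a derivative, and both limits superior, taken in `[0, ∞]`, are finite. -/
def VanishesToOrder (g : ℝ → ℝ) (μ T : ℝ) : Prop :=
  (∀ᶠ t in 𝓝[≠] T, DifferentiableAt ℝ (ft g) t) ∧
  limsup (fun t : ℝ => ENNReal.ofReal (‖ft g t‖ / |t - T| ^ μ)) (𝓝[≠] T) < ∞ ∧
  limsup (fun t : ℝ => ENNReal.ofReal (‖deriv (ft g) t‖ / |t - T| ^ (μ - 1))) (𝓝[≠] T) < ∞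

/-- An estimator: for every sample size `n`, a function of the sample `(w₁, …, wₙ)` with values in
functions on the line, jointly measurable in the sample and the point. -/
structure Estimator where
  toFun : (n : ℕ) → (Fin n → ℝ) → ℝ → ℝ
  measurable : ∀ n, Measurable fun p : (Fin n → ℝ) × ℝ => toFun n p.1 p.2

/-- The mean integrated squared error `E ‖est - f‖²` in `[0, ∞]` of the estimator `est` based on
`W_j = X_j + δ_j`, `j = 1, …, n`, where `X_1, …, X_n, δ_1, …, δ_n` are independent, the `X_j` have
density `f` and the `δ_j` have density `g`.  Here `ω j = (X_j, δ_j)`. -/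
def mise (est : Estimator) (f g : ℝ → ℝ) (n : ℕ) : ℝ≥0∞ :=
  ∫⁻ ω : Fin n → ℝ × ℝ,
    (∫⁻ x : ℝ, ENNReal.ofReal ((est.toFun n (fun j => (ω j).1 + (ω j).2) x - f x) ^ 2))
    ∂(Measure.pi fun _ : Fin n => (law f).prod (law g))

end Deconvolution

end

open Deconvolution

/-! Both rates come from Assouad's lemma, applied to a hypercube of densities that are easy to tell
apart in $L_2$ but hard to tell apart after convolution with $f_\delta$. Let $p$ be a density whose
Fourier transform $K$ is $C^1$ and supported in $[-1,1]$. The edges are $a\,h\,p(hx)\cos(\lambda_j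
x)$. Their transforms live in windows of half-width $h$ about $\pm\lambda_j$, so they are orthogonal
when the $\lambda_j$ are at least $2h$ apart, have squared norm of order $a^2h$, and integrate to
zero. If $|f_\delta^{\rm ft}|\le A$ and $|(f_\delta^{\rm ft})'|\le A/h$ on the windows, then
convolution with $f_\delta$ leaves a perturbation $D$ with $\int(1+h^2x^2)D^2\lesssim a^2hA^2$, by
Plancherel applied to the transform and to its derivative.

To turn this into a chi-square bound, the density of one observation must be at least of order
$h/(1+h^2x^2)$. The centre of the hypercube therefore contains a mixture of the dilates of $p$ by
$h,h/2,\dots,h/2^J$ with weights proportional to $2^{-i}$. It has this Cauchy lower bound on a range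
that grows with $J$, while its transform stays supported in $[-h,h]$, bounded by 1, with derivative
bounded in $L^1$ independently of $h$ and $J$. The chi-square distance of neighbouring vertices is
then of order $a^2A^2$ plus a tail that a large $J$ makes negligible. Hence the risk over $N$ edges
is at least of order $Na^2h$ as soon as $na^2A^2$ is small: this is `family_lower_bound`, which
combines `assouad`, `exists_le_mix` and `lintegral_weighted_sq_dconv_bump_le`.

The rate $n^{-1/(2\mu)}$ uses one edge of fixed amplitude at $\lambda=T$. There $A\asymp h^\mu$, so
$h\asymp n^{-1/(2\mu)}$ is allowed, and the risk is of order $h$. The other rate uses $h=1$ and $M$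
edges with frequencies of order $M$. Smoothness allows $a\asymp M^{-\beta-1/2}$, ill-posedness gives
$A\asymp M^{-\nu}$, so $M\asymp n^{1/(2\beta+2\nu+1)}$, and the risk is of order $Ma^2\asymp
M^{-2\beta}$.

It remains to place the hypercube inside the class. The rest of the centre is a wide Gaussian. For
$\mathcal F^3$ its transform meets the decay condition with any prescribed constant. For $\mathcal
F^2$, every member has functional greater than 1 (`one_lt_of_mem_classF2`), while wide Gaussians
have functional close to 1 (`exists_gaussSmoothness_lt`); so a non-empty class leaves room for a
small perturbation. The lower bounds hold for all large $n$, not only along a subsequence. -/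

namespace Deconvolution

/-! ### Construction of a band-limited density. -/

section

open scoped FourierTransform SchwartzMap Convolution ContDiff

/-- `p` is a probability density, positive at the origin, whose Fourier transform `K` is
continuously differentiable and vanishes outside `[-1, 1]`. -/
structure IsBandlimitedDensity (p : ℝ → ℝ) (K : ℝ → ℂ) : Prop where
  continuous : Continuous p
  density : IsProbDensity p
  ft_eq : ∀ t, ft p t = K t
  inversion : ∀ x, (p x : ℂ) =
    (2 * Real.pi)⁻¹ * ∫ t : ℝ, K t * Complex.exp (-((t * x : ℝ) : ℂ) * Complex.I)
  contDiff : ContDiff ℝ 1 K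
  eq_zero : ∀ t, 1 ≤ |t| → K t = 0
  pos : 0 < p 0

/-- Even and real, so that the transform of `u` is real; vanishing from $|x|=1/2$ on, so that $u*u$
vanishes from $|x|=1$ on; nonzero transform at 0, so that the final density is positive there. -/
theorem exists_even_schwartz : ∃ u : 𝓢(ℝ, ℂ), (∀ x, 1 / 2 ≤ |x| → u x = 0) ∧ (∀ x, u (-x) = u x) ∧
    (∀ x, (starRingEnd ℂ) (u x) = u x) ∧ 𝓕 u 0 ≠ 0 := by
  let b : ContDiffBump (0 : ℝ) := ⟨1 / 4, 1 / 2, by norm_num, by norm_num⟩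
  have hsmooth : ContDiff ℝ ∞ fun x => (b x : ℂ) := Complex.ofRealCLM.contDiff.comp b.contDiff
  have hcs : HasCompactSupport fun x => (b x : ℂ) :=
    b.hasCompactSupport.comp_left Complex.ofReal_zero
  refine ⟨hcs.toSchwartzMap hsmooth, fun x hx => ?_, fun x => ?_, fun x => ?_, ?_⟩
  · simp only [HasCompactSupport.toSchwartzMap_toFun]
    rw [b.zero_of_le_dist (by simpa [Real.dist_eq, b] using hx)]
    simp
  · simp only [HasCompactSupport.toSchwartzMap_toFun]
    rw [b.neg]
  · simp only [HasCompactSupport.toSchwartzMap_toFun, Complex.conj_ofReal]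
  · rw [SchwartzMap.fourier_coe, Real.fourier_eq']
    have : (∫ v : ℝ, Complex.exp ((-2 * Real.pi * inner ℝ v (0 : ℝ) : ℝ) * Complex.I) •
        (hcs.toSchwartzMap hsmooth) v) = ((∫ v, b v : ℝ) : ℂ) := by
      rw [← integral_complex_ofReal]
      simp
    rw [this]
    exact_mod_cast b.integral_pos.ne'

/-- A passage between normalisations: Mathlib's transform carries $2\pi$ in the exponent, `ft` does
not. Rescaling by $2\pi$ and dividing by the mass $Z=\int w=k(0)$ makes `w` a density. -/
theorem isBandlimitedDensity_of_transform {w : ℝ → ℝ} {k : ℝ → ℂ} (hwcont : Continuous w)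
    (hw : ∀ y, 0 ≤ w y) (hw0 : 0 < w 0) (hwint : Integrable w) (hk : ContDiff ℝ 1 k)
    (hsupp : ∀ t, 1 ≤ |t| → k t = 0)
    (hkinv : ∀ t, k t = ∫ y : ℝ, Complex.exp ((2 * Real.pi * (y * t) : ℝ) * Complex.I) * w y)
    (hfwd : ∀ y, (w y : ℂ) = ∫ t : ℝ, k t * Complex.exp (-(2 * Real.pi * (t * y) : ℝ) * Complex.I)) :
    ∃ p K, IsBandlimitedDensity p K := by
  set Z : ℝ := ∫ y, w y with hZ
  have hZpos : 0 < Z := integral_pos_of_integrable_nonneg_nonzero hwcont hwint hw hw0.ne'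
  have hk0 : k 0 = Z := by
    rw [hkinv, hZ, ← integral_complex_ofReal]
    simp
  have hpi := Real.pi_pos
  have hpint : Integrable fun x => w (x / (2 * Real.pi)) / (2 * Real.pi * Z) :=
    (hwint.comp_div (by positivity)).div_const _
  have hft : ∀ t, ft (fun x => w (x / (2 * Real.pi)) / (2 * Real.pi * Z)) t = k t / Z := by
    intro t
    have := Measure.integral_comp_div (fun y : ℝ =>
      Complex.exp ((2 * Real.pi * (y * t) : ℝ) * Complex.I) * w y / Z / (2 * Real.pi))
      (2 * Real.pi)
    rw [hkinv, ft]
    calc _ = _ := ?_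
      _ = _ := this
      _ = _ := ?_
    · refine integral_congr_ae (Eventually.of_forall fun v => ?_)
      simp only
      have : 2 * Real.pi * (v / (2 * Real.pi) * t) = t * v := by field_simp
      rw [this]
      push_cast
      field_simp
    · rw [integral_div, integral_div, abs_of_pos (by positivity), Complex.real_smul]
      generalize (∫ y : ℝ, Complex.exp ((2 * Real.pi * (y * t) : ℝ) * Complex.I) * w y) = I
      push_cast
      have : (Real.pi : ℂ) ≠ 0 := by exact_mod_cast hpi.ne'
      field_simp
  have hK0 : ft (fun x => w (x / (2 * Real.pi)) / (2 * Real.pi * Z)) 0 = 1 := by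
    rw [hft, hk0, div_self (by exact_mod_cast hZpos.ne')]
  refine ⟨fun x => w (x / (2 * Real.pi)) / (2 * Real.pi * Z), fun t => k t / Z, by fun_prop,
    ⟨by fun_prop, fun x => div_nonneg (hw _) (by positivity), hpint, ?_⟩, hft, ?_,
    hk.div_const _, fun t ht => by simp [hsupp t ht], ?_⟩
  · rw [ft, ← Complex.ofReal_one] at hK0
    simp only [zero_mul, Complex.ofReal_zero, Complex.exp_zero, one_mul] at hK0
    rw [integral_complex_ofReal] at hK0
    exact_mod_cast hK0
  · intro x
    have h2 : ∀ t : ℝ, k t / Z * Complex.exp (-((t * x : ℝ) : ℂ) * Complex.I) =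
        k t * Complex.exp (-(2 * Real.pi * (t * (x / (2 * Real.pi))) : ℝ) * Complex.I) / Z := by
      intro t
      have : 2 * Real.pi * (t * (x / (2 * Real.pi))) = t * x := by field_simp
      rw [this]
      ring
    simp_rw [h2]
    rw [integral_div, ← hfwd]
    push_cast
    field_simp
  · simp only [zero_div]
    positivity

/-- For $k=u*u$ the transform is $(\mathcal F u)^2$. Since $\mathcal F u$ is real, this is
$|\mathcal F u|^2\ge0$, so it can serve as an unnormalised density whose own transform is the
compactly supported $k$. -/
theorem exists_isBandlimitedDensity : ∃ p K, IsBandlimitedDensity p K := by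
  obtain ⟨u, hsupp, heven, hreal, hne⟩ := exists_even_schwartz
  set k : 𝓢(ℝ, ℂ) := SchwartzMap.convolution (ContinuousLinearMap.mul ℂ ℂ) u u with hk
  have hconj : ∀ ξ, (starRingEnd ℂ) (𝓕 u ξ) = 𝓕 u ξ := by
    intro ξ
    rw [SchwartzMap.fourier_coe, Real.fourier_eq', ← integral_conj,
      ← integral_neg_eq_self]
    refine integral_congr_ae (Eventually.of_forall fun v => ?_)
    simp only [smul_eq_mul, map_mul, heven, hreal, ← Complex.exp_conj, Complex.conj_I,
      Complex.conj_ofReal]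
    congr 2
    simp [mul_comm]
  have hkF : ∀ ξ, 𝓕 k ξ = ((‖𝓕 u ξ‖ ^ 2 : ℝ) : ℂ) := by
    intro ξ
    rw [SchwartzMap.fourier_convolution_apply, Real.fourier_mul_convolution_eq u.integrable
      u.integrable, ← SchwartzMap.fourier_coe]
    push_cast
    rw [← Complex.mul_conj', hconj]
  have hcont := (𝓕 u).continuous
  have hint : Integrable fun ξ => ((‖𝓕 u ξ‖ ^ 2 : ℝ) : ℂ) :=
    (𝓕 k).integrable.congr (Eventually.of_forall hkF)
  refine isBandlimitedDensity_of_transform (w := fun ξ => ‖𝓕 u ξ‖ ^ 2) (k := k) (by fun_prop)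
    (fun y => by positivity) (by positivity) hint.re (k.smooth 1) ?_ ?_ ?_
  · intro t ht
    rw [hk, SchwartzMap.convolution_apply, convolution_def]
    refine integral_eq_zero_of_ae (Eventually.of_forall fun s => ?_)
    rcases le_or_gt (1 / 2) |s| with hs | hs
    · simp [hsupp s hs]
    · have : 1 / 2 ≤ |t - s| := by
        have := abs_sub_abs_le_abs_sub t s
        linarith
      simp [hsupp _ this]
  · intro t
    have h1 : 𝓕⁻ (𝓕 k) t = k t := by simp
    rw [← h1, SchwartzMap.fourierInv_coe, Real.fourierInv_eq']
    refine integral_congr_ae (Eventually.of_forall fun v => ?_)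
    simp [hkF, mul_comm]
  · intro y
    rw [← hkF, SchwartzMap.fourier_coe, Real.fourier_eq']
    refine integral_congr_ae (Eventually.of_forall fun v => ?_)
    simp [mul_comm]

end

/-! ### Plancherel's inequality, unweighted and with weight $1+h^2x^2$. -/

section

/-- The Fourier integral with the sign opposite to `ft`, for complex functions. -/
noncomputable def invft (ψ : ℝ → ℂ) (x : ℝ) : ℂ :=
  ∫ t : ℝ, ψ t * Complex.exp (-((t * x : ℝ) : ℂ) * Complex.I)

theorem norm_exp_neg_mul_I (r : ℝ) : ‖Complex.exp (-(r : ℂ) * Complex.I)‖ = 1 := by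
  rw [← Complex.ofReal_neg, Complex.norm_exp_ofReal_mul_I]

theorem continuous_invft {ψ : ℝ → ℂ} (hψ : Integrable ψ) : Continuous (invft ψ) := by
  refine continuous_of_dominated (bound := fun t => ‖ψ t‖) (fun x => ?_) (fun x => ?_) hψ.norm ?_
  · exact hψ.aestronglyMeasurable.mul (by fun_prop)
  · refine Eventually.of_forall fun t => ?_
    rw [norm_mul, norm_exp_neg_mul_I, mul_one]
  · refine Eventually.of_forall fun t => ?_
    fun_prop

theorem norm_invft_le (ψ : ℝ → ℂ) (x : ℝ) : ‖invft ψ x‖ ≤ ∫ t, ‖ψ t‖ := by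
  refine (norm_integral_le_integral_norm _).trans (le_of_eq ?_)
  simp_rw [norm_mul, norm_exp_neg_mul_I, mul_one]

/-- The Fourier transform of `exp (-ε x²)`. -/
noncomputable def gaussTransform (ε u : ℝ) : ℝ := √(Real.pi / ε) * Real.exp (-(1 / (4 * ε)) * u ^ 2)

theorem gaussTransform_nonneg (ε u : ℝ) : 0 ≤ gaussTransform ε u := by
  unfold gaussTransform; positivity

theorem integral_exp_mul_gauss {ε : ℝ} (hε : 0 < ε) (u : ℝ) :
    ∫ x : ℝ, Complex.exp (-((u * x : ℝ) : ℂ) * Complex.I) * (Real.exp (-ε * x ^ 2) : ℂ) =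
      gaussTransform ε u := by
  have := fourierIntegral_gaussian (b := (ε : ℂ)) (by simpa using hε) (-u : ℂ)
  calc _ = _ := ?_
    _ = _ := this
    _ = _ := ?_
  · refine integral_congr_ae (Eventually.of_forall fun x => ?_)
    push_cast
    ring_nf
  · unfold gaussTransform
    rw [← Complex.ofReal_div, show (1 / 2 : ℂ) = ((1 / 2 : ℝ) : ℂ) by simp,
      ← Complex.ofReal_cpow (by positivity), ← Real.sqrt_eq_rpow]
    push_cast
    congr 2
    ring

theorem lintegral_gaussTransform_sub {ε : ℝ} (hε : 0 < ε) (a : ℝ) :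
    ∫⁻ y : ℝ, ENNReal.ofReal (gaussTransform ε (a - y)) = ENNReal.ofReal (2 * Real.pi) := by
  rw [lintegral_sub_left_eq_self (fun y => ENNReal.ofReal (gaussTransform ε y)),
    ← ofReal_integral_eq_lintegral_ofReal (f := gaussTransform ε)
      ((integrable_exp_neg_mul_sq (b := 1 / (4 * ε)) (by positivity)).const_mul _)
      (Eventually.of_forall fun u => gaussTransform_nonneg ε u)]
  unfold gaussTransform
  rw [integral_const_mul, integral_gaussian, ← Real.sqrt_mul (by positivity)]
  congr 1
  rw [show Real.pi / ε * (Real.pi / (1 / (4 * ε))) = (2 * Real.pi) ^ 2 by field_simp; ring,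
    Real.sqrt_sq (by positivity)]

theorem gaussTransform_neg (ε u : ℝ) : gaussTransform ε (-u) = gaussTransform ε u := by
  simp [gaussTransform]

theorem measurable_gaussTransform (ε : ℝ) : Measurable (gaussTransform ε) := by
  unfold gaussTransform; fun_prop

/-- A Schur test: $2|\psi(s)\psi(t)|\le|\psi(s)|^2+|\psi(t)|^2$, and the Gaussian kernel has
integral $2\pi$ in each variable, whatever $\varepsilon$ is. -/
theorem lintegral_mul_gaussTransform_le {ψ : ℝ → ℂ} (hψm : Measurable ψ) {ε : ℝ} (hε : 0 < ε) :
    ∫⁻ z : ℝ × ℝ, ENNReal.ofReal (‖ψ z.1‖ * ‖ψ z.2‖ * gaussTransform ε (z.1 - z.2)) ≤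
      ENNReal.ofReal (2 * Real.pi) * ∫⁻ t, ENNReal.ofReal (‖ψ t‖ ^ 2) := by
  have hG := measurable_gaussTransform ε
  have h1 : ∫⁻ z : ℝ × ℝ, ENNReal.ofReal (‖ψ z.1‖ ^ 2) *
      ENNReal.ofReal (gaussTransform ε (z.1 - z.2)) =
      ENNReal.ofReal (2 * Real.pi) * ∫⁻ t, ENNReal.ofReal (‖ψ t‖ ^ 2) := by
    rw [Measure.volume_eq_prod, lintegral_prod _ (by fun_prop), ← lintegral_const_mul _ (by fun_prop)]
    refine lintegral_congr fun s => ?_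
    simp only
    rw [lintegral_const_mul _ (by fun_prop), lintegral_gaussTransform_sub hε, mul_comm]
  have h2 : ∫⁻ z : ℝ × ℝ, ENNReal.ofReal (‖ψ z.2‖ ^ 2) *
      ENNReal.ofReal (gaussTransform ε (z.1 - z.2)) =
      ENNReal.ofReal (2 * Real.pi) * ∫⁻ t, ENNReal.ofReal (‖ψ t‖ ^ 2) := by
    rw [Measure.volume_eq_prod, lintegral_prod_symm _ (by fun_prop),
      ← lintegral_const_mul _ (by fun_prop)]
    refine lintegral_congr fun s => ?_
    simp_rw [← neg_sub s, gaussTransform_neg]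
    rw [lintegral_const_mul _ (by fun_prop), lintegral_gaussTransform_sub hε, mul_comm]
  have h3 : ∀ z : ℝ × ℝ, 2 * ENNReal.ofReal (‖ψ z.1‖ * ‖ψ z.2‖ * gaussTransform ε (z.1 - z.2)) ≤
      ENNReal.ofReal (‖ψ z.1‖ ^ 2) * ENNReal.ofReal (gaussTransform ε (z.1 - z.2)) +
      ENNReal.ofReal (‖ψ z.2‖ ^ 2) * ENNReal.ofReal (gaussTransform ε (z.1 - z.2)) := by
    intro z
    have hg := gaussTransform_nonneg ε (z.1 - z.2)
    rw [← add_mul, ← ENNReal.ofReal_add (by positivity) (by positivity),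
      ← ENNReal.ofReal_mul (by positivity), ← ENNReal.ofReal_ofNat, ← ENNReal.ofReal_mul (by simp)]
    refine ENNReal.ofReal_le_ofReal ?_
    rw [← mul_assoc]
    refine mul_le_mul_of_nonneg_right ?_ hg
    nlinarith [sq_nonneg (‖ψ z.1‖ - ‖ψ z.2‖)]
  have h4 := lintegral_mono (μ := volume) h3
  rw [lintegral_add_left (by fun_prop), h1, h2, ← two_mul,
    lintegral_const_mul _ (by fun_prop)] at h4
  exact (ENNReal.mul_le_mul_iff_right (by simp) (by simp)).1 h4

/-- The square is expanded as a double integral over frequencies. The Gaussian factor makes the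
triple integral absolutely convergent, so the integral over $x$ can be done first and leaves a
Gaussian kernel. -/
theorem lintegral_sq_invft_mul_gauss_le {ψ : ℝ → ℂ} (hψm : Measurable ψ) (hψ : Integrable ψ)
    {ε : ℝ} (hε : 0 < ε) :
    ∫⁻ x, ENNReal.ofReal (‖invft ψ x‖ ^ 2 * Real.exp (-ε * x ^ 2)) ≤
      ENNReal.ofReal (2 * Real.pi) * ∫⁻ t, ENNReal.ofReal (‖ψ t‖ ^ 2) := by
  set Φ : ℝ → ℝ × ℝ → ℂ := fun x z =>
    (ψ z.1 * (starRingEnd ℂ) (ψ z.2)) * (Complex.exp (-(((z.1 - z.2) * x : ℝ) : ℂ) * Complex.I) *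
      (Real.exp (-ε * x ^ 2) : ℂ)) with hΦ
  have hconj : Integrable fun t => (starRingEnd ℂ) (ψ t) :=
    (integrable_norm_iff (by fun_prop)).1 (by simpa using hψ.norm)
  have hprod : Integrable fun z : ℝ × ℝ => ψ z.1 * (starRingEnd ℂ) (ψ z.2) := hψ.mul_prod hconj
  have hgauss : Integrable fun x : ℝ => (Real.exp (-ε * x ^ 2) : ℂ) :=
    (integrable_exp_neg_mul_sq hε).ofReal
  have hΦint : Integrable (Function.uncurry Φ) := by
    have hm : Measurable (Function.uncurry Φ) := by
      simp only [hΦ]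
      fun_prop
    refine (hgauss.mul_prod hprod).mono hm.aestronglyMeasurable (Eventually.of_forall fun q => ?_)
    simp only [Function.uncurry, hΦ, norm_mul, norm_exp_neg_mul_I, one_mul]
    rw [mul_comm]
  have hE : ∀ x, ((‖invft ψ x‖ ^ 2 * Real.exp (-ε * x ^ 2) : ℝ) : ℂ) = ∫ z, Φ x z := by
    intro x
    rw [Complex.ofReal_mul, Complex.ofReal_pow, ← Complex.mul_conj']
    unfold invft
    rw [← integral_conj, ← integral_prod_mul, ← integral_mul_const]
    refine integral_congr_ae (Eventually.of_forall fun z => ?_)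
    simp only [hΦ, map_mul, ← Complex.exp_conj, Complex.conj_ofReal, Complex.conj_I, map_neg]
    rw [show -((((z.1 - z.2) * x : ℝ)) : ℂ) * Complex.I = -((z.1 * x : ℝ) : ℂ) * Complex.I +
      -((z.2 * x : ℝ) : ℂ) * -Complex.I by push_cast; ring, Complex.exp_add]
    ring
  have hinner : ∀ z : ℝ × ℝ, ∫ x, Φ x z =
      (ψ z.1 * (starRingEnd ℂ) (ψ z.2)) * gaussTransform ε (z.1 - z.2) := by
    intro z
    simp only [hΦ]
    rw [integral_const_mul, integral_exp_mul_gauss hε]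
  have hfin : Integrable fun x => ((‖invft ψ x‖ ^ 2 * Real.exp (-ε * x ^ 2) : ℝ) : ℂ) := by
    simp_rw [hE]
    exact hΦint.integral_prod_left
  have hfin' : Integrable fun x => ‖invft ψ x‖ ^ 2 * Real.exp (-ε * x ^ 2) := hfin.re
  rw [← ofReal_integral_eq_lintegral_ofReal hfin' (Eventually.of_forall fun x => by positivity)]
  have hswap : ((∫ x, ‖invft ψ x‖ ^ 2 * Real.exp (-ε * x ^ 2) : ℝ) : ℂ) =
      ∫ z : ℝ × ℝ, (ψ z.1 * (starRingEnd ℂ) (ψ z.2)) * gaussTransform ε (z.1 - z.2) := by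
    rw [← integral_complex_ofReal]
    simp_rw [hE, ← hinner]
    exact integral_integral_swap hΦint
  have hnn : 0 ≤ ∫ x, ‖invft ψ x‖ ^ 2 * Real.exp (-ε * x ^ 2) :=
    integral_nonneg fun x => by positivity
  calc ENNReal.ofReal (∫ x, ‖invft ψ x‖ ^ 2 * Real.exp (-ε * x ^ 2))
      = ‖((∫ x, ‖invft ψ x‖ ^ 2 * Real.exp (-ε * x ^ 2) : ℝ) : ℂ)‖ₑ := by
        rw [← ofReal_norm, Complex.norm_real, Real.norm_of_nonneg hnn]
    _ ≤ _ := by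
        rw [hswap]
        refine (enorm_integral_le_lintegral_enorm _).trans (le_trans (le_of_eq ?_)
          (lintegral_mul_gaussTransform_le hψm hε))
        refine lintegral_congr fun z => ?_
        rw [← ofReal_norm, norm_mul, norm_mul, Complex.norm_real, RCLike.norm_conj,
          Real.norm_of_nonneg (gaussTransform_nonneg _ _)]

/-- One half of Plancherel's theorem, for integrable functions. -/
theorem lintegral_sq_invft_le {ψ : ℝ → ℂ} (hψm : Measurable ψ) (hψ : Integrable ψ) :
    ∫⁻ x, ENNReal.ofReal (‖invft ψ x‖ ^ 2) ≤
      ENNReal.ofReal (2 * Real.pi) * ∫⁻ t, ENNReal.ofReal (‖ψ t‖ ^ 2) := by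
  have hc := continuous_invft hψ
  have hlim : ∀ x, Tendsto (fun m : ℕ => ENNReal.ofReal
      (‖invft ψ x‖ ^ 2 * Real.exp (-(1 / ((m : ℝ) + 1)) * x ^ 2))) atTop
      (𝓝 (ENNReal.ofReal (‖invft ψ x‖ ^ 2))) := by
    intro x
    refine (ENNReal.continuous_ofReal.tendsto _).comp ?_
    have := ((((tendsto_one_div_add_atTop_nhds_zero_nat (𝕜 := ℝ)).neg.mul_const (x ^ 2)).rexp).const_mul
      (‖invft ψ x‖ ^ 2))
    simpa using this
  calc ∫⁻ x, ENNReal.ofReal (‖invft ψ x‖ ^ 2)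
      = ∫⁻ x, liminf (fun m : ℕ => ENNReal.ofReal
        (‖invft ψ x‖ ^ 2 * Real.exp (-(1 / ((m : ℝ) + 1)) * x ^ 2))) atTop :=
        lintegral_congr fun x => (hlim x).liminf_eq.symm
    -- Fatou's lemma along $\varepsilon=1/(m+1)\to0$; the regularised bound does not depend on
    -- $\varepsilon$.
    _ ≤ liminf (fun m : ℕ => ∫⁻ x, ENNReal.ofReal
        (‖invft ψ x‖ ^ 2 * Real.exp (-(1 / ((m : ℝ) + 1)) * x ^ 2))) atTop :=
        lintegral_liminf_le fun m => by fun_prop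
    _ ≤ _ := by
        refine liminf_le_of_frequently_le' (Frequently.of_forall fun m => ?_)
        exact lintegral_sq_invft_mul_gauss_le hψm hψ (by positivity)

/-- Integration by parts. Continuity of `ψ` makes one exceptional point `c` harmless; it is needed
because the transform of the error density may fail to be differentiable at $T$. -/
theorem mul_invft_eq {ψ ψ' : ℝ → ℂ} {a b c : ℝ} (hab : a < b) (hψc : Continuous ψ)
    (hzero : ∀ t, t ∉ Set.Ioo a b → ψ t = 0) (hψ' : Integrable ψ')
    (hzero' : ∀ t, t ∉ Set.Ioo a b → ψ' t = 0)
    (hderiv : ∀ t ∈ Set.Ioo a b, t ≠ c → HasDerivAt ψ (ψ' t) t) (x : ℝ) :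
    (x : ℂ) * invft ψ x = -Complex.I * invft ψ' x := by
  have hex : ∀ t : ℝ, HasDerivAt (fun t : ℝ => Complex.exp (-((t * x : ℝ) : ℂ) * Complex.I))
      (Complex.exp (-((t * x : ℝ) : ℂ) * Complex.I) * (-(x : ℂ) * Complex.I)) t := by
    intro t
    refine HasDerivAt.cexp ?_
    have : HasDerivAt (fun t : ℝ => t * x) (1 * x) t := (hasDerivAt_id t).mul_const x
    simpa using this.ofReal_comp.neg.mul_const Complex.I
  have hψ'e : Integrable fun t => ψ' t * Complex.exp (-((t * x : ℝ) : ℂ) * Complex.I) :=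
    hψ'.mono (hψ'.aestronglyMeasurable.mul (by fun_prop)) (Eventually.of_forall fun t => by
      rw [norm_mul, norm_exp_neg_mul_I, mul_one])
  have hc : Continuous fun t => ψ t * (Complex.exp (-((t * x : ℝ) : ℂ) * Complex.I) *
    (-(x : ℂ) * Complex.I)) := by fun_prop
  have key := integral_eq_of_hasDerivAt_off_countable
    (fun t => ψ t * Complex.exp (-((t * x : ℝ) : ℂ) * Complex.I))
    (fun t => ψ' t * Complex.exp (-((t * x : ℝ) : ℂ) * Complex.I) +
      ψ t * (Complex.exp (-((t * x : ℝ) : ℂ) * Complex.I) * (-(x : ℂ) * Complex.I)))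
    (a := a) (b := b) (Set.countable_singleton c) (by fun_prop) (fun t ht => by
      rw [min_eq_left hab.le, max_eq_right hab.le] at ht
      exact (hderiv t ht.1 ht.2).mul (hex t))
    (hψ'e.intervalIntegrable.add (hc.intervalIntegrable _ _))
  rw [intervalIntegral.integral_add hψ'e.intervalIntegrable (hc.intervalIntegrable _ _),
    hzero a (by simp), hzero b (by simp)] at key
  have toR : ∀ F : ℝ → ℂ, (∀ t, t ∉ Set.Ioo a b → F t = 0) → ∫ t in a..b, F t = ∫ t, F t := by
    intro F hF
    rw [intervalIntegral.integral_of_le hab.le]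
    refine setIntegral_eq_integral_of_forall_compl_eq_zero fun t ht => hF t fun h => ht ?_
    exact Set.Ioo_subset_Ioc_self h
  rw [toR _ fun t ht => by rw [hzero' t ht, zero_mul], toR _ fun t ht => by rw [hzero t ht, zero_mul]]
    at key
  simp_rw [← mul_assoc] at key
  rw [integral_mul_const, integral_mul_const] at key
  unfold invft
  linear_combination Complex.I * key + x * (∫ t, ψ t *
    Complex.exp (-((t * x : ℝ) : ℂ) * Complex.I)) * Complex.I_sq

/-- Multiplication by $x$ becomes differentiation of `ψ`, so the weighted integral is
$\|\check\psi\|^2+h^2\|\check\psi'\|^2$, and Plancherel applies to each term on an interval of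
length $b-a$. -/
theorem lintegral_weighted_sq_invft_le {ψ : ℝ → ℂ} {a b c A B h : ℝ} (hab : a < b)
    (hψc : Continuous ψ) (hzero : ∀ t, t ∉ Set.Ioo a b → ψ t = 0)
    (hdiff : ∀ t ∈ Set.Ioo a b, t ≠ c → DifferentiableAt ℝ ψ t)
    (hA : ∀ t ∈ Set.Ioo a b, ‖ψ t‖ ≤ A) (hB : ∀ t ∈ Set.Ioo a b, t ≠ c → ‖deriv ψ t‖ ≤ B) :
    ∫⁻ x, ENNReal.ofReal ((1 + h ^ 2 * x ^ 2) * ‖invft ψ x‖ ^ 2) ≤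
      ENNReal.ofReal (2 * Real.pi * (b - a) * (A ^ 2 + h ^ 2 * B ^ 2)) := by
  -- The derivative is set to zero at `c`, where `B` gives no control of it.
  set ψ' : ℝ → ℂ := (Set.Ioo a b \ {c}).indicator (deriv ψ) with hψ'
  have hmS : MeasurableSet (Set.Ioo a b \ {c}) := measurableSet_Ioo.diff (measurableSet_singleton c)
  have hψ'm : Measurable ψ' := (measurable_deriv ψ).indicator hmS
  have hbound : ∀ (F : ℝ → ℂ) (C : ℝ), (∀ t, t ∉ Set.Ioo a b → F t = 0) →
      (∀ t ∈ Set.Ioo a b, ‖F t‖ ≤ C) → ∫⁻ t, ENNReal.ofReal (‖F t‖ ^ 2) ≤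
        ENNReal.ofReal ((b - a) * C ^ 2) := by
    intro F C h0 hC
    calc ∫⁻ t, ENNReal.ofReal (‖F t‖ ^ 2)
        ≤ ∫⁻ t, (Set.Ioo a b).indicator (fun _ => ENNReal.ofReal (C ^ 2)) t := by
          refine lintegral_mono fun t => ?_
          by_cases ht : t ∈ Set.Ioo a b
          · rw [Set.indicator_of_mem ht]
            exact ENNReal.ofReal_le_ofReal (pow_le_pow_left₀ (norm_nonneg _) (hC t ht) 2)
          · simp [h0 t ht]
      _ = _ := by
          rw [lintegral_indicator measurableSet_Ioo, setLIntegral_const, Real.volume_Ioo, mul_comm,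
            ENNReal.ofReal_mul (by linarith)]
  have hint : ∀ (F : ℝ → ℂ) (C : ℝ), Measurable F → (∀ t, t ∉ Set.Ioo a b → F t = 0) →
      (∀ t ∈ Set.Ioo a b, ‖F t‖ ≤ C) → Integrable F := by
    intro F C hm h0 hC
    have : IntegrableOn F (Set.Ioo a b) :=
      Measure.integrableOn_of_bounded (by simp) hm.aestronglyMeasurable
        ((ae_restrict_iff' measurableSet_Ioo).2 (Eventually.of_forall hC))
    rw [← integrable_indicator_iff measurableSet_Ioo] at this
    rwa [Set.indicator_eq_self.2] at this
    intro t ht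
    by_contra hn
    exact ht (h0 t hn)
  have h0' : ∀ t, t ∉ Set.Ioo a b → ψ' t = 0 := fun t ht =>
    Set.indicator_of_notMem (fun h => ht h.1) _
  have hA0 : 0 ≤ A := (norm_nonneg _).trans (hA ((a + b) / 2) ⟨by linarith, by linarith⟩)
  have hB0 : 0 ≤ B := by
    obtain ⟨t, ht, htc⟩ := (Set.Ioo_infinite hab).exists_notMem_finset {c}
    exact (norm_nonneg _).trans (hB t ht (by simpa using htc))
  have hB' : ∀ t ∈ Set.Ioo a b, ‖ψ' t‖ ≤ B := by
    intro t ht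
    by_cases htc : t = c
    · simpa [hψ', htc] using hB0
    · rw [hψ', Set.indicator_of_mem (show t ∈ Set.Ioo a b \ {c} from ⟨ht, htc⟩)]
      exact hB t ht htc
  have i1 := hint ψ A hψc.measurable hzero hA
  have i2 := hint ψ' B hψ'm h0' hB'
  have hmul := mul_invft_eq (c := c) hab hψc hzero i2 h0' fun t ht htc => by
    rw [hψ', Set.indicator_of_mem (show t ∈ Set.Ioo a b \ {c} from ⟨ht, htc⟩)]
    exact (hdiff t ht htc).hasDerivAt
  have hnorm : ∀ x, (1 + h ^ 2 * x ^ 2) * ‖invft ψ x‖ ^ 2 =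
      ‖invft ψ x‖ ^ 2 + h ^ 2 * ‖invft ψ' x‖ ^ 2 := by
    intro x
    have := congrArg (fun z => ‖z‖ ^ 2) (hmul x)
    simp only [norm_mul, mul_pow, Complex.norm_real, Real.norm_eq_abs, sq_abs, norm_neg,
      Complex.norm_I, one_mul] at this
    linear_combination h ^ 2 * this
  have c1 := continuous_invft i1
  have c2 := continuous_invft i2
  calc ∫⁻ x, ENNReal.ofReal ((1 + h ^ 2 * x ^ 2) * ‖invft ψ x‖ ^ 2)
      = ∫⁻ x, (ENNReal.ofReal (‖invft ψ x‖ ^ 2) +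
          ENNReal.ofReal (h ^ 2) * ENNReal.ofReal (‖invft ψ' x‖ ^ 2)) := by
        refine lintegral_congr fun x => ?_
        rw [hnorm, ENNReal.ofReal_add (by positivity) (by positivity),
          ENNReal.ofReal_mul (by positivity)]
    _ ≤ ENNReal.ofReal (2 * Real.pi) * ENNReal.ofReal ((b - a) * A ^ 2) + ENNReal.ofReal (h ^ 2) *
        (ENNReal.ofReal (2 * Real.pi) * ENNReal.ofReal ((b - a) * B ^ 2)) := by
        rw [lintegral_add_left (by fun_prop), lintegral_const_mul _ (by fun_prop)]
        gcongr
        · exact (lintegral_sq_invft_le hψc.measurable i1).trans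
            (mul_le_mul_right (hbound ψ A hzero hA) _)
        · exact (lintegral_sq_invft_le hψ'm i2).trans (mul_le_mul_right (hbound ψ' B h0' hB') _)
    _ = _ := by
        have hba : 0 ≤ b - a := by linarith
        rw [← ENNReal.ofReal_mul (by positivity), ← ENNReal.ofReal_mul (by positivity),
          ← ENNReal.ofReal_mul (by positivity), ← ENNReal.ofReal_add (by positivity) (by positivity)]
        congr 1
        ring

end

/-! ### Testing two product measures, and the law of the observations. -/

section

theorem lintegral_pi_prod {ι : Type*} [Fintype ι] (P : Measure ℝ) [IsProbabilityMeasure P]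
    {F : ι → ℝ → ℝ≥0∞} (hF : ∀ i, Measurable (F i)) :
    ∫⁻ w, ∏ i, F i (w i) ∂(Measure.pi fun _ : ι => P) = ∏ i, ∫⁻ x, F i x ∂P := by
  have hind : ProbabilityTheory.iIndepFun (fun i (w : ι → ℝ) => F i (w i))
      (Measure.pi fun _ : ι => P) :=
    ProbabilityTheory.iIndepFun_pi (X := F) fun i => (hF i).aemeasurable
  rw [ProbabilityTheory.lintegral_prod_eq_prod_lintegral_of_indepFun Finset.univ
    (fun i (w : ι → ℝ) => F i (w i)) hind fun i => (hF i).comp (measurable_pi_apply i)]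
  refine Finset.prod_congr rfl fun i _ => ?_
  exact (measurePreserving_eval (fun _ : ι => P) i).lintegral_comp (hF i)

theorem pi_withDensity {ι : Type*} [Fintype ι] (P : Measure ℝ) [IsProbabilityMeasure P]
    {ℓ : ℝ → ℝ≥0∞} (hℓ : Measurable ℓ) [SigmaFinite (P.withDensity ℓ)] :
    (Measure.pi fun _ : ι => P.withDensity ℓ) =
      (Measure.pi fun _ : ι => P).withDensity fun w => ∏ i, ℓ (w i) := by
  refine Measure.pi_eq fun s hs => ?_
  rw [withDensity_apply _ (MeasurableSet.univ_pi hs),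
    ← lintegral_indicator (MeasurableSet.univ_pi hs)]
  have : ∀ w : ι → ℝ, (Set.univ.pi s).indicator (fun w => ∏ i, ℓ (w i)) w =
      ∏ i, (s i).indicator ℓ (w i) := by
    intro w
    by_cases hw : w ∈ Set.univ.pi s
    · rw [Set.indicator_of_mem hw]
      exact Finset.prod_congr rfl fun i _ => (Set.indicator_of_mem (hw i (Set.mem_univ i)) _).symm
    · rw [Set.indicator_of_notMem hw]
      obtain ⟨i, hi⟩ : ∃ i, w i ∉ s i := by simpa [Set.mem_pi] using hw
      exact (Finset.prod_eq_zero (Finset.mem_univ i) (Set.indicator_of_notMem hi _)).symm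
  simp_rw [this]
  rw [lintegral_pi_prod P fun i => hℓ.indicator (hs i)]
  refine Finset.prod_congr rfl fun i _ => ?_
  rw [lintegral_indicator (hs i), withDensity_apply _ (hs i)]

theorem isProbabilityMeasure_law {p : ℝ → ℝ} (hp : IsProbDensity p) :
    IsProbabilityMeasure (law p) := by
  constructor
  rw [law, withDensity_apply _ MeasurableSet.univ, setLIntegral_univ,
    ← ofReal_integral_eq_lintegral_ofReal hp.integrable (Eventually.of_forall hp.nonneg),
    hp.integral_eq_one, ENNReal.ofReal_one]

/-- If the chi-square divergence of two densities is at most `1 / (2 n)`, two nonnegative functions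
of `n` observations whose sum is at least `D` cannot both have small mean. -/
theorem le_lintegral_add_lintegral {n : ℕ} {p₀ p₁ : ℝ → ℝ} (hp₀ : IsProbDensity p₀)
    (hp₁ : IsProbDensity p₁) (hac : ∀ x, p₀ x = 0 → p₁ x = 0)
    (hχ : ∫⁻ x, ENNReal.ofReal (p₁ x ^ 2 / p₀ x) ≤ ENNReal.ofReal (1 + 1 / (2 * n)))
    {u v : (Fin n → ℝ) → ℝ≥0∞} (hu : Measurable u) (hv : Measurable v) {D : ℝ≥0∞}
    (huv : ∀ w, D ≤ u w + v w) :
    D / 2 ≤ ∫⁻ w, u w ∂(Measure.pi fun _ : Fin n => law p₀) +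
      ∫⁻ w, v w ∂(Measure.pi fun _ : Fin n => law p₁) := by
  have := isProbabilityMeasure_law hp₀
  have i1 := isProbabilityMeasure_law hp₁
  set ℓ : ℝ → ℝ≥0∞ := fun x => ENNReal.ofReal (p₁ x / p₀ x) with hℓ
  have hm0 := hp₀.measurable
  have hm1 := hp₁.measurable
  have hℓm : Measurable ℓ := by fun_prop
  have hlaw : law p₁ = (law p₀).withDensity ℓ := by
    rw [law, law, ← withDensity_mul _ (by fun_prop) hℓm]
    congr 1
    ext1 x
    simp only [Pi.mul_apply, hℓ]
    rw [← ENNReal.ofReal_mul (hp₀.nonneg x)]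
    by_cases h : p₀ x = 0
    · simp [h, hac x h]
    · rw [mul_div_cancel₀ _ h]
  set P := Measure.pi fun _ : Fin n => law p₀ with hP
  set L : (Fin n → ℝ) → ℝ≥0∞ := fun w => ∏ i, ℓ (w i) with hL
  have hLm : Measurable L := by fun_prop
  have hPQ : (Measure.pi fun _ : Fin n => law p₁) = P.withDensity L := by
    rw [hlaw] at i1 ⊢
    exact pi_withDensity _ hℓm
  have hLone : ∫⁻ w, L w ∂P = 1 := by
    have : (Measure.pi fun _ : Fin n => law p₁) Set.univ = 1 := measure_univ
    rwa [hPQ, withDensity_apply _ MeasurableSet.univ, setLIntegral_univ] at this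
  have hℓ2 : ∫⁻ x, ℓ x ^ 2 ∂(law p₀) ≤ ENNReal.ofReal (1 + 1 / (2 * n)) := by
    refine le_trans (le_of_eq ?_) hχ
    rw [law, lintegral_withDensity_eq_lintegral_mul _ (by fun_prop) (by fun_prop)]
    refine lintegral_congr fun x => ?_
    simp only [Pi.mul_apply, hℓ]
    rw [← ENNReal.ofReal_pow (div_nonneg (hp₁.nonneg x) (hp₀.nonneg x)),
      ← ENNReal.ofReal_mul (hp₀.nonneg x)]
    by_cases h : p₀ x = 0
    · simp [h]
    · congr 1
      field_simp
  -- The second moment of the likelihood ratio is at most $(1+1/(2n))^n\le e^{1/2}\le2$.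
  have hL2 : ∫⁻ w, L w ^ 2 ∂P ≤ 2 := by
    have : ∀ w, L w ^ 2 = ∏ i, ℓ (w i) ^ 2 := fun w => by rw [hL, Finset.prod_pow]
    simp_rw [this]
    rw [lintegral_pi_prod (law p₀) (F := fun _ x => ℓ x ^ 2) fun i => by fun_prop]
    rw [Finset.prod_const, Finset.card_univ, Fintype.card_fin]
    refine (pow_le_pow_left' hℓ2 n).trans ?_
    rw [← ENNReal.ofReal_pow (by positivity), ← ENNReal.ofReal_ofNat]
    refine ENNReal.ofReal_le_ofReal ?_
    rcases Nat.eq_zero_or_pos n with hn | hn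
    · subst hn; norm_num
    · have h1 : (1 + 1 / (2 * n) : ℝ) ≤ Real.exp (1 / (2 * n)) := by
        have := Real.add_one_le_exp (1 / (2 * n) : ℝ)
        linarith
      have hn' : (0 : ℝ) < n := by exact_mod_cast hn
      calc (1 + 1 / (2 * n) : ℝ) ^ n ≤ Real.exp (1 / (2 * n)) ^ n :=
            pow_le_pow_left₀ (by positivity) h1 n
        _ = Real.exp (1 / 2) := by
            rw [← Real.exp_nat_mul]
            congr 1
            field_simp
        _ ≤ 2 := by
            have h2 : Real.exp (1 / 2) ^ 2 = Real.exp 1 := by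
              rw [← Real.exp_nat_mul]; norm_num
            have h3 := Real.exp_one_lt_d9
            nlinarith [Real.exp_pos (1 / 2)]
  have hLfin : ∀ w, L w ≠ ∞ := fun w =>
    ENNReal.prod_ne_top fun i _ => ENNReal.ofReal_ne_top
  -- For $y\ge1$ this says $(y-2)^2\ge0$. Taking means gives $E\min(1,L)\ge1-2/4=1/2$, and
  -- $D\min(1,L)\le u+Lv$ then yields the claim.
  have hmin : ∀ w, L w ≤ min 1 (L w) + L w ^ 2 / 4 := by
    intro w
    lift L w to NNReal using hLfin w with y
    rcases le_total (y : ℝ≥0∞) 1 with h | h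
    · rw [min_eq_right h]
      exact le_self_add
    · rw [min_eq_left h, show (4 : ℝ≥0∞) = ((4 : NNReal) : ℝ≥0∞) by rfl,
        show (1 : ℝ≥0∞) = ((1 : NNReal) : ℝ≥0∞) by rfl]
      rw [← ENNReal.coe_pow, ← ENNReal.coe_div (by norm_num), ← ENNReal.coe_add,
        ENNReal.coe_le_coe, ← NNReal.coe_le_coe]
      push_cast
      nlinarith [sq_nonneg ((y : ℝ) - 2)]
  have hhalf : (2 : ℝ≥0∞)⁻¹ ≤ ∫⁻ w, min 1 (L w) ∂P := by
    have h1 := lintegral_mono (μ := P) hmin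
    rw [hLone, lintegral_add_left (by fun_prop)] at h1
    have h2 : ∫⁻ w, L w ^ 2 / 4 ∂P ≤ 2⁻¹ := by
      simp_rw [div_eq_mul_inv]
      rw [lintegral_mul_const _ (by fun_prop)]
      refine (mul_le_mul_left hL2 _).trans (le_of_eq ?_)
      rw [show (4 : ℝ≥0∞) = 2 * 2 by norm_num, ENNReal.mul_inv (by simp) (by simp), ← mul_assoc,
        ENNReal.mul_inv_cancel (by simp) (by simp), one_mul]
    have h3 : (2 : ℝ≥0∞)⁻¹ + 2⁻¹ ≤ ∫⁻ w, min 1 (L w) ∂P + 2⁻¹ := by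
      rw [ENNReal.inv_two_add_inv_two]
      exact h1.trans (add_le_add_right h2 _)
    exact (ENNReal.add_le_add_iff_right (by simp)).1 h3
  rw [hPQ, lintegral_withDensity_eq_lintegral_mul _ hLm hv, ← lintegral_add_left hu]
  calc D / 2 ≤ D * ∫⁻ w, min 1 (L w) ∂P := by
        rw [div_eq_mul_inv]
        gcongr
    _ ≤ ∫⁻ w, D * min 1 (L w) ∂P := lintegral_const_mul_le _ _
    _ ≤ _ := by
        refine lintegral_mono fun w => ?_
        calc D * min 1 (L w) ≤ (u w + v w) * min 1 (L w) := by gcongr; exact huv w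
          _ ≤ u w + (L * v) w := by
              rw [add_mul, Pi.mul_apply, mul_comm (L w)]
              gcongr
              · exact mul_le_of_le_one_right' (min_le_left _ _)
              · exact min_le_right _ _

/-- The convolution of two densities. -/
noncomputable def dconv (f g : ℝ → ℝ) (x : ℝ) : ℝ := ∫ y, f (x - y) * g y

/-- Boundedness of `f` makes the convolution integral converge at every point, so the default value
of a divergent integral does not enter `dconv` for such `f`. -/
theorem integrable_comp_sub_mul {f g : ℝ → ℝ} {M : ℝ} (hf : Measurable f) (hM : ∀ x, |f x| ≤ M)
    (hg : Integrable g) (x : ℝ) : Integrable fun y => f (x - y) * g y :=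
  hg.bdd_mul (c := M) (hf.comp (measurable_const.sub measurable_id)).aestronglyMeasurable (Eventually.of_forall fun y => by simpa using hM (x - y))

theorem ofReal_dconv {f g : ℝ → ℝ} (hf : IsProbDensity f) {M : ℝ} (hM : ∀ x, f x ≤ M)
    (hg : IsProbDensity g) (x : ℝ) :
    ENNReal.ofReal (dconv f g x) =
      ∫⁻ y, ENNReal.ofReal (g y) * ENNReal.ofReal (f (-y + x)) := by
  rw [dconv, ofReal_integral_eq_lintegral_ofReal (integrable_comp_sub_mul (M := M) hf.measurable
    (fun x => by rw [abs_of_nonneg (hf.nonneg x)]; exact hM x) hg.integrable x)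
    (Eventually.of_forall fun y => mul_nonneg (hf.nonneg _) (hg.nonneg _))]
  refine lintegral_congr fun y => ?_
  rw [mul_comm, ENNReal.ofReal_mul (hg.nonneg y), neg_add_eq_sub]

theorem measurable_dconv {f g : ℝ → ℝ} (hf : Measurable f) (hg : Measurable g) :
    Measurable (dconv f g) := by
  unfold dconv
  exact (StronglyMeasurable.integral_prod_right'
    (f := fun q : ℝ × ℝ => f (q.1 - q.2) * g q.2) (Measurable.stronglyMeasurable (by fun_prop))).measurable

theorem conv_law {f g : ℝ → ℝ} (hf : IsProbDensity f) {M : ℝ} (hM : ∀ x, f x ≤ M)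
    (hg : IsProbDensity g) : (law f).conv (law g) = law (dconv f g) := by
  have := isProbabilityMeasure_law hf
  have := isProbabilityMeasure_law hg
  have hgm := hg.measurable
  have hfm := hf.measurable
  rw [Measure.conv_comm, law, law, conv_withDensity_eq_lconvolution (by fun_prop) (by fun_prop),
    law]
  congr 1
  ext1 x
  rw [ofReal_dconv hf hM hg, lconvolution_def]

theorem isProbDensity_dconv {f g : ℝ → ℝ} (hf : IsProbDensity f) {M : ℝ} (hM : ∀ x, f x ≤ M)
    (hg : IsProbDensity g) : IsProbDensity (dconv f g) := by
  have i1 := isProbabilityMeasure_law hf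
  have i2 := isProbabilityMeasure_law hg
  have hm := measurable_dconv hf.measurable hg.measurable
  have hnn : ∀ x, 0 ≤ dconv f g x := fun x =>
    integral_nonneg fun y => mul_nonneg (hf.nonneg _) (hg.nonneg _)
  have h1 : ∫⁻ x, ENNReal.ofReal (dconv f g x) = 1 := by
    have : ((law f).conv (law g)) Set.univ = 1 := measure_univ
    rwa [conv_law hf hM hg, law, withDensity_apply _ MeasurableSet.univ, setLIntegral_univ] at this
  have hint : Integrable (dconv f g) := by
    refine ⟨hm.aestronglyMeasurable, ?_⟩
    rw [hasFiniteIntegral_iff_ofReal (Eventually.of_forall hnn), h1]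
    simp
  refine ⟨hm, hnn, hint, ?_⟩
  rw [integral_eq_lintegral_of_nonneg_ae (Eventually.of_forall hnn) hm.aestronglyMeasurable, h1]
  simp

theorem measurable_loss (est : Estimator) {f : ℝ → ℝ} (hf : Measurable f) (n : ℕ) :
    Measurable fun w : Fin n → ℝ => ∫⁻ x, ENNReal.ofReal ((est.toFun n w x - f x) ^ 2) := by
  have := est.measurable n
  exact Measurable.lintegral_prod_right'
    (f := fun q : (Fin n → ℝ) × ℝ => ENNReal.ofReal ((est.toFun n q.1 q.2 - f q.2) ^ 2))
    (by fun_prop)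

theorem mise_eq (est : Estimator) {f g : ℝ → ℝ} (hf : IsProbDensity f) {M : ℝ} (hM : ∀ x, f x ≤ M)
    (hg : IsProbDensity g) (n : ℕ) :
    mise est f g n = ∫⁻ w, (∫⁻ x, ENNReal.ofReal ((est.toFun n w x - f x) ^ 2))
      ∂(Measure.pi fun _ : Fin n => law (dconv f g)) := by
  have i1 := isProbabilityMeasure_law hf
  have i2 := isProbabilityMeasure_law hg
  have hmap : ((law f).prod (law g)).map (fun q : ℝ × ℝ => q.1 + q.2) = law (dconv f g) := by
    rw [← conv_law hf hM hg, Measure.conv]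
  have i3 := isProbabilityMeasure_law (isProbDensity_dconv hf hM hg)
  have hmp : MeasurePreserving (fun (ω : Fin n → ℝ × ℝ) j => (ω j).1 + (ω j).2)
      (Measure.pi fun _ : Fin n => (law f).prod (law g))
      (Measure.pi fun _ : Fin n => law (dconv f g)) :=
    measurePreserving_pi _ _ fun i => ⟨by fun_prop, hmap⟩
  exact hmp.lintegral_comp (measurable_loss est hf.measurable n)

end

/-! ### Assouad's lemma for the integrated squared error. -/

section

/-- Bessel's inequality, from $\|u-\sum_j a_j\Delta_j\|^2\ge0$ with $a_j$ the Fourier coefficients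
of `u`. -/
theorem sum_sq_integral_mul_le {ι : Type*} [Fintype ι] [DecidableEq ι] {u : ℝ → ℝ} {Δ : ι → ℝ → ℝ} {d : ℝ}
    (hd : 0 < d) (hu : MemLp u 2) (hΔ : ∀ j, MemLp (Δ j) 2)
    (horth : ∀ i j, ∫ x, Δ i x * Δ j x = if i = j then d else 0) :
    ∑ j, (∫ x, u x * Δ j x) ^ 2 / d ≤ ∫ x, u x ^ 2 := by
  set a : ι → ℝ := fun j => (∫ x, u x * Δ j x) / d with ha
  have hu2 : Integrable fun x => u x * u x := hu.integrable_mul hu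
  have huΔ : ∀ j, Integrable fun x => u x * Δ j x := fun j => hu.integrable_mul (hΔ j)
  have hΔΔ : ∀ i j, Integrable fun x => Δ i x * Δ j x := fun i j => (hΔ i).integrable_mul (hΔ j)
  have hexp : ∀ x, (u x - ∑ j, a j * Δ j x) ^ 2 = u x * u x - 2 * ∑ j, a j * (u x * Δ j x) +
      ∑ i, ∑ j, a i * a j * (Δ i x * Δ j x) := by
    intro x
    have h1 : (∑ j, a j * Δ j x) * (∑ j, a j * Δ j x) =
        ∑ i, ∑ j, a i * a j * (Δ i x * Δ j x) := by
      rw [Finset.sum_mul_sum]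
      exact Finset.sum_congr rfl fun i _ => Finset.sum_congr rfl fun j _ => by ring
    have h2 : u x * ∑ j, a j * Δ j x = ∑ j, a j * (u x * Δ j x) := by
      rw [Finset.mul_sum]
      exact Finset.sum_congr rfl fun i _ => by ring
    linear_combination h1 - 2 * h2
  have h0 : 0 ≤ ∫ x, (u x - ∑ j, a j * Δ j x) ^ 2 := integral_nonneg fun x => sq_nonneg _
  have i1 : Integrable fun x => ∑ j, a j * (u x * Δ j x) :=
    integrable_finsetSum _ fun j _ => (huΔ j).const_mul _
  have i2 : Integrable fun x => ∑ i, ∑ j, a i * a j * (Δ i x * Δ j x) :=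
    integrable_finsetSum _ fun i _ => integrable_finsetSum _ fun j _ => (hΔΔ i j).const_mul _
  simp_rw [hexp] at h0
  have i3 : Integrable fun x => u x * u x - 2 * ∑ j, a j * (u x * Δ j x) := hu2.sub (i1.const_mul 2)
  rw [integral_add i3 i2, integral_sub hu2 (i1.const_mul 2),
    integral_const_mul, integral_finsetSum _ fun j _ => (huΔ j).const_mul _,
    integral_finsetSum _ fun i _ => integrable_finsetSum _ fun j _ => (hΔΔ i j).const_mul _] at h0
  have h3 : ∀ i, ∫ x, ∑ j, a i * a j * (Δ i x * Δ j x) = a i ^ 2 * d := by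
    intro i
    rw [integral_finsetSum _ fun j _ => (hΔΔ i j).const_mul _]
    simp_rw [integral_const_mul, horth]
    simp [sq]
  have h4 : ∀ j, ∫ x, a j * (u x * Δ j x) = a j ^ 2 * d := by
    intro j
    rw [integral_const_mul, sq, mul_assoc]
    congr 1
    simp only [ha]
    field_simp
  simp_rw [h3, h4] at h0
  have h5 : ∀ j, (∫ x, u x * Δ j x) ^ 2 / d = a j ^ 2 * d := by
    intro j
    simp only [ha]
    field_simp
  simp_rw [h5, sq (u _)]
  linarith

/-- The vertex `θ` of a hypercube of functions with base point `f₀` and edges `Δ j`. -/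
noncomputable def hypercube {N : ℕ} (f₀ : ℝ → ℝ) (Δ : Fin N → ℝ → ℝ) (θ : Fin N → Bool) (x : ℝ) : ℝ :=
  f₀ x + ∑ j, if θ j then Δ j x else 0

/-- The vertex adjacent to `θ` in the direction `j`. -/
def flip {N : ℕ} (j : Fin N) (θ : Fin N → Bool) : Fin N → Bool := Function.update θ j (!θ j)

theorem flip_involutive {N : ℕ} (j : Fin N) : Function.Involutive (flip j) := by
  intro θ
  simp [flip]

theorem flip_apply_self {N : ℕ} (j : Fin N) (θ : Fin N → Bool) : flip j θ j = !θ j := by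
  simp [flip]

/-- Bessel's inequality for the error `u` of the estimate. By orthogonality the coefficient of `u`
along `Δ j` depends on `θ` only through `θ j`, so the loss dominates a sum of losses each of which
sees a single coordinate. -/
theorem sum_coord_loss_le {N : ℕ} {f₀ e : ℝ → ℝ} {Δ : Fin N → ℝ → ℝ} {d : ℝ}
    (hd : 0 < d) (hΔ : ∀ j, MemLp (Δ j) 2) (hf₀ : Measurable f₀) (hΔm : ∀ j, Measurable (Δ j))
    (horth : ∀ i j, ∫ x, Δ i x * Δ j x = if i = j then d else 0) (he : Measurable e)
    (θ : Fin N → Bool) :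
    ∑ j, ENNReal.ofReal (((∫ x, (e x - f₀ x) * Δ j x) - if θ j then d else 0) ^ 2 / d) ≤
      ∫⁻ x, ENNReal.ofReal ((e x - hypercube f₀ Δ θ x) ^ 2) := by
  set u : ℝ → ℝ := fun x => e x - hypercube f₀ Δ θ x with hu
  have hum : Measurable u := by
    simp only [hu, hypercube]
    refine he.sub (hf₀.add (Finset.measurable_sum _ fun j _ => ?_))
    split_ifs
    exacts [hΔm j, measurable_const]
  by_cases hfin : ∫⁻ x, ENNReal.ofReal (u x ^ 2) = ∞
  · rw [hfin]; exact le_top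
  have hint : Integrable fun x => u x ^ 2 := by
    refine ⟨(hum.pow_const 2).aestronglyMeasurable, ?_⟩
    rw [hasFiniteIntegral_iff_ofReal (Eventually.of_forall fun x => sq_nonneg _)]
    exact lt_top_iff_ne_top.2 hfin
  have hL2 : MemLp u 2 := (memLp_two_iff_integrable_sq hum.aestronglyMeasurable).2 hint
  have hcoef : ∀ j, (∫ x, (e x - f₀ x) * Δ j x) - (if θ j then d else 0) = ∫ x, u x * Δ j x := by
    intro j
    have h1 : ∀ x, (e x - f₀ x) * Δ j x = u x * Δ j x +
        ∑ i, (if θ i then (1 : ℝ) else 0) * (Δ i x * Δ j x) := by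
      intro x
      have : ∑ i, (if θ i then (1 : ℝ) else 0) * (Δ i x * Δ j x) =
          (∑ i, if θ i then Δ i x else 0) * Δ j x := by
        rw [Finset.sum_mul]
        exact Finset.sum_congr rfl fun i _ => by split_ifs <;> simp
      rw [this]
      simp only [hu, hypercube]
      ring
    have h2 : ∀ i, Integrable fun x => (if θ i then (1 : ℝ) else 0) * (Δ i x * Δ j x) :=
      fun i => ((hΔ i).integrable_mul (hΔ j)).const_mul _
    have h3 : Integrable fun x => u x * Δ j x := hL2.integrable_mul (hΔ j)
    simp_rw [h1]
    rw [integral_add h3 (integrable_finsetSum _ fun i _ => h2 i),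
      integral_finsetSum _ fun i _ => h2 i]
    simp_rw [integral_const_mul, horth]
    simp
  simp_rw [hcoef]
  rw [← ENNReal.ofReal_sum_of_nonneg fun j _ => by positivity,
    ← ofReal_integral_eq_lintegral_ofReal hint (Eventually.of_forall fun x => sq_nonneg _)]
  exact ENNReal.ofReal_le_ofReal (sum_sq_integral_mul_le hd hL2 hΔ horth)

/-- Assouad's lemma for the mean integrated squared error. -/
theorem assouad {n N : ℕ} {f₀ g : ℝ → ℝ} {Δ : Fin N → ℝ → ℝ} {d M : ℝ} (hg : IsProbDensity g)
    (hd : 0 < d) (hΔ : ∀ j, MemLp (Δ j) 2) (hf₀ : Measurable f₀) (hΔm : ∀ j, Measurable (Δ j))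
    (horth : ∀ i j, ∫ x, Δ i x * Δ j x = if i = j then d else 0)
    (hdens : ∀ θ, IsProbDensity (hypercube f₀ Δ θ)) (hM : ∀ θ x, hypercube f₀ Δ θ x ≤ M)
    (hac : ∀ θ j x, dconv (hypercube f₀ Δ θ) g x = 0 → dconv (hypercube f₀ Δ (flip j θ)) g x = 0)
    (hχ : ∀ θ j, ∫⁻ x, ENNReal.ofReal (dconv (hypercube f₀ Δ (flip j θ)) g x ^ 2 /
      dconv (hypercube f₀ Δ θ) g x) ≤ ENNReal.ofReal (1 + 1 / (2 * n)))
    (est : Estimator) {S : ℝ≥0∞} (hS : ∀ θ, mise est (hypercube f₀ Δ θ) g n ≤ S) :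
    ENNReal.ofReal (N * d / 8) ≤ S := by
  set P : (Fin N → Bool) → Measure (Fin n → ℝ) := fun θ =>
    Measure.pi fun _ : Fin n => law (dconv (hypercube f₀ Δ θ) g) with hP
  set c : Fin N → Bool → (Fin n → ℝ) → ℝ≥0∞ := fun j b w =>
    ENNReal.ofReal (((∫ x, (est.toFun n w x - f₀ x) * Δ j x) - if b then d else 0) ^ 2 / d) with hc
  have hcm : ∀ j b, Measurable (c j b) := by
    intro j b
    have h1 := est.measurable n
    have h2 := hΔm j
    have h3 : Measurable fun w : Fin n → ℝ => ∫ x, (est.toFun n w x - f₀ x) * Δ j x :=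
      (StronglyMeasurable.integral_prod_right'
        (f := fun q : (Fin n → ℝ) × ℝ => (est.toFun n q.1 q.2 - f₀ q.2) * Δ j q.2)
        (Measurable.stronglyMeasurable (by fun_prop))).measurable
    simp only [hc]
    fun_prop
  have hloss : ∀ θ, ∑ j, ∫⁻ w, c j (θ j) w ∂(P θ) ≤ S := by
    intro θ
    refine le_trans ?_ (hS θ)
    rw [mise_eq est (hdens θ) (hM θ) hg, ← lintegral_finsetSum _ fun j _ => hcm j (θ j)]
    refine lintegral_mono fun w => ?_
    exact sum_coord_loss_le hd hΔ hf₀ hΔm horth ((est.measurable n).comp measurable_prodMk_left) θ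
  -- With $x$ the coefficient of the estimate along edge $j$, $x^2+(x-d)^2\ge d^2/2$. So the two
  -- coordinate losses add up to at least $d/2$ at every sample, and the two-point bound keeps half
  -- of this.
  have hpair : ∀ θ j, ENNReal.ofReal (d / 4) ≤
      ∫⁻ w, c j (θ j) w ∂(P θ) + ∫⁻ w, c j (flip j θ j) w ∂(P (flip j θ)) := by
    intro θ j
    have h1 : ENNReal.ofReal (d / 4) = ENNReal.ofReal (d / 2) / 2 := by
      rw [← ENNReal.ofReal_ofNat 2, ← ENNReal.ofReal_div_of_pos (by norm_num)]
      congr 1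
      norm_num
      ring
    rw [h1, flip_apply_self]
    refine le_lintegral_add_lintegral (isProbDensity_dconv (hdens θ) (hM θ) hg)
      (isProbDensity_dconv (hdens (flip j θ)) (hM _) hg) (hac θ j) (hχ θ j) (hcm _ _) (hcm _ _) ?_
    intro w
    simp only [hc]
    rw [← ENNReal.ofReal_add (by positivity) (by positivity), ← add_div]
    refine ENNReal.ofReal_le_ofReal ?_
    rw [le_div_iff₀ hd]
    generalize (∫ x, (est.toFun n w x - f₀ x) * Δ j x) = a
    cases θ j <;> simp <;> nlinarith [sq_nonneg (2 * a - d)]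
  have hsum : ∀ j : Fin N, (2 : ℝ≥0∞) ^ N * ENNReal.ofReal (d / 4) ≤
      2 * ∑ θ, ∫⁻ w, c j (θ j) w ∂(P θ) := by
    intro j
    calc (2 : ℝ≥0∞) ^ N * ENNReal.ofReal (d / 4)
        = ∑ θ : Fin N → Bool, ENNReal.ofReal (d / 4) := by simp
      _ ≤ ∑ θ : Fin N → Bool, (∫⁻ w, c j (θ j) w ∂(P θ) +
          ∫⁻ w, c j (flip j θ j) w ∂(P (flip j θ))) := Finset.sum_le_sum fun θ _ => hpair θ j
      _ = _ := by
          -- Flipping coordinate `j` permutes the vertices, so both sums are equal.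
          rw [Finset.sum_add_distrib, two_mul]
          congr 1
          exact Equiv.sum_comp (flip_involutive j).toPerm
            fun θ => ∫⁻ w, c j (θ j) w ∂(P θ)
  have htot : (2 : ℝ≥0∞) ^ N * (N * ENNReal.ofReal (d / 4)) ≤ 2 ^ N * (2 * S) := by
    calc (2 : ℝ≥0∞) ^ N * (N * ENNReal.ofReal (d / 4))
        = ∑ _j : Fin N, (2 : ℝ≥0∞) ^ N * ENNReal.ofReal (d / 4) := by
          rw [Finset.sum_const, Finset.card_univ, Fintype.card_fin, nsmul_eq_mul]
          ring
      _ ≤ ∑ j : Fin N, 2 * ∑ θ, ∫⁻ w, c j (θ j) w ∂(P θ) := Finset.sum_le_sum fun j _ => hsum j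
      _ = 2 * ∑ θ, ∑ j : Fin N, ∫⁻ w, c j (θ j) w ∂(P θ) := by
          rw [← Finset.mul_sum, Finset.sum_comm]
      _ ≤ 2 * ∑ θ : Fin N → Bool, S := by gcongr; exact hloss _
      _ = _ := by simp; ring
  have h2 := (ENNReal.mul_le_mul_iff_right (by simp) (by simp)).1 htot
  refine (ENNReal.mul_le_mul_iff_right (a := 2) (by simp) (by simp)).1 (le_trans (le_of_eq ?_) h2)
  rw [← ENNReal.ofReal_ofNat 2, ← ENNReal.ofReal_mul (by simp), ← ENNReal.ofReal_natCast,
    ← ENNReal.ofReal_mul (by simp)]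
  congr 1
  norm_num
  ring

end

/-! ### Fourier transforms, and modulated bumps before and after convolution. -/

section

theorem integrable_exp_mul {f : ℝ → ℝ} (hf : Integrable f) (t : ℝ) :
    Integrable fun x : ℝ => Complex.exp (((t * x : ℝ) : ℂ) * Complex.I) * (f x : ℂ) := by
  refine hf.ofReal.bdd_mul (c := 1) (Continuous.aestronglyMeasurable (by fun_prop))
    (Eventually.of_forall fun x => ?_)
  rw [Complex.norm_exp_ofReal_mul_I]

theorem norm_ft_le_integral (f : ℝ → ℝ) (t : ℝ) : ‖ft f t‖ ≤ ∫ x, |f x| := by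
  refine (norm_integral_le_integral_norm _).trans (le_of_eq ?_)
  simp_rw [norm_mul, Complex.norm_exp_ofReal_mul_I, one_mul, Complex.norm_real, Real.norm_eq_abs]

theorem norm_ft_le_one {f : ℝ → ℝ} (hf : IsProbDensity f) (t : ℝ) : ‖ft f t‖ ≤ 1 := by
  refine (norm_ft_le_integral f t).trans (le_of_eq ?_)
  simp_rw [abs_of_nonneg (hf.nonneg _)]
  exact hf.integral_eq_one

theorem continuous_ft {f : ℝ → ℝ} (hf : Integrable f) : Continuous (ft f) := by
  refine continuous_of_dominated (bound := fun x => |f x|) (fun t => ?_) (fun t => ?_) hf.abs ?_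
  · exact (integrable_exp_mul hf t).aestronglyMeasurable
  · refine Eventually.of_forall fun x => ?_
    rw [norm_mul, Complex.norm_exp_ofReal_mul_I, one_mul, Complex.norm_real, Real.norm_eq_abs]
  · refine Eventually.of_forall fun x => ?_
    fun_prop

theorem ft_zero (f : ℝ → ℝ) : ft f 0 = ((∫ x, f x : ℝ) : ℂ) := by
  rw [ft, ← integral_complex_ofReal]
  simp

theorem ft_add {f g : ℝ → ℝ} (hf : Integrable f) (hg : Integrable g) (t : ℝ) :
    ft (fun x => f x + g x) t = ft f t + ft g t := by
  simp only [ft]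
  rw [← integral_add (integrable_exp_mul hf t) (integrable_exp_mul hg t)]
  refine integral_congr_ae (Eventually.of_forall fun x => ?_)
  push_cast
  ring

theorem ft_const_mul (c : ℝ) (f : ℝ → ℝ) (t : ℝ) : ft (fun x => c * f x) t = c * ft f t := by
  simp only [ft]
  rw [← integral_const_mul]
  refine integral_congr_ae (Eventually.of_forall fun x => ?_)
  push_cast
  ring

theorem ft_sum {ι : Type*} (s : Finset ι) {f : ι → ℝ → ℝ} (hf : ∀ i ∈ s, Integrable (f i)) (t : ℝ) :
    ft (fun x => ∑ i ∈ s, f i x) t = ∑ i ∈ s, ft (f i) t := by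
  simp only [ft]
  rw [← integral_finsetSum _ fun i hi => integrable_exp_mul (hf i hi) t]
  refine integral_congr_ae (Eventually.of_forall fun x => ?_)
  push_cast
  rw [Finset.mul_sum]

/-- The density `s p(s ·)`. -/
def dilate (p : ℝ → ℝ) (s x : ℝ) : ℝ := s * p (s * x)

theorem isProbDensity_dilate {p : ℝ → ℝ} (hp : IsProbDensity p) {s : ℝ} (hs : 0 < s) :
    IsProbDensity (dilate p s) := by
  have hm := hp.measurable
  refine ⟨by unfold dilate; fun_prop, fun x => mul_nonneg hs.le (hp.nonneg _),
    (hp.integrable.comp_mul_left' hs.ne').const_mul s, ?_⟩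
  simp only [dilate]
  rw [integral_const_mul, Measure.integral_comp_mul_left, hp.integral_eq_one,
    abs_of_pos (by positivity)]
  simp [hs.ne']

theorem ft_dilate (p : ℝ → ℝ) {s : ℝ} (hs : 0 < s) (t : ℝ) : ft (dilate p s) t = ft p (t / s) := by
  have := Measure.integral_comp_mul_left (fun x : ℝ =>
    (s : ℂ) * (Complex.exp (((t / s * x : ℝ) : ℂ) * Complex.I) * (p x : ℂ))) s
  simp only [ft]
  calc _ = _ := ?_
    _ = _ := this
    _ = _ := ?_
  · refine integral_congr_ae (Eventually.of_forall fun x => ?_)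
    simp only [dilate]
    rw [show t / s * (s * x) = t * x by field_simp]
    push_cast
    ring
  · rw [integral_const_mul, abs_of_pos (by positivity), Complex.real_smul]
    push_cast
    rw [← mul_assoc, inv_mul_cancel₀ (by exact_mod_cast hs.ne'), one_mul]

/-- The density `h p(h ·)` modulated to the frequency `lam`. -/
noncomputable def bump (p : ℝ → ℝ) (h lam x : ℝ) : ℝ := dilate p h x * Real.cos (lam * x)

theorem integrable_bump {p : ℝ → ℝ} (hp : IsProbDensity p) {h : ℝ} (hh : 0 < h) (lam : ℝ) :
    Integrable (bump p h lam) :=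
  (isProbDensity_dilate hp hh).integrable.mul_bdd (c := 1)
    (Continuous.aestronglyMeasurable (by fun_prop))
    (Eventually.of_forall fun x => Real.abs_cos_le_one _)

theorem abs_bump_le {p : ℝ → ℝ} (hp : IsProbDensity p) {h : ℝ} (hh : 0 < h) (lam x : ℝ) :
    |bump p h lam x| ≤ dilate p h x := by
  have h1 := (isProbDensity_dilate hp hh).nonneg x
  rw [bump, abs_mul, abs_of_nonneg h1]
  exact mul_le_of_le_one_right h1 (Real.abs_cos_le_one _)

theorem ft_mul_cos {f : ℝ → ℝ} (hf : Integrable f) (lam t : ℝ) :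
    ft (fun x => f x * Real.cos (lam * x)) t = (ft f (t - lam) + ft f (t + lam)) / 2 := by
  simp only [ft]
  rw [← integral_add (integrable_exp_mul hf _) (integrable_exp_mul hf _), ← integral_div]
  refine integral_congr_ae (Eventually.of_forall fun x => ?_)
  simp only [Complex.ofReal_mul, Complex.ofReal_cos, Complex.cos]
  rw [show (((t - lam : ℝ) : ℂ) * x) * Complex.I = (t : ℂ) * x * Complex.I +
      -((lam : ℂ) * x) * Complex.I by push_cast; ring,
    show (((t + lam : ℝ) : ℂ) * x) * Complex.I = (t : ℂ) * x * Complex.I +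
      (lam : ℂ) * x * Complex.I by push_cast; ring, Complex.exp_add, Complex.exp_add]
  ring

section Kernel

variable {p : ℝ → ℝ} {K : ℝ → ℂ}

namespace IsBandlimitedDensity

theorem norm_le_one (hp : IsBandlimitedDensity p K) (t : ℝ) : ‖K t‖ ≤ 1 := by
  rw [← hp.ft_eq]
  exact norm_ft_le_one hp.density t

theorem hasCompactSupport (hp : IsBandlimitedDensity p K) : HasCompactSupport K :=
  HasCompactSupport.intro (isCompact_Icc (a := -1) (b := 1)) fun t ht => hp.eq_zero t (by
    by_contra h
    exact ht (abs_le.1 (not_le.1 h).le))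

theorem integrable (hp : IsBandlimitedDensity p K) : Integrable K :=
  hp.contDiff.continuous.integrable_of_hasCompactSupport hp.hasCompactSupport

theorem differentiable (hp : IsBandlimitedDensity p K) : Differentiable ℝ K :=
  hp.contDiff.differentiable (by simp)

theorem continuous_deriv (hp : IsBandlimitedDensity p K) : Continuous (deriv K) :=
  hp.contDiff.continuous_deriv (by simp)

theorem exists_norm_deriv_le (hp : IsBandlimitedDensity p K) : ∃ k₁, 0 ≤ k₁ ∧ ∀ t, ‖deriv K t‖ ≤ k₁ := by
  obtain ⟨C, hC⟩ := hp.hasCompactSupport.deriv.exists_bound_of_continuous hp.continuous_deriv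
  exact ⟨C, (norm_nonneg _).trans (hC 0), hC⟩

theorem le_integral_norm (hp : IsBandlimitedDensity p K) (x : ℝ) : p x ≤ ∫ t, ‖K t‖ := by
  have h1 := congrArg norm (hp.inversion x)
  rw [norm_mul, Complex.norm_real, Real.norm_of_nonneg (hp.density.nonneg x)] at h1
  rw [h1]
  refine le_trans (mul_le_of_le_one_left (norm_nonneg _) ?_) (norm_invft_le K x)
  have := Real.pi_gt_three
  rw [Complex.norm_real, Real.norm_of_nonneg (by positivity)]
  exact inv_le_one_of_one_le₀ (by linarith)

theorem integrable_sq (hp : IsBandlimitedDensity p K) : Integrable fun x => p x * p x :=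
  hp.density.integrable.bdd_mul (c := ∫ t, ‖K t‖) hp.density.measurable.aestronglyMeasurable
    (Eventually.of_forall fun x => by
      rw [Real.norm_of_nonneg (hp.density.nonneg x)]; exact hp.le_integral_norm x)

theorem integral_sq_pos (hp : IsBandlimitedDensity p K) : 0 < ∫ x, p x * p x :=
  integral_pos_of_integrable_nonneg_nonzero (hp.continuous.mul hp.continuous) hp.integrable_sq
    (fun _ => mul_self_nonneg _) (mul_pos hp.pos hp.pos).ne'

/-- The transform of $p^2$ is $(2\pi)^{-1}K*K$, supported in $[-2,2]$. This is what makes bumps at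
separated frequencies orthogonal. -/
theorem ft_sq_eq_zero (hp : IsBandlimitedDensity p K) {t : ℝ} (ht : 2 ≤ |t|) :
    ft (fun x => p x * p x) t = 0 := by
  set Φ : ℝ → ℝ → ℂ := fun x s => (p x : ℂ) * K s *
    Complex.exp ((((t - s) * x : ℝ) : ℂ) * Complex.I) with hΦ
  have hint : Integrable (Function.uncurry Φ) (volume.prod volume) := by
    have h1 := hp.density.integrable.ofReal (𝕜 := ℂ).mul_prod hp.integrable
    refine h1.mul_bdd (c := 1) (Continuous.aestronglyMeasurable (by fun_prop))
      (Eventually.of_forall fun q => ?_)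
    rw [Complex.norm_exp_ofReal_mul_I]
  have h1 : ∀ x : ℝ, Complex.exp (((t * x : ℝ) : ℂ) * Complex.I) * ((p x * p x : ℝ) : ℂ) =
      (2 * Real.pi)⁻¹ * ∫ s, Φ x s := by
    intro x
    have h3 : ∫ s, Φ x s = p x * Complex.exp (((t * x : ℝ) : ℂ) * Complex.I) *
        ∫ s : ℝ, K s * Complex.exp (-((s * x : ℝ) : ℂ) * Complex.I) := by
      rw [← integral_const_mul]
      refine integral_congr_ae (Eventually.of_forall fun s => ?_)
      simp only [hΦ]
      rw [show ((((t - s) * x : ℝ)) : ℂ) * Complex.I = ((t * x : ℝ) : ℂ) * Complex.I +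
        -((s * x : ℝ) : ℂ) * Complex.I by push_cast; ring, Complex.exp_add]
      ring
    rw [h3]
    have h2 := hp.inversion x
    generalize (∫ s : ℝ, K s * Complex.exp (-((s * x : ℝ) : ℂ) * Complex.I)) = I at *
    rw [Complex.ofReal_mul (p x) (p x)]
    linear_combination (Complex.exp (((t * x : ℝ) : ℂ) * Complex.I) * p x) * h2
  simp only [ft]
  simp_rw [h1]
  rw [integral_const_mul, integral_integral_swap hint]
  have h2 : ∀ s, ∫ x, Φ x s = 0 := by
    intro s
    have : ∫ x, Φ x s = K s * ft p (t - s) := by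
      rw [ft, ← integral_const_mul]
      refine integral_congr_ae (Eventually.of_forall fun x => ?_)
      simp only [hΦ]
      ring
    rw [this, hp.ft_eq]
    rcases le_or_gt 1 |s| with h | h
    · rw [hp.eq_zero s h, zero_mul]
    · rw [hp.eq_zero (t - s), mul_zero]
      have := abs_sub_abs_le_abs_sub t s
      linarith
  simp [h2]

theorem integral_sq_mul_cos (hp : IsBandlimitedDensity p K) {t : ℝ} (ht : 2 ≤ |t|) :
    ∫ x, p x * p x * Real.cos (t * x) = 0 := by
  have h1 := ft_mul_cos hp.integrable_sq t 0
  rw [ft_zero, hp.ft_sq_eq_zero (by simpa using ht), hp.ft_sq_eq_zero (by simpa using ht)] at h1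
  have h2 : ((∫ x, p x * p x * Real.cos (t * x) : ℝ) : ℂ) = 0 := by rw [h1]; simp
  exact_mod_cast h2

/-- Product-to-sum for cosines and the substitution $x\mapsto hx$. Both cosine integrals vanish once
$|l-m|$ and $l+m$ are at least $2h$. -/
theorem integral_bump_mul_bump (hp : IsBandlimitedDensity p K) {h : ℝ} (hh : 0 < h) (l m : ℝ) :
    ∫ x, bump p h l x * bump p h m x =
      h / 2 * ((∫ x, p x * p x * Real.cos ((l - m) / h * x)) +
        ∫ x, p x * p x * Real.cos ((l + m) / h * x)) := by
  have hcos : ∀ t, Integrable fun x => p x * p x * Real.cos (t * x) := fun t =>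
    hp.integrable_sq.mul_bdd (c := 1) (Continuous.aestronglyMeasurable (by fun_prop))
      (Eventually.of_forall fun x => Real.abs_cos_le_one _)
  rw [← integral_add (hcos _) (hcos _), ← integral_const_mul]
  have := Measure.integral_comp_mul_left (fun x : ℝ => h ^ 2 / 2 *
    (p x * p x * Real.cos ((l - m) / h * x) + p x * p x * Real.cos ((l + m) / h * x))) h
  calc _ = _ := ?_
    _ = _ := this
    _ = _ := ?_
  · refine integral_congr_ae (Eventually.of_forall fun x => ?_)
    simp only [bump, dilate]
    rw [show (l - m) / h * (h * x) = l * x - m * x by field_simp,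
      show (l + m) / h * (h * x) = l * x + m * x by field_simp, Real.cos_sub, Real.cos_add]
    ring
  · rw [integral_const_mul, integral_const_mul, abs_of_pos (by positivity), smul_eq_mul, ← mul_assoc]
    congr 1
    field_simp

theorem integral_bump_mul_bump_of_ne (hp : IsBandlimitedDensity p K) {h : ℝ} (hh : 0 < h) {l m : ℝ}
    (hl : h ≤ l) (hm : h ≤ m) (hlm : 2 * h ≤ |l - m|) : ∫ x, bump p h l x * bump p h m x = 0 := by
  rw [hp.integral_bump_mul_bump hh, hp.integral_sq_mul_cos, hp.integral_sq_mul_cos]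
  · simp
  · rw [abs_div, abs_of_pos hh, le_div_iff₀ hh, abs_of_pos (by linarith)]
    linarith
  · rwa [abs_div, abs_of_pos hh, le_div_iff₀ hh]

theorem integral_bump_mul_self (hp : IsBandlimitedDensity p K) {h : ℝ} (hh : 0 < h) {l : ℝ}
    (hl : h ≤ l) : ∫ x, bump p h l x * bump p h l x = h / 2 * ∫ x, p x * p x := by
  rw [hp.integral_bump_mul_bump hh, hp.integral_sq_mul_cos (t := (l + l) / h)]
  · simp
  · rw [abs_div, abs_of_pos hh, le_div_iff₀ hh, abs_of_pos (by linarith)]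
    linarith

theorem dilate_le (hp : IsBandlimitedDensity p K) {s : ℝ} (hs : 0 < s) (x : ℝ) :
    dilate p s x ≤ s * ∫ t, ‖K t‖ :=
  mul_le_mul_of_nonneg_left (hp.le_integral_norm _) hs.le

theorem memLp_bump (hp : IsBandlimitedDensity p K) {h : ℝ} (hh : 0 < h) (l : ℝ) :
    MemLp (bump p h l) 2 := by
  have hi := integrable_bump hp.density hh l
  rw [memLp_two_iff_integrable_sq hi.aestronglyMeasurable]
  simp_rw [sq]
  refine hi.bdd_mul (c := h * ∫ t, ‖K t‖) hi.aestronglyMeasurable (Eventually.of_forall fun x => ?_)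
  exact (abs_bump_le hp.density hh l x).trans (hp.dilate_le hh x)

theorem ft_bump (hp : IsBandlimitedDensity p K) {h : ℝ} (hh : 0 < h) (l t : ℝ) :
    ft (bump p h l) t = (K ((t - l) / h) + K ((t + l) / h)) / 2 := by
  have := ft_mul_cos (isProbDensity_dilate hp.density hh).integrable l t
  rw [ft_dilate p hh, ft_dilate p hh, hp.ft_eq, hp.ft_eq] at this
  exact this

theorem integral_bump (hp : IsBandlimitedDensity p K) {h : ℝ} (hh : 0 < h) {l : ℝ} (hl : h ≤ l) :
    ∫ x, bump p h l x = 0 := by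
  have h1 := hp.ft_bump hh l 0
  have h2 : 1 ≤ |l / h| := by
    rw [abs_div, abs_of_pos hh, one_le_div hh]
    exact hl.trans (le_abs_self l)
  rw [ft_zero, hp.eq_zero _ (by rwa [zero_sub, neg_div, abs_neg]),
    hp.eq_zero _ (by rwa [zero_add])] at h1
  have h2 : ((∫ x, bump p h l x : ℝ) : ℂ) = 0 := by rw [h1]; simp
  exact_mod_cast h2

theorem dilate_inversion (hp : IsBandlimitedDensity p K) {h : ℝ} (hh : 0 < h) (l x : ℝ) :
    (dilate p h x : ℂ) * Complex.exp (-((l * x : ℝ) : ℂ) * Complex.I) =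
      (2 * Real.pi)⁻¹ * invft (fun t => K ((t - l) / h)) x := by
  have h1 : invft (fun t => K ((t - l) / h)) x = h * Complex.exp (-((l * x : ℝ) : ℂ) * Complex.I) *
      ∫ t : ℝ, K t * Complex.exp (-((t * (h * x) : ℝ) : ℂ) * Complex.I) := by
    have e1 := integral_sub_right_eq_self (μ := volume) (fun t : ℝ => K (t / h) *
      Complex.exp (-(((t + l) * x : ℝ) : ℂ) * Complex.I)) l
    have e2 := Measure.integral_comp_div (fun t : ℝ => Complex.exp (-((l * x : ℝ) : ℂ) * Complex.I) *
      (K t * Complex.exp (-((t * (h * x) : ℝ) : ℂ) * Complex.I))) h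
    simp only [sub_add_cancel] at e1
    rw [invft, e1, mul_assoc, ← integral_const_mul]
    rw [abs_of_pos hh, Complex.real_smul] at e2
    rw [← e2]
    refine integral_congr_ae (Eventually.of_forall fun t => ?_)
    simp only
    rw [show t / h * (h * x) = t * x by field_simp, add_mul, Complex.ofReal_add, neg_add, add_mul,
      Complex.exp_add]
    ring
  rw [h1, dilate]
  have := hp.inversion (h * x)
  rw [Complex.ofReal_mul, this]
  ring

theorem integrable_comp (hp : IsBandlimitedDensity p K) {h : ℝ} (hh : 0 < h) (l : ℝ) :
    Integrable fun t => K ((t - l) / h) :=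
  (hp.integrable.comp_div hh.ne').comp_sub_right l

/-- The modulated convolution is the inverse Fourier transform of the product of the transforms. -/
theorem integral_modulated_eq_invft (hp : IsBandlimitedDensity p K) {g : ℝ → ℝ} (hg : Integrable g)
    {h : ℝ} (hh : 0 < h) (l x : ℝ) :
    ∫ y, (dilate p h (x - y) : ℂ) * Complex.exp (-((l * (x - y) : ℝ) : ℂ) * Complex.I) * g y =
      (2 * Real.pi)⁻¹ * invft (fun t => K ((t - l) / h) * ft g t) x := by
  simp_rw [hp.dilate_inversion hh, mul_assoc]
  rw [integral_const_mul]
  congr 1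
  set Φ : ℝ → ℝ → ℂ := fun y t => (g y : ℂ) * K ((t - l) / h) *
    Complex.exp (-((t * (x - y) : ℝ) : ℂ) * Complex.I) with hΦ
  have hint : Integrable (Function.uncurry Φ) (volume.prod volume) := by
    have h1 := hg.ofReal (𝕜 := ℂ).mul_prod (hp.integrable_comp hh l)
    refine h1.mul_bdd (c := 1) (Continuous.aestronglyMeasurable (by fun_prop))
      (Eventually.of_forall fun q => ?_)
    rw [norm_exp_neg_mul_I]
  calc _ = ∫ y, ∫ t, Φ y t := ?_
    _ = ∫ t, ∫ y, Φ y t := integral_integral_swap hint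
    _ = _ := ?_
  · refine integral_congr_ae (Eventually.of_forall fun y => ?_)
    simp only [invft, hΦ]
    rw [← integral_mul_const]
    refine integral_congr_ae (Eventually.of_forall fun t => ?_)
    simp only
    ring
  · simp only [invft]
    refine integral_congr_ae (Eventually.of_forall fun t => ?_)
    simp only [hΦ, ft]
    rw [← integral_const_mul, ← integral_mul_const]
    refine integral_congr_ae (Eventually.of_forall fun y => ?_)
    simp only
    rw [show -((t * (x - y) : ℝ) : ℂ) * Complex.I = ((t * y : ℝ) : ℂ) * Complex.I +
        -((t * x : ℝ) : ℂ) * Complex.I by push_cast; ring, Complex.exp_add]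
    ring

/-- The bump is the real part of a dilate modulated by $e^{-ilx}$, so its convolution is controlled
by an inverse transform supported near $l$ alone, without the mirror window at $-l$. The factor
$(2\pi)^{-1}\le1$ is dropped. -/
theorem abs_dconv_bump_le (hp : IsBandlimitedDensity p K) {g : ℝ → ℝ} (hg : Integrable g)
    {h : ℝ} (hh : 0 < h) (l x : ℝ) :
    |dconv (bump p h l) g x| ≤ ‖invft (fun t => K ((t - l) / h) * ft g t) x‖ := by
  have hre : dconv (bump p h l) g x = (∫ y, (dilate p h (x - y) : ℂ) *
      Complex.exp (-((l * (x - y) : ℝ) : ℂ) * Complex.I) * g y).re := by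
    have hi : Integrable fun y => (dilate p h (x - y) : ℂ) *
        Complex.exp (-((l * (x - y) : ℝ) : ℂ) * Complex.I) * g y := by
      refine hg.ofReal.bdd_mul (c := h * ∫ t, ‖K t‖) ?_ (Eventually.of_forall fun y => ?_)
      · have := hp.continuous
        exact Continuous.aestronglyMeasurable (by unfold dilate; fun_prop)
      · rw [norm_mul, norm_exp_neg_mul_I, mul_one, Complex.norm_real,
          Real.norm_of_nonneg ((isProbDensity_dilate hp.density hh).nonneg _)]
        exact hp.dilate_le hh _
    have h1 := integral_re hi
    simp only [RCLike.re_eq_complex_re] at h1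
    rw [← h1]
    refine integral_congr_ae (Eventually.of_forall fun y => ?_)
    simp only
    rw [← Complex.ofReal_neg, Complex.re_mul_ofReal, Complex.re_ofReal_mul,
      Complex.exp_ofReal_mul_I_re, Real.cos_neg, bump]
  rw [hre, hp.integral_modulated_eq_invft hg hh]
  refine (Complex.abs_re_le_norm _).trans ?_
  rw [norm_mul]
  refine mul_le_of_le_one_left (norm_nonneg _) ?_
  have := Real.pi_gt_three
  rw [Complex.norm_real, Real.norm_of_nonneg (by positivity)]
  exact inv_le_one_of_one_le₀ (by linarith)

/-- By the product rule the transform has derivative at most $(k_1+1)A/h$. The weight $h^2$ cancels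
$h^{-2}$, and the window has length $2h$, so the bound is of order $hA^2$. -/
theorem lintegral_weighted_sq_dconv_bump_le (hp : IsBandlimitedDensity p K) {k₁ : ℝ}
    (hk₁ : ∀ t, ‖deriv K t‖ ≤ k₁) {g : ℝ → ℝ} (hg : Integrable g) {h l A : ℝ} (hh : 0 < h)
    (hA : ∀ t, |t - l| < h → ‖ft g t‖ ≤ A)
    (hA' : ∀ t, |t - l| < h → t ≠ l → DifferentiableAt ℝ (ft g) t ∧ ‖deriv (ft g) t‖ ≤ A / h) :
    ∫⁻ x, ENNReal.ofReal ((1 + h ^ 2 * x ^ 2) * dconv (bump p h l) g x ^ 2) ≤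
      ENNReal.ofReal (4 * Real.pi * (1 + (k₁ + 1) ^ 2) * h * A ^ 2) := by
  have hmem : ∀ t, t ∈ Set.Ioo (l - h) (l + h) ↔ |t - l| < h := by
    intro t
    rw [abs_lt, Set.mem_Ioo]
    constructor <;> rintro ⟨h1, h2⟩ <;> constructor <;> linarith
  have hKd : ∀ t, HasDerivAt (fun t => K ((t - l) / h)) ((1 / h) • deriv K ((t - l) / h)) t := by
    intro t
    have h1 : HasDerivAt (fun t => (t - l) / h) (1 / h) t := ((hasDerivAt_id t).sub_const l).div_const h
    exact (hp.differentiable _).hasDerivAt.scomp t h1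
  have hd : ∀ t, |t - l| < h → t ≠ l → HasDerivAt (fun t => K ((t - l) / h) * ft g t)
      ((1 / h) • deriv K ((t - l) / h) * ft g t + K ((t - l) / h) * deriv (ft g) t) t :=
    fun t ht htl => (hKd t).mul (hA' t ht htl).1.hasDerivAt
  have key := lintegral_weighted_sq_invft_le (ψ := fun t => K ((t - l) / h) * ft g t)
    (a := l - h) (b := l + h) (c := l) (A := A) (B := (k₁ + 1) * A / h) (h := h) (by linarith)
    ((hp.contDiff.continuous.comp (by fun_prop)).mul (continuous_ft hg))
    (fun t ht => by
      rw [hp.eq_zero, zero_mul]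
      rw [abs_div, abs_of_pos hh, one_le_div hh]
      exact not_lt.1 fun hlt => ht ((hmem t).2 hlt))
    (fun t ht htl => (hd t ((hmem t).1 ht) htl).differentiableAt)
    (fun t ht => by
      rw [norm_mul]
      have := hA t ((hmem t).1 ht)
      exact (mul_le_of_le_one_left (norm_nonneg _) (hp.norm_le_one _)).trans this)
    (fun t ht htl => by
      have ht := (hmem t).1 ht
      have h1 := hA t ht
      have h2 := (hA' t ht htl).2
      have hA0 : 0 ≤ A := (norm_nonneg _).trans h1
      have hk0 : 0 ≤ k₁ := (norm_nonneg _).trans (hk₁ 0)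
      rw [(hd t ht htl).deriv]
      refine (norm_add_le _ _).trans ?_
      rw [norm_mul, norm_mul, norm_smul, Real.norm_of_nonneg (by positivity)]
      have h3 : 1 / h * ‖deriv K ((t - l) / h)‖ * ‖ft g t‖ ≤ 1 / h * k₁ * A := by
        gcongr
        exact hk₁ _
      have h4 : ‖K ((t - l) / h)‖ * ‖deriv (ft g) t‖ ≤ 1 * (A / h) := by
        gcongr
        exact hp.norm_le_one _
      refine (add_le_add h3 h4).trans (le_of_eq ?_)
      field_simp)
  calc ∫⁻ x, ENNReal.ofReal ((1 + h ^ 2 * x ^ 2) * dconv (bump p h l) g x ^ 2)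
      ≤ ∫⁻ x, ENNReal.ofReal ((1 + h ^ 2 * x ^ 2) *
        ‖invft (fun t => K ((t - l) / h) * ft g t) x‖ ^ 2) := by
        refine lintegral_mono fun x => ENNReal.ofReal_le_ofReal ?_
        refine mul_le_mul_of_nonneg_left ?_ (by positivity)
        rw [← sq_abs]
        exact pow_le_pow_left₀ (abs_nonneg _) (hp.abs_dconv_bump_le hg hh l x) 2
    _ ≤ _ := key
    _ = _ := by
        congr 1
        field_simp
        ring

end IsBandlimitedDensity

end Kernel

end

/-! ### The mixture with a Cauchy lower bound, and the hypercube of densities. -/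

section

/-- Geometric weights on `{0, …, J}`, with total mass one. -/
noncomputable def geomWeight (J i : ℕ) : ℝ := (1 / 2) ^ i / ∑ k ∈ Finset.range (J + 1), (1 / 2 : ℝ) ^ k

theorem geomWeight_sum_pos (J : ℕ) : 0 < ∑ k ∈ Finset.range (J + 1), (1 / 2 : ℝ) ^ k :=
  Finset.sum_pos (fun _ _ => by positivity) (by simp)

theorem geomWeight_nonneg (J i : ℕ) : 0 ≤ geomWeight J i :=
  div_nonneg (by positivity) (geomWeight_sum_pos J).le

theorem sum_geomWeight (J : ℕ) : ∑ i ∈ Finset.range (J + 1), geomWeight J i = 1 := by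
  simp only [geomWeight]
  rw [← Finset.sum_div, div_self (geomWeight_sum_pos J).ne']

theorem half_pow_div_two_le_geomWeight (J i : ℕ) : (1 / 2) ^ i / 2 ≤ geomWeight J i := by
  refine div_le_div_of_nonneg_left (by positivity) (geomWeight_sum_pos J) ?_
  rw [geom_sum_eq (by norm_num)]
  have : (0 : ℝ) ≤ (1 / 2) ^ (J + 1) := by positivity
  rw [div_le_iff_of_neg (by norm_num)]
  linarith

/-- A mixture of dilates of `p` by the factors `h, h/2, …, h/2^J`. -/
noncomputable def mix (p : ℝ → ℝ) (h : ℝ) (J : ℕ) (x : ℝ) : ℝ :=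
  ∑ i ∈ Finset.range (J + 1), geomWeight J i * dilate p (h / 2 ^ i) x

section

variable {p : ℝ → ℝ} {K : ℝ → ℂ}

theorem isProbDensity_mix (hp : IsProbDensity p) {h : ℝ} (hh : 0 < h) (J : ℕ) :
    IsProbDensity (mix p h J) := by
  have hd : ∀ i : ℕ, IsProbDensity (dilate p (h / 2 ^ i)) := fun i =>
    isProbDensity_dilate hp (by positivity)
  have hi : ∀ i ∈ Finset.range (J + 1), Integrable fun x => geomWeight J i * dilate p (h / 2 ^ i) x :=
    fun i _ => (hd i).integrable.const_mul _
  refine ⟨Finset.measurable_sum _ fun i _ => (hd i).measurable.const_mul _,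
    fun x => Finset.sum_nonneg fun i _ => mul_nonneg (geomWeight_nonneg J i) ((hd i).nonneg x),
    integrable_finsetSum _ hi, ?_⟩
  simp only [mix]
  rw [integral_finsetSum _ hi, ← sum_geomWeight J]
  refine Finset.sum_congr rfl fun i _ => ?_
  rw [integral_const_mul, (hd i).integral_eq_one, mul_one]

theorem geomWeight_mul_dilate_le_mix (hp : IsProbDensity p) {h : ℝ} (hh : 0 < h) {J i : ℕ}
    (hi : i ≤ J) (x : ℝ) : geomWeight J i * dilate p (h / 2 ^ i) x ≤ mix p h J x :=
  Finset.single_le_sum (f := fun i => geomWeight J i * dilate p (h / 2 ^ i) x)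
    (fun i _ => mul_nonneg (geomWeight_nonneg J i)
      ((isProbDensity_dilate hp (s := h / 2 ^ i) (by positivity)).nonneg x))
    (by simpa using Nat.lt_succ_of_le hi)

theorem dilate_le_two_mul_mix (hp : IsProbDensity p) {h : ℝ} (hh : 0 < h) (J : ℕ) (x : ℝ) :
    dilate p h x ≤ 2 * mix p h J x := by
  have h1 := geomWeight_mul_dilate_le_mix hp hh (Nat.zero_le J) x
  have h2 := half_pow_div_two_le_geomWeight J 0
  have h3 := (isProbDensity_dilate hp hh).nonneg x
  simp only [pow_zero, div_one] at h1 h2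
  nlinarith

/-- On a range growing with `J`, the mixture has a Cauchy lower bound that does not depend on `J`. -/
theorem exists_le_mix (hp : IsBandlimitedDensity p K) : ∃ r > 0, ∃ c > 0, ∀ h : ℝ, 0 < h → ∀ (J : ℕ) (z : ℝ),
    h * |z| ≤ r * 2 ^ J → c * h / (1 + h ^ 2 * z ^ 2) ≤ mix p h J z := by
  obtain ⟨r, hr, hball⟩ := Metric.continuous_iff.1 hp.continuous 0 (p 0 / 2) (half_pos hp.pos)
  have hlow : ∀ x, |x| ≤ r / 2 → p 0 / 2 ≤ p x := by
    intro x hx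
    have := hball x (by rw [Real.dist_eq, sub_zero]; linarith)
    rw [Real.dist_eq, abs_lt] at this
    linarith
  refine ⟨r / 2, by positivity, p 0 / 4 / (1 + 16 / r ^ 2), by have := hp.pos; positivity,
    fun h hh J z hz => ?_⟩
  classical
  have hex : ∃ i : ℕ, h * |z| ≤ r / 2 * 2 ^ i := ⟨J, hz⟩
  -- At the least scale where $hz/2^i$ falls in the neighbourhood of 0 on which $p\ge p(0)/2$, the
  -- $i$-th term is of order $2^{-i}\cdot h2^{-i}=h4^{-i}$. Minimality gives $2^i\lesssim h|z|$
  -- unless $i=0$, whence $4^i\lesssim1+h^2z^2$.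
  set i := Nat.find hex with hi
  have hiJ : i ≤ J := Nat.find_min' hex hz
  have hspec : h * |z| ≤ r / 2 * 2 ^ i := Nat.find_spec hex
  refine le_trans ?_ (geomWeight_mul_dilate_le_mix hp.density hh hiJ z)
  have hp0 : p 0 / 2 ≤ p (h / 2 ^ i * z) := by
    refine hlow _ ?_
    rw [abs_mul, abs_of_pos (by positivity), div_mul_eq_mul_div, div_le_iff₀ (by positivity)]
    exact hspec
  have h4 : (4 : ℝ) ^ i ≤ (1 + 16 / r ^ 2) * (1 + h ^ 2 * z ^ 2) := by
    have hprod : (1 + 16 / r ^ 2) * (1 + h ^ 2 * z ^ 2) =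
        1 + 16 / r ^ 2 + h ^ 2 * z ^ 2 + 16 / r ^ 2 * (h ^ 2 * z ^ 2) := by ring
    have hnn : 0 ≤ 16 / r ^ 2 := by positivity
    have hnn2 : 0 ≤ 16 / r ^ 2 * (h ^ 2 * z ^ 2) := by positivity
    have hnn3 : 0 ≤ h ^ 2 * z ^ 2 := by positivity
    rcases Nat.eq_zero_or_pos i with h0 | h0
    · rw [h0, pow_zero]
      linarith
    · have hlt := Nat.find_min hex (Nat.sub_lt h0 one_pos)
      rw [not_le] at hlt
      have h5 : (2 : ℝ) ^ i = 2 * 2 ^ (i - 1) := by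
        rw [← pow_succ', Nat.sub_add_cancel h0]
      have h6 : (2 : ℝ) ^ i ≤ 4 / r * (h * |z|) := by
        rw [h5, div_mul_eq_mul_div, le_div_iff₀ hr]
        linarith
      have h7 : (4 : ℝ) ^ i ≤ 16 / r ^ 2 * (h ^ 2 * z ^ 2) := by
        calc (4 : ℝ) ^ i = (2 ^ i) ^ 2 := by rw [← pow_mul, mul_comm, pow_mul]; norm_num
          _ ≤ (4 / r * (h * |z|)) ^ 2 := pow_le_pow_left₀ (by positivity) h6 2
          _ = _ := by rw [mul_pow, mul_pow, sq_abs, div_pow]; norm_num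
      linarith
  have hw := half_pow_div_two_le_geomWeight J i
  calc p 0 / 4 / (1 + 16 / r ^ 2) * h / (1 + h ^ 2 * z ^ 2)
      = p 0 / 4 * h / ((1 + 16 / r ^ 2) * (1 + h ^ 2 * z ^ 2)) := by field_simp
    _ ≤ p 0 / 4 * h / 4 ^ i :=
        div_le_div_of_nonneg_left (by have := hp.pos; positivity) (by positivity) h4
    _ = (1 / 2) ^ i / 2 * (h / 2 ^ i * (p 0 / 2)) := by
        rw [show (4 : ℝ) ^ i = 2 ^ i * 2 ^ i by rw [← mul_pow]; norm_num, one_div, inv_pow]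
        field_simp
        norm_num
    _ ≤ geomWeight J i * dilate p (h / 2 ^ i) z := by
        unfold dilate
        have := hp.pos
        have := geomWeight_nonneg J i
        gcongr

theorem mix_le (hp : IsBandlimitedDensity p K) {h : ℝ} (hh : 0 < h) (J : ℕ) (x : ℝ) :
    mix p h J x ≤ h * ∫ t, ‖K t‖ := by
  have hK : 0 ≤ ∫ t, ‖K t‖ := integral_nonneg fun t => norm_nonneg _
  calc mix p h J x ≤ ∑ i ∈ Finset.range (J + 1), geomWeight J i * (h * ∫ t, ‖K t‖) := by
        refine Finset.sum_le_sum fun i _ => mul_le_mul_of_nonneg_left ?_ (geomWeight_nonneg J i)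
        refine (hp.dilate_le (by positivity) x).trans (mul_le_mul_of_nonneg_right ?_ hK)
        exact div_le_self hh.le (one_le_pow₀ (by norm_num))
    _ = _ := by rw [← Finset.sum_mul, sum_geomWeight, one_mul]

/-- The centre of the hypercubes: a mixture of a fixed density `γ` and of `mix p h J`. -/
noncomputable def center (γ p : ℝ → ℝ) (α h : ℝ) (J : ℕ) (x : ℝ) : ℝ := (1 - α) * γ x + α * mix p h J x

/-- The hypercube of densities with centre `center γ p α h J` and edges `a * bump p h (lam j)`. -/
noncomputable def family {N : ℕ} (γ p : ℝ → ℝ) (α h : ℝ) (J : ℕ) (a : ℝ) (lam : Fin N → ℝ)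
    (θ : Fin N → Bool) : ℝ → ℝ :=
  hypercube (center γ p α h J) (fun j x => a * bump p h (lam j) x) θ

variable {N : ℕ} {γ : ℝ → ℝ} {α h a : ℝ} {J : ℕ} {lam : Fin N → ℝ}

theorem abs_sum_bump_le (hp : IsProbDensity p) (hh : 0 < h) (ha : 0 ≤ a) (θ : Fin N → Bool) (x : ℝ) :
    |∑ j, if θ j then a * bump p h (lam j) x else 0| ≤ N * a * dilate p h x := by
  have hd := (isProbDensity_dilate hp hh).nonneg x
  calc |∑ j, if θ j then a * bump p h (lam j) x else 0|
      ≤ ∑ j : Fin N, |if θ j then a * bump p h (lam j) x else 0| := Finset.abs_sum_le_sum_abs _ _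
    _ ≤ ∑ _j : Fin N, a * dilate p h x := by
        refine Finset.sum_le_sum fun j _ => ?_
        split_ifs
        · rw [abs_mul, abs_of_nonneg ha]
          exact mul_le_mul_of_nonneg_left (abs_bump_le hp hh _ x) ha
        · rw [abs_zero]; positivity
    _ = _ := by rw [Finset.sum_const, Finset.card_univ, Fintype.card_fin, nsmul_eq_mul, mul_assoc]

/-- The edges together are at most $Na\cdot$`dilate p h`, and the term $i=0$ gives `dilate p h`
$\le2\,$`mix p h J`. With $Na\le\alpha/4$ they consume at most half of the mixture's share $\alpha$.
-/
theorem half_mix_le_family (hp : IsProbDensity p) (hγ : IsProbDensity γ) (hh : 0 < h) (ha : 0 ≤ a)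
    (hα1 : α ≤ 1) (hNa : N * a ≤ α / 4) (θ : Fin N → Bool) (x : ℝ) :
    α / 2 * mix p h J x ≤ family γ p α h J a lam θ x := by
  have h1 := abs_sum_bump_le (lam := lam) hp hh ha θ x
  have h2 := dilate_le_two_mul_mix hp hh J x
  have h3 := (isProbDensity_dilate hp hh).nonneg x
  have h4 := mul_nonneg (sub_nonneg.2 hα1) (hγ.nonneg x)
  have hα : 0 ≤ α / 4 := le_trans (by positivity) hNa
  have h5 := mul_le_mul_of_nonneg_right hNa h3
  have h6 := mul_le_mul_of_nonneg_left h2 hα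
  have h7 := (abs_le.1 h1).1
  unfold family hypercube center
  linarith

theorem isProbDensity_family (hp : IsBandlimitedDensity p K) (hγ : IsProbDensity γ) (hh : 0 < h)
    (ha : 0 ≤ a) (hα0 : 0 ≤ α) (hα1 : α ≤ 1) (hNa : N * a ≤ α / 4) (hlam : ∀ j, h ≤ lam j)
    (θ : Fin N → Bool) : IsProbDensity (family γ p α h J a lam θ) := by
  have hb : ∀ j, Integrable (bump p h (lam j)) := fun j => integrable_bump hp.density hh _
  have hmix := isProbDensity_mix hp.density hh J
  have hbm : ∀ j, Integrable fun x => if θ j then a * bump p h (lam j) x else 0 := by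
    intro j
    split_ifs
    exacts [(hb j).const_mul a, integrable_zero _ _ _]
  have hbmeas : ∀ j, Measurable fun x => if θ j then a * bump p h (lam j) x else 0 := by
    intro j
    have := hp.density.measurable
    split_ifs
    · unfold bump dilate; fun_prop
    · fun_prop
  have i1 : Integrable fun x => (1 - α) * γ x := hγ.integrable.const_mul _
  have i2 : Integrable fun x => α * mix p h J x := hmix.integrable.const_mul _
  have i3 : Integrable fun x => ∑ j, if θ j then a * bump p h (lam j) x else 0 :=
    integrable_finsetSum _ fun j _ => hbm j
  refine ⟨((hγ.measurable.const_mul _).add (hmix.measurable.const_mul _)).add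
    (Finset.measurable_sum _ fun j _ => hbmeas j), fun x => ?_, (i1.add i2).add i3, ?_⟩
  · refine le_trans ?_ (half_mix_le_family hp.density hγ hh ha hα1 hNa θ x)
    have := hmix.nonneg x
    positivity
  · have i4 : Integrable fun x => (1 - α) * γ x + α * mix p h J x := i1.add i2
    simp only [family, hypercube, center]
    rw [integral_add i4 i3, integral_add i1 i2, integral_const_mul, integral_const_mul,
      hγ.integral_eq_one, hmix.integral_eq_one, integral_finsetSum _ fun j _ => hbm j]
    rw [Finset.sum_eq_zero fun j _ => ?_]
    · ring
    · split_ifs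
      · rw [integral_const_mul, hp.integral_bump hh (hlam j), mul_zero]
      · simp

theorem family_le (hp : IsBandlimitedDensity p K) (hh : 0 < h)
    (ha : 0 ≤ a) (hα0 : 0 ≤ α) (hα1 : α ≤ 1) {M : ℝ} (hM : ∀ x, γ x ≤ M)
    (θ : Fin N → Bool) (x : ℝ) : family γ p α h J a lam θ x ≤
      (1 - α) * M + α * (h * ∫ t, ‖K t‖) + N * a * (h * ∫ t, ‖K t‖) := by
  have h1 := (abs_le.1 (abs_sum_bump_le (lam := lam) hp.density hh ha θ x)).2
  have h2 := mul_le_mul_of_nonneg_left (hp.dilate_le hh x) (show 0 ≤ N * a by positivity)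
  have h3 := mul_le_mul_of_nonneg_left (mix_le hp hh J x) hα0
  have h4 := mul_le_mul_of_nonneg_left (hM x) (sub_nonneg.2 hα1)
  unfold family hypercube center
  linarith

theorem family_flip (θ : Fin N → Bool) (j : Fin N) (x : ℝ) :
    family γ p α h J a lam (flip j θ) x = family γ p α h J a lam θ x +
      (if θ j then -1 else 1) * (a * bump p h (lam j) x) := by
  have hsplit : ∀ τ : Fin N → Bool, (∑ i, if τ i then a * bump p h (lam i) x else 0) =
      (if τ j then a * bump p h (lam j) x else 0) +
        ∑ i ∈ Finset.univ.erase j, if τ i then a * bump p h (lam i) x else 0 := fun τ =>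
    (Finset.add_sum_erase _ _ (Finset.mem_univ j)).symm
  have hrest : (∑ i ∈ Finset.univ.erase j, if flip j θ i then a * bump p h (lam i) x else 0) =
      ∑ i ∈ Finset.univ.erase j, if θ i then a * bump p h (lam i) x else 0 := by
    refine Finset.sum_congr rfl fun i hi => ?_
    rw [flip, Function.update_of_ne (Finset.ne_of_mem_erase hi)]
  simp only [family, hypercube]
  rw [hsplit, hsplit θ, hrest, flip_apply_self]
  cases θ j <;> simp <;> ring

end

end

/-! ### Chi-square divergence of neighbouring vertices, and the general lower bound. -/

section

theorem IsProbDensity.exists_Icc {q : ℝ → ℝ} (hq : IsProbDensity q) {ε : ℝ} (hε : 0 < ε) :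
    ∃ R : ℝ, 0 < R ∧ 1 - ε ≤ ∫ x in Set.Icc (-R) R, q x := by
  have h1 := intervalIntegral_tendsto_integral hq.integrable
    (tendsto_neg_atTop_atBot.comp tendsto_id) (tendsto_id (α := ℝ) (x := atTop))
  rw [hq.integral_eq_one] at h1
  obtain ⟨R, hR, hR0⟩ := ((h1.eventually (lt_mem_nhds (show 1 - ε < 1 by linarith))).and
    (eventually_gt_atTop 0)).exists
  refine ⟨R, hR0, hR.le.trans (le_of_eq ?_)⟩
  simp only [Function.comp, id]
  rw [intervalIntegral.integral_of_le (by linarith), integral_Icc_eq_integral_Ioc]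

theorem IsProbDensity.exists_lintegral_compl_le {q : ℝ → ℝ} (hq : IsProbDensity q) {ε : ℝ}
    (hε : 0 < ε) : ∃ R : ℝ, 0 < R ∧ ∫⁻ x in (Set.Icc (-R) R)ᶜ, ENNReal.ofReal (q x) ≤ ENNReal.ofReal ε := by
  obtain ⟨R, hR0, hR⟩ := hq.exists_Icc hε
  refine ⟨R, hR0, ?_⟩
  rw [← ofReal_integral_eq_lintegral_ofReal hq.integrable.integrableOn
    (Eventually.of_forall hq.nonneg)]
  refine ENNReal.ofReal_le_ofReal ?_
  have := integral_add_compl (measurableSet_Icc (a := -R) (b := R)) hq.integrable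
  rw [hq.integral_eq_one] at this
  linarith

theorem abs_dconv_le {u v g : ℝ → ℝ} {M : ℝ} (huv : ∀ x, |u x| ≤ v x)
    (hv : Measurable v) (hM : ∀ x, |v x| ≤ M) (hg : IsProbDensity g) (x : ℝ) :
    |dconv u g x| ≤ dconv v g x := by
  unfold dconv
  refine (abs_integral_le_integral_abs).trans ?_
  refine integral_mono_of_nonneg (Eventually.of_forall fun y => abs_nonneg _)
    (integrable_comp_sub_mul hv hM hg.integrable x) (Eventually.of_forall fun y => ?_)
  simp only
  rw [abs_mul, abs_of_nonneg (hg.nonneg y)]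
  exact mul_le_mul_of_nonneg_right (huv _) (hg.nonneg y)

theorem le_dconv {f g : ℝ → ℝ} {M m b x : ℝ} (hf : IsProbDensity f) (hM : ∀ x, f x ≤ M)
    (hg : IsProbDensity g) (hm : 1 / 2 ≤ ∫ y in Set.Icc (-m) m, g y) (hb : 0 ≤ b)
    (hlow : ∀ y ∈ Set.Icc (-m) m, b ≤ f (x - y)) : b / 2 ≤ dconv f g x := by
  have hi := integrable_comp_sub_mul (M := M) hf.measurable
    (fun x => by rw [abs_of_nonneg (hf.nonneg x)]; exact hM x) hg.integrable x
  calc b / 2 ≤ b * ∫ y in Set.Icc (-m) m, g y := by nlinarith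
    _ = ∫ y in Set.Icc (-m) m, b * g y := by rw [integral_const_mul]
    _ ≤ ∫ y in Set.Icc (-m) m, f (x - y) * g y :=
        setIntegral_mono_on (hg.integrable.integrableOn.const_mul b) hi.integrableOn
          measurableSet_Icc fun y hy => mul_le_mul_of_nonneg_right (hlow y hy) (hg.nonneg y)
    _ ≤ dconv f g x :=
        setIntegral_le_integral hi (Eventually.of_forall fun y => mul_nonneg (hf.nonneg _) (hg.nonneg y))

/-- Integrates $P+Q^2/P=2Q+(Q-P)^2/P$, arranged without subtraction so that it makes sense in
$[0,\infty]$. Where $P=0$ the bound on $D$ forces $Q=0$, and the identity survives division by zero.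
-/
theorem lintegral_sq_div_le {P Q D : ℝ → ℝ} (hP : IsProbDensity P) (hQ : IsProbDensity Q)
    (hD : ∀ x, (Q x - P x) ^ 2 = D x ^ 2) (hDP : ∀ x, |D x| ≤ P x) :
    ∫⁻ x, ENNReal.ofReal (Q x ^ 2 / P x) ≤ 1 + ∫⁻ x, ENNReal.ofReal (D x ^ 2 / P x) := by
  have hPm := hP.measurable
  have hQm := hQ.measurable
  have one : ∀ {q : ℝ → ℝ}, IsProbDensity q → ∫⁻ x, ENNReal.ofReal (q x) = 1 := fun {q} hq => by
    rw [← ofReal_integral_eq_lintegral_ofReal hq.integrable (Eventually.of_forall hq.nonneg),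
      hq.integral_eq_one, ENNReal.ofReal_one]
  have hpt : ∀ x, ENNReal.ofReal (P x) + ENNReal.ofReal (Q x ^ 2 / P x) =
      2 * ENNReal.ofReal (Q x) + ENNReal.ofReal (D x ^ 2 / P x) := by
    intro x
    have hPx := hP.nonneg x
    have hQx := hQ.nonneg x
    rw [← ENNReal.ofReal_ofNat 2, ← ENNReal.ofReal_mul (by norm_num),
      ← ENNReal.ofReal_add hPx (by positivity), ← ENNReal.ofReal_add (by positivity) (by positivity)]
    congr 1
    rcases hPx.eq_or_lt with h0 | h0
    · have hD0 : D x = 0 := by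
        have := hDP x
        rw [← h0] at this
        exact abs_nonpos_iff.1 this
      have h2 := hD x
      rw [hD0, ← h0] at h2
      have : Q x = 0 := by simpa using h2
      simp [← h0, this]
    · rw [← hD]
      field_simp
      ring
  have hint := lintegral_congr (μ := volume) hpt
  rw [lintegral_add_left (by fun_prop), lintegral_add_left (by fun_prop),
    lintegral_const_mul _ (by fun_prop), one hP, one hQ, mul_one] at hint
  refine (ENNReal.add_le_add_iff_left (a := 1) (by simp)).1 ?_
  rw [hint, ← add_assoc, one_add_one_eq_two]

/-- The Cauchy lower bound is available only on $[-R,R]$. Outside, $D^2/P\le|D|\le aG\le G$, so only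
the tail of `G` is paid. -/
theorem lintegral_sq_div_le_add {P D G : ℝ → ℝ} {c h a R : ℝ} (hc : 0 < c) (hh : 0 < h)
    (hDm : Measurable D) (hDP : ∀ x, |D x| ≤ P x) (hDG : ∀ x, |D x| ≤ a * G x)
    (ha1 : a ≤ 1) (hG : ∀ x, 0 ≤ G x)
    (hlow : ∀ x, |x| ≤ R → c * h / (1 + h ^ 2 * x ^ 2) ≤ P x) :
    ∫⁻ x, ENNReal.ofReal (D x ^ 2 / P x) ≤ ENNReal.ofReal (1 / (c * h)) *
      (∫⁻ x, ENNReal.ofReal ((1 + h ^ 2 * x ^ 2) * D x ^ 2)) +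
      ∫⁻ x in (Set.Icc (-R) R)ᶜ, ENNReal.ofReal (G x) := by
  rw [← lintegral_const_mul _ (by fun_prop), ← lintegral_indicator measurableSet_Icc.compl,
    ← lintegral_add_left (by fun_prop)]
  refine lintegral_mono fun x => ?_
  by_cases hx : x ∈ Set.Icc (-R) R
  · have hPx := hlow x (abs_le.2 hx)
    refine le_add_right ?_
    rw [← ENNReal.ofReal_mul (by positivity)]
    refine ENNReal.ofReal_le_ofReal ?_
    calc D x ^ 2 / P x ≤ D x ^ 2 / (c * h / (1 + h ^ 2 * x ^ 2)) :=
          div_le_div_of_nonneg_left (sq_nonneg _) (by positivity) hPx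
      _ = _ := by field_simp
  · refine le_add_left ?_
    rw [Set.indicator_of_mem (Set.mem_compl hx)]
    refine ENNReal.ofReal_le_ofReal ?_
    have h1 : D x ^ 2 / P x ≤ |D x| := by
      rcases (abs_nonneg (D x)).eq_or_lt with h0 | h0
      · have : D x = 0 := abs_eq_zero.1 h0.symm
        simp [this]
      · rw [div_le_iff₀ (h0.trans_le (hDP x)), ← sq_abs, sq]
        exact mul_le_mul_of_nonneg_left (hDP x) h0.le
    refine h1.trans ((hDG x).trans ?_)
    exact mul_le_of_le_one_left (hG x) ha1

variable {p : ℝ → ℝ} {K : ℝ → ℂ}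

/-- The Cauchy lower bound for the mixture passes to the density of the observations. -/
theorem exists_le_dconv_of_mix_le (hp : IsBandlimitedDensity p K) {g : ℝ → ℝ} (hg : IsProbDensity g)
    {α : ℝ} (hα : 0 < α) : ∃ c > 0, ∀ h, 0 < h → h ≤ 1 → ∀ R : ℝ, ∃ J : ℕ, ∀ (f : ℝ → ℝ) (M : ℝ),
      IsProbDensity f → (∀ x, f x ≤ M) → (∀ x, α / 2 * mix p h J x ≤ f x) →
      ∀ x, |x| ≤ R → c * h / (1 + h ^ 2 * x ^ 2) ≤ dconv f g x := by
  obtain ⟨r, hr, c, hc, hmix⟩ := exists_le_mix hp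
  obtain ⟨m, hm0, hm⟩ := hg.exists_Icc (ε := 1 / 2) (by norm_num)
  refine ⟨α / 4 * c / (2 + 2 * m ^ 2), by positivity, fun h hh hh1 R => ?_⟩
  -- $J$ must cover $x-y$ with $|x|\le R$ and $|y|\le m$, where $[-m,m]$ carries at least half of
  -- the error mass; the constant `c` does not depend on it.
  obtain ⟨J, hJ⟩ := pow_unbounded_of_one_lt (h * (R + m) / r) (one_lt_two (α := ℝ))
  refine ⟨J, fun f M hf hM hlow x hx => ?_⟩
  have hden : ∀ y ∈ Set.Icc (-m) m, 1 + h ^ 2 * (x - y) ^ 2 ≤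
      (2 + 2 * m ^ 2) * (1 + h ^ 2 * x ^ 2) := by
    intro y hy
    have hy2 : y ^ 2 ≤ m ^ 2 := sq_le_sq' hy.1 hy.2
    have hh2 : h ^ 2 ≤ 1 := pow_le_one₀ hh.le hh1
    have e1 : h ^ 2 * (x - y) ^ 2 ≤ h ^ 2 * (2 * x ^ 2 + 2 * m ^ 2) :=
      mul_le_mul_of_nonneg_left (by nlinarith [sq_nonneg (x + y)]) (sq_nonneg h)
    have e2 : h ^ 2 * (2 * m ^ 2) ≤ 2 * m ^ 2 := mul_le_of_le_one_left (by positivity) hh2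
    have e3 : 0 ≤ 2 * m ^ 2 * (h ^ 2 * x ^ 2) := by positivity
    nlinarith
  have key := le_dconv (b := α / 2 * (c * h / ((2 + 2 * m ^ 2) * (1 + h ^ 2 * x ^ 2)))) (x := x)
    hf hM hg (m := m) (by linarith) (by positivity) fun y hy => by
      refine le_trans ?_ (hlow _)
      refine mul_le_mul_of_nonneg_left (le_trans ?_ (hmix h hh J (x - y) ?_)) (by positivity)
      · exact div_le_div_of_nonneg_left (by positivity) (by positivity) (hden y hy)
      · rw [div_lt_iff₀ hr] at hJ
        have : |x - y| ≤ R + m := (abs_sub x y).trans (add_le_add hx (abs_le.2 hy))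
        calc h * |x - y| ≤ h * (R + m) := mul_le_mul_of_nonneg_left this hh.le
          _ ≤ _ := by linarith
  refine le_trans (le_of_eq ?_) key
  field_simp
  norm_num

theorem dconv_family_flip (hp : IsBandlimitedDensity p K) {g γ : ℝ → ℝ} (hg : IsProbDensity g)
    {N : ℕ} {α h a M : ℝ} {J : ℕ} {lam : Fin N → ℝ} (hh : 0 < h)
    (hdens : ∀ θ, IsProbDensity (family γ p α h J a lam θ))
    (hM : ∀ θ x, family γ p α h J a lam θ x ≤ M) (θ : Fin N → Bool) (j : Fin N) (x : ℝ) :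
    dconv (family γ p α h J a lam (flip j θ)) g x = dconv (family γ p α h J a lam θ) g x +
      (if θ j then -1 else 1) * (a * dconv (bump p h (lam j)) g x) := by
  have hm := hp.density.measurable
  have h1 := integrable_comp_sub_mul (M := M) (hdens θ).measurable
    (fun x => by rw [abs_of_nonneg ((hdens θ).nonneg x)]; exact hM θ x) hg.integrable x
  have h2 := integrable_comp_sub_mul (f := bump p h (lam j)) (M := h * ∫ t, ‖K t‖)
    (by unfold bump dilate; fun_prop)
    (fun x => (abs_bump_le hp.density hh _ x).trans (hp.dilate_le hh x)) hg.integrable x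
  simp only [dconv]
  rw [← integral_const_mul, ← integral_const_mul, ← integral_add h1 ((h2.const_mul _).const_mul _)]
  refine integral_congr_ae (Eventually.of_forall fun y => ?_)
  simp only [family_flip]
  ring

/-- The two applications differ only in the parameters. `A` measures the size of the error transform
on the windows, $n a^2A^2\le\kappa$ keeps neighbours indistinguishable, and the risk is then at
least of order $N\cdot a^2h$. `κ` is uniform in all parameters; `J` may depend on them, but not on
the estimator. -/
theorem family_lower_bound (hp : IsBandlimitedDensity p K) {g γ : ℝ → ℝ} (hg : IsProbDensity g)
    (hγ : IsProbDensity γ) {Mγ : ℝ} (hMγ : ∀ x, γ x ≤ Mγ) {α : ℝ} (hα : 0 < α) (hα1 : α ≤ 1) :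
    ∃ κ > 0, ∀ (n N : ℕ) (h a A : ℝ) (lam : Fin N → ℝ), 0 < n → 0 < N → 0 < h → h ≤ 1 → 0 < a →
      N * a ≤ α / 4 → (∀ j, h ≤ lam j) → (∀ i j, i ≠ j → 2 * h ≤ |lam i - lam j|) →
      (∀ j t, |t - lam j| < h → ‖ft g t‖ ≤ A) →
      (∀ j t, |t - lam j| < h → t ≠ lam j →
        DifferentiableAt ℝ (ft g) t ∧ ‖deriv (ft g) t‖ ≤ A / h) →
      n * (a ^ 2 * A ^ 2) ≤ κ → ∃ J : ℕ, ∀ (est : Estimator) (S : ℝ≥0∞),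
        (∀ θ, mise est (family γ p α h J a lam θ) g n ≤ S) →
        ENNReal.ofReal (κ * (N * a ^ 2 * h)) ≤ S := by
  obtain ⟨k₁, hk0, hk₁⟩ := hp.exists_norm_deriv_le
  obtain ⟨c, hc, hlow⟩ := exists_le_dconv_of_mix_le hp hg hα
  have hpi := Real.pi_pos
  have hI := hp.integral_sq_pos
  set B := 4 * Real.pi * (1 + (k₁ + 1) ^ 2) with hB
  have hB0 : 0 < B := by positivity
  -- The first entry makes the weighted part of the chi-square divergence at most $1/(4n)$. The
  -- second is the factor $1/8$ from Assouad's lemma times the $\frac12\int p^2$ in the squared norm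
  -- of an edge.
  refine ⟨min (c / (4 * B)) ((∫ x, p x * p x) / 16), lt_min (by positivity) (by positivity),
    fun n N h a A lam hn hN hh hh1 ha hNa hlam hsep hA hA' hκ => ?_⟩
  have hn' : (0 : ℝ) < n := by exact_mod_cast hn
  have hN1 : (1 : ℝ) ≤ N := by exact_mod_cast hN
  have ha4 : a ≤ α / 4 := le_trans (le_mul_of_one_le_left ha.le hN1) hNa
  have hpm := hp.density.measurable
  have hdil := isProbDensity_dilate hp.density hh
  have hdilM : ∀ x, dilate p h x ≤ h * ∫ t, ‖K t‖ := hp.dilate_le hh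
  set G := dconv (dilate p h) g with hG
  have hGdens : IsProbDensity G := isProbDensity_dconv hdil hdilM hg
  -- The dominating density `G` does not involve `J`; so `R` can be fixed first, with a tail of at
  -- most $1/(4n)$, and `J` chosen for that `R`.
  obtain ⟨R, hR0, hR⟩ := hGdens.exists_lintegral_compl_le (ε := 1 / (4 * n)) (by positivity)
  obtain ⟨J, hJ⟩ := hlow h hh hh1 R
  refine ⟨J, fun est S hS => ?_⟩
  have hdens : ∀ θ, IsProbDensity (family γ p α h J a lam θ) :=
    isProbDensity_family hp hγ hh ha.le hα.le hα1 hNa hlam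
  obtain ⟨M, hM⟩ : ∃ M, ∀ θ x, family γ p α h J a lam θ x ≤ M :=
    ⟨_, fun θ x => family_le hp hh ha.le hα.le hα1 hMγ θ x⟩
  have hhalf : ∀ θ x, α / 2 * mix p h J x ≤ family γ p α h J a lam θ x :=
    half_mix_le_family hp.density hγ hh ha.le hα1 hNa
  have hflip := dconv_family_flip hp hg hh hdens hM
  have hbm : ∀ j, Measurable (bump p h (lam j)) := fun j => by unfold bump dilate; fun_prop
  have hDm : ∀ j, Measurable fun x => a * dconv (bump p h (lam j)) g x := fun j =>
    (measurable_dconv (hbm j) hg.measurable).const_mul a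
  have hDG : ∀ j x, |a * dconv (bump p h (lam j)) g x| ≤ a * G x := by
    intro j x
    rw [abs_mul, abs_of_pos ha]
    refine mul_le_mul_of_nonneg_left ?_ ha.le
    exact abs_dconv_le (abs_bump_le hp.density hh _) hdil.measurable
      (fun x => by rw [abs_of_nonneg (hdil.nonneg x)]; exact hdilM x) hg x
  have hDP : ∀ θ j x, |a * dconv (bump p h (lam j)) g x| ≤ dconv (family γ p α h J a lam θ) g x := by
    intro θ j x
    have e1 : a * dconv (bump p h (lam j)) g x = dconv (fun x => a * bump p h (lam j) x) g x := by
      simp only [dconv]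
      rw [← integral_const_mul]
      exact integral_congr_ae (Eventually.of_forall fun y => by simp only; ring)
    rw [e1]
    refine abs_dconv_le (M := M) (fun x => ?_) (hdens θ).measurable
      (fun x => by rw [abs_of_nonneg ((hdens θ).nonneg x)]; exact hM θ x) hg x
    refine le_trans ?_ (hhalf θ x)
    rw [abs_mul, abs_of_pos ha]
    have e2 := abs_bump_le hp.density hh (lam j) x
    have e3 := dilate_le_two_mul_mix hp.density hh J x
    calc a * |bump p h (lam j) x| ≤ α / 4 * (2 * mix p h J x) :=
          mul_le_mul ha4 (e2.trans e3) (abs_nonneg _) (by positivity)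
      _ = _ := by ring
  have hP : ∀ θ, IsProbDensity (dconv (family γ p α h J a lam θ) g) := fun θ =>
    isProbDensity_dconv (hdens θ) (hM θ) hg
  have hχ : ∀ θ j, ∫⁻ x, ENNReal.ofReal ((dconv (family γ p α h J a lam (flip j θ)) g x) ^ 2 /
      dconv (family γ p α h J a lam θ) g x) ≤ ENNReal.ofReal (1 + 1 / (2 * n)) := by
    intro θ j
    refine (lintegral_sq_div_le (hP θ) (hP (flip j θ)) (fun x => ?_) (hDP θ j)).trans ?_
    · rw [hflip]
      split_ifs <;> ring
    rw [ENNReal.ofReal_add zero_le_one (by positivity), ENNReal.ofReal_one]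
    refine add_le_add_right ?_ _
    have ha1 : a ≤ 1 := by linarith
    refine (lintegral_sq_div_le_add (G := G) hc hh (hDm j) (hDP θ j) (hDG j) ha1
      hGdens.nonneg (hJ _ M (hdens θ) (hM θ) (hhalf θ))).trans ?_
    have hw := hp.lintegral_weighted_sq_dconv_bump_le hk₁ hg.integrable hh (hA j) (hA' j)
    have hpull : ∫⁻ x, ENNReal.ofReal ((1 + h ^ 2 * x ^ 2) * (a * dconv (bump p h (lam j)) g x) ^ 2) =
        ENNReal.ofReal (a ^ 2) *
          ∫⁻ x, ENNReal.ofReal ((1 + h ^ 2 * x ^ 2) * dconv (bump p h (lam j)) g x ^ 2) := by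
      have := measurable_dconv (hbm j) hg.measurable
      rw [← lintegral_const_mul _ (by fun_prop)]
      refine lintegral_congr fun x => ?_
      rw [← ENNReal.ofReal_mul (by positivity)]
      congr 1
      ring
    calc _ ≤ ENNReal.ofReal (1 / (c * h)) * (ENNReal.ofReal (a ^ 2) * ENNReal.ofReal (B * h * A ^ 2)) +
          ENNReal.ofReal (1 / (4 * n)) := by
          rw [hpull]
          gcongr
      _ ≤ ENNReal.ofReal (1 / (4 * n)) + ENNReal.ofReal (1 / (4 * n)) := by
          refine add_le_add_left ?_ _
          rw [← ENNReal.ofReal_mul (by positivity), ← ENNReal.ofReal_mul (by positivity)]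
          refine ENNReal.ofReal_le_ofReal ?_
          have e1 : n * (a ^ 2 * A ^ 2) ≤ c / (4 * B) := hκ.trans (min_le_left _ _)
          rw [le_div_iff₀ (by positivity)] at e1
          rw [le_div_iff₀ (by positivity)]
          have e2 : 1 / (c * h) * (a ^ 2 * (B * h * A ^ 2)) * (4 * n) =
              n * (a ^ 2 * A ^ 2) * (4 * B) / c := by field_simp
          rw [e2, div_le_one hc]
          exact e1
      _ = _ := by
          rw [← ENNReal.ofReal_add (by positivity) (by positivity)]
          congr 1
          field_simp
          norm_num
  have hcm : Measurable (center γ p α h J) :=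
    (hγ.measurable.const_mul _).add ((isProbDensity_mix hp.density hh J).measurable.const_mul _)
  have hprod : ∀ i j, ∫ x, (a * bump p h (lam i) x) * (a * bump p h (lam j) x) =
      if i = j then a ^ 2 * (h / 2 * ∫ x, p x * p x) else 0 := by
    intro i j
    have e1 : ∀ x, (a * bump p h (lam i) x) * (a * bump p h (lam j) x) =
        a ^ 2 * (bump p h (lam i) x * bump p h (lam j) x) := fun x => by ring
    simp_rw [e1]
    rw [integral_const_mul]
    split_ifs with hij
    · rw [hij, hp.integral_bump_mul_self hh (hlam j)]
    · rw [hp.integral_bump_mul_bump_of_ne hh (hlam i) (hlam j) (hsep i j hij), mul_zero]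
  have key := assouad (n := n) (f₀ := center γ p α h J) (Δ := fun j x => a * bump p h (lam j) x)
    (d := a ^ 2 * (h / 2 * ∫ x, p x * p x)) (M := M) hg (by positivity)
    (fun j => (hp.memLp_bump hh (lam j)).const_mul a) hcm (fun j => (hbm j).const_mul a) hprod
    hdens hM (fun θ j x hx => ?_) hχ est hS
  · refine le_trans (ENNReal.ofReal_le_ofReal ?_) key
    calc min (c / (4 * B)) ((∫ x, p x * p x) / 16) * (N * a ^ 2 * h)
        ≤ (∫ x, p x * p x) / 16 * (N * a ^ 2 * h) := by
          gcongr
          exact min_le_right _ _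
      _ = _ := by ring
  · have e1 := hflip θ j x
    have e2 := hDP θ j x
    unfold family at e1 e2
    rw [hx] at e1 e2
    rw [e1, abs_nonpos_iff.1 e2]
    simp

end

/-! ### The class $\mathcal F^2$ forces $C>1$; Gaussian densities come arbitrarily close. -/

section

/-- The integrand of the functional that defines `classF2`. -/
noncomputable def smoothness (β : ℝ) (φ : ℝ → ℂ) (t : ℝ) : ℝ :=
  (‖φ t‖ ^ 2 + ‖φ t‖ * ‖deriv φ t‖) * (1 + t ^ 2) ^ β

theorem tendsto_ft_cocompact (f : ℝ → ℝ) : Tendsto (ft f) (cocompact ℝ) (𝓝 0) := by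
  have h1 := Real.tendsto_integral_exp_smul_cocompact (fun x => (f x : ℂ))
  have hne : -(2 * Real.pi)⁻¹ ≠ 0 := by have := Real.pi_pos; exact neg_ne_zero.2 (by positivity)
  have h2 : Tendsto (fun t : ℝ => -(2 * Real.pi)⁻¹ * t) (cocompact ℝ) (cocompact ℝ) :=
    (Homeomorph.mulLeft₀ _ hne).isClosedEmbedding.tendsto_cocompact
  refine (h1.comp h2).congr fun t => ?_
  simp only [Function.comp, ft]
  refine integral_congr_ae (Eventually.of_forall fun x => ?_)
  simp only
  rw [Circle.smul_def, Real.fourierChar_apply, smul_eq_mul]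
  congr 3
  have := Real.pi_pos
  push_cast
  field_simp

/-- $|\varphi|^2$ rises from 0 at $-\infty$ to 1 at the origin and returns to 0, by the
Riemann–Lebesgue lemma. Its total variation is at least 2, and its derivative is at most
$2|\varphi||\varphi'|$. -/
theorem one_le_integral_norm_mul_norm_deriv {f : ℝ → ℝ} (hf : IsProbDensity f)
    (hd : Differentiable ℝ (ft f)) (hint : Integrable fun t => ‖ft f t‖ * ‖deriv (ft f) t‖) :
    1 ≤ ∫ t, ‖ft f t‖ * ‖deriv (ft f) t‖ := by
  set q' : ℝ → ℝ := fun t => 2 * inner ℝ (ft f t) (deriv (ft f) t) with hq'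
  have hder : ∀ t, HasDerivAt (fun t => ‖ft f t‖ ^ 2) (q' t) t := fun t =>
    (hd t).hasDerivAt.norm_sq
  have hm : Measurable q' :=
    ((continuous_ft hf.integrable).measurable.inner (measurable_deriv _)).const_mul 2
  have hbound : ∀ t, |q' t| ≤ 2 * (‖ft f t‖ * ‖deriv (ft f) t‖) := by
    intro t
    rw [hq', abs_mul, abs_two]
    exact mul_le_mul_of_nonneg_left (abs_real_inner_le_norm _ _) zero_le_two
  have hq'int : Integrable q' :=
    (hint.const_mul 2).mono' hm.aestronglyMeasurable (Eventually.of_forall hbound)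
  have hlim : Tendsto (fun t => ‖ft f t‖ ^ 2) (cocompact ℝ) (𝓝 0) := by
    simpa using ((tendsto_ft_cocompact f).norm.pow 2)
  rw [cocompact_eq_atBot_atTop, tendsto_sup] at hlim
  have hzero : ‖ft f 0‖ ^ 2 = 1 := by
    rw [ft_zero, hf.integral_eq_one]
    simp
  have e1 := integral_Ioi_of_hasDerivAt_of_tendsto' (a := 0) (fun t _ => hder t)
    hq'int.integrableOn hlim.2
  have e2 := integral_Iic_of_hasDerivAt_of_tendsto' (a := 0) (fun t _ => hder t)
    hq'int.integrableOn hlim.1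
  rw [hzero] at e1 e2
  have b1 : 1 ≤ ∫ t in Set.Ioi (0 : ℝ), 2 * (‖ft f t‖ * ‖deriv (ft f) t‖) := by
    have := abs_integral_le_integral_abs (μ := volume.restrict (Set.Ioi (0 : ℝ))) (f := q')
    rw [e1] at this
    refine le_trans (by norm_num) (this.trans ?_)
    exact integral_mono hq'int.abs.integrableOn (hint.const_mul 2).integrableOn hbound
  have b2 : 1 ≤ ∫ t in Set.Iic (0 : ℝ), 2 * (‖ft f t‖ * ‖deriv (ft f) t‖) := by
    have := abs_integral_le_integral_abs (μ := volume.restrict (Set.Iic (0 : ℝ))) (f := q')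
    rw [e2] at this
    refine le_trans (by norm_num) (this.trans ?_)
    exact integral_mono hq'int.abs.integrableOn (hint.const_mul 2).integrableOn hbound
  have e3 := integral_add_compl (measurableSet_Iic (a := (0 : ℝ))) (hint.const_mul 2)
  have e4 : ∫ t, 2 * (‖ft f t‖ * ‖deriv (ft f) t‖) = 2 * ∫ t, ‖ft f t‖ * ‖deriv (ft f) t‖ :=
    integral_const_mul _ _
  rw [Set.compl_Iic] at e3
  linarith

/-- The weight is at least 1 and the product term already contributes 1. Strictness comes from
$\int|\varphi|^2>0$. -/
theorem one_lt_of_mem_classF2 {β C : ℝ} (hβ : 0 ≤ β) {f : ℝ → ℝ} (hf : f ∈ classF2 β C) : 1 < C := by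
  obtain ⟨hdens, hd, hC⟩ := hf
  have hc := continuous_ft hdens.integrable
  have hm := measurable_deriv (ft f)
  have hcm := hc.measurable
  have hw : ∀ t : ℝ, 1 ≤ (1 + t ^ 2) ^ β := fun t =>
    Real.one_le_rpow (by nlinarith [sq_nonneg t]) hβ
  have hle : ∫⁻ t, ENNReal.ofReal (‖ft f t‖ ^ 2) + ENNReal.ofReal (‖ft f t‖ * ‖deriv (ft f) t‖) ≤
      ENNReal.ofReal C := by
    refine le_trans (lintegral_mono fun t => ?_) hC
    rw [← ENNReal.ofReal_add (by positivity) (by positivity)]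
    exact ENNReal.ofReal_le_ofReal (le_mul_of_one_le_right (by positivity) (hw t))
  rw [lintegral_add_left (by fun_prop)] at hle
  have hfin : ∫⁻ t, ENNReal.ofReal (‖ft f t‖ * ‖deriv (ft f) t‖) < ∞ :=
    (le_add_self.trans hle).trans_lt ENNReal.ofReal_lt_top
  have hint : Integrable fun t => ‖ft f t‖ * ‖deriv (ft f) t‖ := by
    refine ⟨(by fun_prop : Measurable _).aestronglyMeasurable, ?_⟩
    rwa [hasFiniteIntegral_iff_ofReal (Eventually.of_forall fun t => by positivity)]
  have h1 : 1 ≤ ∫⁻ t, ENNReal.ofReal (‖ft f t‖ * ‖deriv (ft f) t‖) := by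
    rw [← ofReal_integral_eq_lintegral_ofReal hint (Eventually.of_forall fun t => by positivity),
      ENNReal.one_le_ofReal]
    exact one_le_integral_norm_mul_norm_deriv hdens hd hint
  have h2 : 0 < ∫⁻ t, ENNReal.ofReal (‖ft f t‖ ^ 2) := by
    rw [pos_iff_ne_zero, Ne, lintegral_eq_zero_iff (by fun_prop)]
    intro h
    have h' := congrFun (Continuous.ae_eq_iff_eq volume
      (ENNReal.continuous_ofReal.comp (hc.norm.pow 2)) continuous_const |>.1 h) 0
    simp [ft_zero, hdens.integral_eq_one] at h'
  have h3 : 1 < ENNReal.ofReal C := by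
    refine lt_of_lt_of_le ?_ hle
    calc (1 : ℝ≥0∞) = 0 + 1 := (zero_add 1).symm
      _ < _ := ENNReal.add_lt_add_of_lt_of_le (by simp) h2 h1
  rwa [ENNReal.one_lt_ofReal] at h3

/-- The centred Gaussian density with standard deviation `1 / s`. -/
noncomputable def gauss (s : ℝ) : ℝ → ℝ := dilate (ProbabilityTheory.gaussianPDFReal 0 1) s

theorem isProbDensity_gauss {s : ℝ} (hs : 0 < s) : IsProbDensity (gauss s) :=
  isProbDensity_dilate ⟨ProbabilityTheory.measurable_gaussianPDFReal 0 1,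
    ProbabilityTheory.gaussianPDFReal_nonneg 0 1, ProbabilityTheory.integrable_gaussianPDFReal 0 1,
    ProbabilityTheory.integral_gaussianPDFReal_eq_one 0 one_ne_zero⟩ hs

theorem gauss_le {s : ℝ} (hs : 0 < s) (x : ℝ) : gauss s x ≤ s := by
  refine mul_le_of_le_one_right hs.le ?_
  rw [ProbabilityTheory.gaussianPDFReal_def]
  have h1 : (√(2 * Real.pi * (1 : NNReal)))⁻¹ ≤ 1 := by
    refine inv_le_one_of_one_le₀ (Real.one_le_sqrt.2 ?_)
    have := Real.pi_gt_three
    norm_num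
    linarith
  refine mul_le_one₀ h1 (Real.exp_pos _).le (Real.exp_le_one_iff.2 ?_)
  exact div_nonpos_of_nonpos_of_nonneg (neg_nonpos.2 (sq_nonneg _)) (by positivity)

theorem ft_gauss {s : ℝ} (hs : 0 < s) (t : ℝ) :
    ft (gauss s) t = (Real.exp (-(t / s) ^ 2 / 2) : ℂ) := by
  rw [gauss, ft_dilate _ hs]
  have h1 := ProbabilityTheory.charFun_gaussianReal (μ := 0) (v := 1) (t / s)
  rw [charFun_apply_real, ProbabilityTheory.integral_gaussianReal_eq_integral_smul one_ne_zero] at h1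
  rw [ft]
  calc _ = _ := ?_
    _ = _ := h1
    _ = _ := ?_
  · refine integral_congr_ae (Eventually.of_forall fun x => ?_)
    simp [mul_comm]
  · push_cast
    congr 1
    simp
    ring

/-- The inequality $1+x\le e^x$ at $x=u^2/(2\beta)$, raised to the power $\beta$; $2\beta\ge1$
absorbs the constant term. -/
theorem one_add_sq_rpow_le {β : ℝ} (hβ : 1 / 2 ≤ β) (u : ℝ) :
    (1 + u ^ 2) ^ β ≤ (2 * β) ^ β * Real.exp (u ^ 2 / 2) := by
  have h1 : 1 + u ^ 2 ≤ 2 * β * Real.exp (u ^ 2 / (2 * β)) := by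
    have := Real.add_one_le_exp (u ^ 2 / (2 * β))
    have h2 : 2 * β * (u ^ 2 / (2 * β) + 1) ≤ 2 * β * Real.exp (u ^ 2 / (2 * β)) :=
      mul_le_mul_of_nonneg_left this (by linarith)
    have h3 : 2 * β * (u ^ 2 / (2 * β) + 1) = u ^ 2 + 2 * β := by field_simp
    linarith
  refine (Real.rpow_le_rpow (by positivity) h1 (by linarith)).trans (le_of_eq ?_)
  rw [Real.mul_rpow (by linarith) (Real.exp_pos _).le, ← Real.exp_mul]
  congr 2
  field_simp

/-- The factor $s^b$ matters: a wide Gaussian (small `s`) satisfies the polynomial decay condition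
with any prescribed constant. -/
theorem exp_neg_sq_le {b s t : ℝ} (hb : 1 / 2 ≤ b) (hs : 0 < s) (ht : t ≠ 0) :
    Real.exp (-(t / s) ^ 2 / 2) ≤ s ^ b * (2 * b) ^ b * |t| ^ (-b) := by
  have ht' : 0 < |t| := abs_pos.2 ht
  have h1 : (|t| / s) ^ b ≤ (2 * b) ^ b * Real.exp ((t / s) ^ 2 / 2) := by
    refine le_trans (Real.rpow_le_rpow (by positivity) ?_ (by linarith)) (one_add_sq_rpow_le hb (t / s))
    rw [← sq_abs (t / s), abs_div, abs_of_pos hs]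
    nlinarith [sq_nonneg (|t| / s - 1), sq_nonneg (|t| / s)]
  rw [Real.div_rpow ht'.le hs.le, div_le_iff₀ (by positivity)] at h1
  rw [Real.rpow_neg ht'.le, ← div_eq_mul_inv, le_div_iff₀ (by positivity)]
  calc Real.exp (-(t / s) ^ 2 / 2) * |t| ^ b
      ≤ Real.exp (-(t / s) ^ 2 / 2) * ((2 * b) ^ b * Real.exp ((t / s) ^ 2 / 2) * s ^ b) :=
        mul_le_mul_of_nonneg_left h1 (Real.exp_pos _).le
    _ = (Real.exp (-(t / s) ^ 2 / 2) * Real.exp ((t / s) ^ 2 / 2)) * (s ^ b * (2 * b) ^ b) := by ring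
    _ = _ := by
      rw [← Real.exp_add, neg_div, neg_add_cancel, Real.exp_zero, one_mul]

/-- The smoothness integrand of a Gaussian density. -/
noncomputable def gaussSmoothness (β s t : ℝ) : ℝ :=
  (1 + |t| / s ^ 2) * Real.exp (-(t / s) ^ 2) * (1 + t ^ 2) ^ β

theorem integrable_abs_mul_exp {b : ℝ} (hb : 0 < b) :
    Integrable fun x : ℝ => (1 + |x|) * Real.exp (-b * x ^ 2) := by
  have h1 := (integrable_exp_neg_mul_sq hb).add (integrable_mul_exp_neg_mul_sq hb).norm
  refine h1.congr (Eventually.of_forall fun x => ?_)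
  simp only [Pi.add_apply, norm_mul, Real.norm_eq_abs, Real.abs_exp]
  ring

theorem integral_abs_mul_exp : ∫ x : ℝ, |x| * Real.exp (-x ^ 2) = 1 := by
  have h1 := integral_comp_abs (f := fun x : ℝ => x * Real.exp (-x ^ 2))
  simp only [sq_abs] at h1
  rw [h1]
  have h2 := integral_mul_cexp_neg_mul_sq (b := 1) (by simp)
  have h3 : ((∫ x in Set.Ioi (0 : ℝ), x * Real.exp (-x ^ 2) : ℝ) : ℂ) = (2 * 1)⁻¹ := by
    rw [← h2, ← integral_complex_ofReal]
    refine integral_congr_ae (Eventually.of_forall fun x => ?_)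
    push_cast
    simp
  have h4 : (∫ x in Set.Ioi (0 : ℝ), x * Real.exp (-x ^ 2)) = 1 / 2 := by
    have : ((∫ x in Set.Ioi (0 : ℝ), x * Real.exp (-x ^ 2) : ℝ) : ℂ) = ((1 / 2 : ℝ) : ℂ) := by
      rw [h3]; norm_num
    exact_mod_cast this
  rw [h4]
  norm_num

/-- As the variance grows, the smoothness functional of the Gaussian densities tends to one. -/
theorem exists_gaussSmoothness_lt {β : ℝ} (hβ : 1 / 2 ≤ β) {C : ℝ} (hC : 1 < C) :
    ∃ s > 0, Integrable (gaussSmoothness β s) ∧ ∫ t, gaussSmoothness β s t < C := by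
  -- The integrand after $t=su$. It extends continuously to $s=0$, where it is $|u|e^{-u^2}$ with
  -- integral 1, so dominated convergence applies.
  set F : ℝ → ℝ → ℝ := fun s u => (s + |u|) * Real.exp (-u ^ 2) * (1 + s ^ 2 * u ^ 2) ^ β with hF
  have hFcont : ∀ s, Continuous (F s) := by
    intro s
    simp only [hF]
    refine Continuous.mul (by fun_prop) (Continuous.rpow_const (by fun_prop) fun u => Or.inr (by linarith))
  have hβ0 : 0 ≤ β := by linarith
  have hbd : ∀ s, 0 ≤ s → s ≤ 1 → ∀ u, ‖F s u‖ ≤ (2 * β) ^ β * ((1 + |u|) * Real.exp (-(1 / 2) * u ^ 2)) := by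
    intro s hs hs1 u
    have hs2 : s ^ 2 ≤ 1 := pow_le_one₀ hs hs1
    rw [Real.norm_of_nonneg (by simp only [hF]; positivity)]
    calc F s u ≤ (1 + |u|) * Real.exp (-u ^ 2) * ((2 * β) ^ β * Real.exp (u ^ 2 / 2)) := by
          refine mul_le_mul ?_ ?_ (by positivity) (by positivity)
          · gcongr
          · refine le_trans (Real.rpow_le_rpow (by positivity) ?_ hβ0) (one_add_sq_rpow_le hβ u)
            nlinarith [sq_nonneg u]
      _ = (2 * β) ^ β * ((1 + |u|) * (Real.exp (-u ^ 2) * Real.exp (u ^ 2 / 2))) := by ring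
      _ = _ := by rw [← Real.exp_add]; congr 4; ring
  have hdom : Integrable fun u : ℝ => (2 * β) ^ β * ((1 + |u|) * Real.exp (-(1 / 2) * u ^ 2)) :=
    (integrable_abs_mul_exp (by norm_num)).const_mul _
  have hlim : Tendsto (fun m : ℕ => ∫ u, F (1 / ((m : ℝ) + 1)) u) atTop (𝓝 (∫ u, F 0 u)) := by
    refine tendsto_integral_of_dominated_convergence _
      (fun m => (hFcont _).aestronglyMeasurable) hdom
      (fun m => Eventually.of_forall (hbd _ (by positivity) ?_)) (Eventually.of_forall fun u => ?_)
    · rw [div_le_one (by positivity)]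
      linarith [(Nat.cast_nonneg m : (0 : ℝ) ≤ m)]
    · have hc : Continuous fun s => F s u := by
        simp only [hF]
        refine Continuous.mul (by fun_prop) (Continuous.rpow_const (by fun_prop) fun u => Or.inr hβ0)
      exact (hc.tendsto 0).comp tendsto_one_div_add_atTop_nhds_zero_nat
  have h0 : ∫ u, F 0 u = 1 := by
    rw [← integral_abs_mul_exp]
    refine integral_congr_ae (Eventually.of_forall fun u => ?_)
    simp [hF]
  rw [h0] at hlim
  obtain ⟨m, hm⟩ := (hlim.eventually (gt_mem_nhds hC)).exists
  set s : ℝ := 1 / ((m : ℝ) + 1) with hs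
  have hs0 : 0 < s := by positivity
  have hs1 : s ≤ 1 := by
    rw [hs, div_le_one (by positivity)]
    linarith [(Nat.cast_nonneg m : (0 : ℝ) ≤ m)]
  have hscale : ∀ t, gaussSmoothness β s t = F s (t / s) / s := by
    intro t
    simp only [gaussSmoothness, hF]
    rw [show s ^ 2 * (t / s) ^ 2 = t ^ 2 by field_simp, abs_div, abs_of_pos hs0]
    field_simp
  have hFint : Integrable (F s) :=
    hdom.mono' (hFcont s).aestronglyMeasurable (Eventually.of_forall (hbd s hs0.le hs1))
  refine ⟨s, hs0, ?_, ?_⟩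
  · refine ((hFint.comp_div hs0.ne').div_const s).congr (Eventually.of_forall fun t => ?_)
    exact (hscale t).symm
  · simp_rw [hscale]
    rw [integral_div, Measure.integral_comp_div, abs_of_pos hs0, smul_eq_mul,
      mul_div_cancel_left₀ _ hs0.ne']
    exact hm

end

/-! ### Transforms of the hypercube densities, and membership in $\mathcal F^2$. -/

section

/-- The Fourier transform of the compactly supported part of the members of the family. -/
noncomputable def perturbation {N : ℕ} (K : ℝ → ℂ) (α h : ℝ) (J : ℕ) (a : ℝ) (lam : Fin N → ℝ)
    (θ : Fin N → Bool) (t : ℝ) : ℂ :=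
  α * ∑ i ∈ Finset.range (J + 1), geomWeight J i * K (t / (h / 2 ^ i)) +
    ∑ j, if θ j then a * ((K ((t - lam j) / h) + K ((t + lam j) / h)) / 2) else 0

variable {p : ℝ → ℝ} {K : ℝ → ℂ} {N : ℕ} {γ : ℝ → ℝ} {α h a : ℝ} {J : ℕ} {lam : Fin N → ℝ}
  {θ : Fin N → Bool}

theorem ft_mix (hp : IsBandlimitedDensity p K) (hh : 0 < h) (t : ℝ) :
    ft (mix p h J) t = ∑ i ∈ Finset.range (J + 1), geomWeight J i * K (t / (h / 2 ^ i)) := by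
  have hd : ∀ i : ℕ, IsProbDensity (dilate p (h / 2 ^ i)) := fun i =>
    isProbDensity_dilate hp.density (by positivity)
  have h1 := ft_sum (Finset.range (J + 1))
    (f := fun i x => geomWeight J i * dilate p (h / 2 ^ i) x)
    (fun i _ => (hd i).integrable.const_mul _) t
  refine h1.trans (Finset.sum_congr rfl fun i _ => ?_)
  rw [ft_const_mul, ft_dilate p (by positivity), hp.ft_eq]

theorem ft_family (hp : IsBandlimitedDensity p K) (hγ : IsProbDensity γ) (hh : 0 < h) (t : ℝ) :
    ft (family γ p α h J a lam θ) t = (1 - α : ℝ) * ft γ t + perturbation K α h J a lam θ t := by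
  have hb : ∀ j, Integrable (bump p h (lam j)) := fun j => integrable_bump hp.density hh _
  have hbm : ∀ j, Integrable fun x => if θ j then a * bump p h (lam j) x else 0 := by
    intro j
    split_ifs
    exacts [(hb j).const_mul a, integrable_zero _ _ _]
  have i1 : Integrable fun x => (1 - α) * γ x := hγ.integrable.const_mul _
  have i2 : Integrable fun x => α * mix p h J x :=
    (isProbDensity_mix hp.density hh J).integrable.const_mul _
  have i3 : Integrable fun x => ∑ j, if θ j then a * bump p h (lam j) x else 0 :=
    integrable_finsetSum _ fun j _ => hbm j
  have i4 : Integrable fun x => (1 - α) * γ x + α * mix p h J x := i1.add i2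
  have e1 := ft_add i4 i3 t
  have e2 := ft_sum Finset.univ (fun j _ => hbm j) t
  have e3 : ∀ j, ft (fun x => if θ j then a * bump p h (lam j) x else 0) t =
      if θ j then a * ((K ((t - lam j) / h) + K ((t + lam j) / h)) / 2) else 0 := by
    intro j
    split_ifs
    · rw [ft_const_mul, hp.ft_bump hh]
    · simp [ft]
  simp_rw [e3] at e2
  rw [ft_add i1 i2, ft_const_mul, ft_const_mul, ft_mix hp hh, e2] at e1
  refine e1.trans ?_
  rw [perturbation, add_assoc]

theorem norm_mix_part_le (hp : IsBandlimitedDensity p K) (hα : 0 ≤ α) (t : ℝ) :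
    ‖(α : ℂ) * ∑ i ∈ Finset.range (J + 1), geomWeight J i * K (t / (h / 2 ^ i))‖ ≤ α := by
  rw [norm_mul, Complex.norm_real, Real.norm_of_nonneg hα]
  refine mul_le_of_le_one_right hα ((norm_sum_le _ _).trans ?_)
  rw [← sum_geomWeight J]
  refine Finset.sum_le_sum fun i _ => ?_
  rw [norm_mul, Complex.norm_real, Real.norm_of_nonneg (geomWeight_nonneg J i)]
  exact mul_le_of_le_one_right (geomWeight_nonneg J i) (hp.norm_le_one _)

theorem mix_part_eq_zero (hp : IsBandlimitedDensity p K) (hh : 0 < h) {t : ℝ} (ht : h ≤ |t|) :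
    (α : ℂ) * ∑ i ∈ Finset.range (J + 1), geomWeight J i * K (t / (h / 2 ^ i)) = 0 := by
  rw [Finset.sum_eq_zero, mul_zero]
  intro i _
  rw [hp.eq_zero, mul_zero]
  rw [abs_div, abs_of_pos (by positivity : 0 < h / 2 ^ i), one_le_div (by positivity)]
  exact (div_le_self hh.le (one_le_pow₀ (by norm_num))).trans ht

theorem bump_part_eq_zero (hp : IsBandlimitedDensity p K) (hh : 0 < h) {t l : ℝ}
    (ht : h ≤ |(|t| - |l|)|) : K ((t - l) / h) = 0 ∧ K ((t + l) / h) = 0 := by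
  constructor <;> refine hp.eq_zero _ ?_ <;> rw [abs_div, abs_of_pos hh, one_le_div hh]
  · exact ht.trans (abs_abs_sub_abs_le t l)
  · have := abs_abs_sub_abs_le t (-l)
    rw [abs_neg, sub_neg_eq_add] at this
    exact ht.trans this

section OneBump

variable {l : ℝ} {θ : Fin 1 → Bool}

theorem norm_perturbation_one_le (hp : IsBandlimitedDensity p K) (hα : 0 ≤ α) (ha : 0 ≤ a) (t : ℝ) :
    ‖perturbation K α h J a (fun _ => l) θ t‖ ≤ α + a := by
  refine (norm_add_le _ _).trans (add_le_add (norm_mix_part_le hp hα t) ?_)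
  simp only [Finset.univ_unique, Finset.sum_singleton]
  split_ifs
  · rw [norm_mul, Complex.norm_real, Real.norm_of_nonneg ha, norm_div]
    refine mul_le_of_le_one_right ha ?_
    have := (norm_add_le (K ((t - l) / h)) (K ((t + l) / h))).trans
      (add_le_add (hp.norm_le_one _) (hp.norm_le_one _))
    rw [Complex.norm_ofNat, div_le_one (by norm_num)]
    linarith
  · simpa using ha

theorem perturbation_one_eq_zero (hp : IsBandlimitedDensity p K) (hh : 0 < h) (hl : 0 ≤ l) {t : ℝ}
    (ht : l + h ≤ |t|) : perturbation K α h J a (fun _ => l) θ t = 0 := by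
  have h1 := bump_part_eq_zero hp hh (t := t) (l := l) (by
    rw [abs_of_nonneg hl, abs_of_nonneg (by linarith)]
    linarith)
  rw [perturbation, mix_part_eq_zero hp hh (by linarith)]
  simp [h1.1, h1.2]

/-- The derivative of `perturbation`, for one bump. -/
noncomputable def perturbationDeriv (K : ℝ → ℂ) (α h : ℝ) (J : ℕ) (a l : ℝ) (b : Bool) (t : ℝ) : ℂ :=
  α * ∑ i ∈ Finset.range (J + 1), geomWeight J i * ((1 / (h / 2 ^ i)) • deriv K (t / (h / 2 ^ i))) +
    if b then a * (((1 / h) • deriv K ((t - l) / h) + (1 / h) • deriv K ((t + l) / h)) / 2) else 0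

theorem hasDerivAt_perturbation_one (hp : IsBandlimitedDensity p K) (t : ℝ) :
    HasDerivAt (perturbation K α h J a (fun _ => l) θ) (perturbationDeriv K α h J a l (θ 0) t) t := by
  have hK : ∀ s c : ℝ, HasDerivAt (fun t => K ((t + c) / s)) ((1 / s) • deriv K ((t + c) / s)) t := by
    intro s c
    have h1 : HasDerivAt (fun t => (t + c) / s) (1 / s) t := ((hasDerivAt_id t).add_const c).div_const s
    exact (hp.differentiable _).hasDerivAt.scomp t h1
  have hK0 : ∀ s : ℝ, HasDerivAt (fun t => K (t / s)) ((1 / s) • deriv K (t / s)) t := by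
    intro s
    simpa using hK s 0
  have hKs : HasDerivAt (fun t => K ((t - l) / h)) ((1 / h) • deriv K ((t - l) / h)) t := by
    simpa [sub_eq_add_neg] using hK h (-l)
  unfold perturbation perturbationDeriv
  simp only [Finset.univ_unique, Finset.sum_singleton, Fin.default_eq_zero]
  refine HasDerivAt.add (HasDerivAt.const_mul _ (HasDerivAt.fun_sum fun i _ =>
    HasDerivAt.const_mul _ (hK0 _))) ?_
  split_ifs
  · exact ((hKs.add (hK h l)).div_const 2).const_mul _
  · exact hasDerivAt_const t 0

/-- The $L^1$ norm of a derivative is invariant under dilation. Hence bounds uniform in $h$ and $J$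
are possible, although the scaling factors $2^i/h$ are unbounded. -/
theorem integral_norm_scaled_deriv (hp : IsBandlimitedDensity p K) {s : ℝ} (hs : 0 < s) (c : ℝ) :
    Integrable (fun t => ‖(1 / s) • deriv K ((t + c) / s)‖) ∧
      ∫ t, ‖(1 / s) • deriv K ((t + c) / s)‖ = ∫ t, ‖deriv K t‖ := by
  have hi : Integrable fun t => ‖deriv K t‖ :=
    (hp.continuous_deriv.integrable_of_hasCompactSupport hp.hasCompactSupport.deriv).norm
  simp only [norm_smul, Real.norm_of_nonneg (by positivity : 0 ≤ 1 / s)]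
  refine ⟨((hi.comp_div hs.ne').comp_add_right c).const_mul _, ?_⟩
  rw [integral_const_mul, integral_add_right_eq_self (fun t => ‖deriv K (t / s)‖) c,
    Measure.integral_comp_div (fun t => ‖deriv K t‖), abs_of_pos hs, smul_eq_mul]
  field_simp

theorem lintegral_norm_perturbationDeriv_le (hp : IsBandlimitedDensity p K) (hh : 0 < h)
    (hα : 0 ≤ α) (ha : 0 ≤ a) (b : Bool) :
    ∫⁻ t, ENNReal.ofReal ‖perturbationDeriv K α h J a l b t‖ ≤
      ENNReal.ofReal ((α + a) * ∫ t, ‖deriv K t‖) := by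
  set Y : ℝ → ℝ := fun t => α * ∑ i ∈ Finset.range (J + 1),
    geomWeight J i * ‖(1 / (h / 2 ^ i)) • deriv K ((t + 0) / (h / 2 ^ i))‖ +
    a * ((‖(1 / h) • deriv K ((t + -l) / h)‖ + ‖(1 / h) • deriv K ((t + l) / h)‖) / 2) with hY
  have hYle : ∀ t, ‖perturbationDeriv K α h J a l b t‖ ≤ Y t := by
    intro t
    refine (norm_add_le _ _).trans (add_le_add ?_ ?_)
    · rw [norm_mul, Complex.norm_real, Real.norm_of_nonneg hα]
      refine mul_le_mul_of_nonneg_left ((norm_sum_le _ _).trans (Finset.sum_le_sum fun i _ => ?_)) hα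
      rw [norm_mul, Complex.norm_real, Real.norm_of_nonneg (geomWeight_nonneg J i), add_zero]
    · split_ifs
      · rw [norm_mul, Complex.norm_real, Real.norm_of_nonneg ha, norm_div, Complex.norm_ofNat,
          ← sub_eq_add_neg]
        gcongr
        exact norm_add_le _ _
      · rw [norm_zero]; positivity
  have hI : ∀ {s : ℝ}, 0 < s → ∀ c, _ := fun {s} hs c => integral_norm_scaled_deriv (s := s) hp hs c
  have hs : ∀ i : ℕ, 0 < h / 2 ^ i := fun i => by positivity
  have i1 : Integrable fun t => ∑ i ∈ Finset.range (J + 1),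
      geomWeight J i * ‖(1 / (h / 2 ^ i)) • deriv K ((t + 0) / (h / 2 ^ i))‖ :=
    integrable_finsetSum _ fun i _ => (hI (hs i) 0).1.const_mul _
  have i2 : Integrable fun t => ‖(1 / h) • deriv K ((t + -l) / h)‖ + ‖(1 / h) • deriv K ((t + l) / h)‖ :=
    (hI hh (-l)).1.add (hI hh l).1
  have hYint : Integrable Y := (i1.const_mul α).add ((i2.div_const 2).const_mul a)
  have hYval : ∫ t, Y t = (α + a) * ∫ t, ‖deriv K t‖ := by
    simp only [hY]
    rw [integral_add (i1.const_mul α) ((i2.div_const 2).const_mul a), integral_const_mul,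
      integral_const_mul, integral_div, integral_add (hI hh (-l)).1 (hI hh l).1, (hI hh (-l)).2,
      (hI hh l).2, integral_finsetSum _ fun i _ => (hI (hs i) 0).1.const_mul _]
    have : ∀ i ∈ Finset.range (J + 1), ∫ t, geomWeight J i *
        ‖(1 / (h / 2 ^ i)) • deriv K ((t + 0) / (h / 2 ^ i))‖ =
        geomWeight J i * ∫ t, ‖deriv K t‖ := fun i _ => by
      rw [integral_const_mul, (hI (hs i) 0).2]
    rw [Finset.sum_congr rfl this, ← Finset.sum_mul, sum_geomWeight]
    ring
  rw [← hYval, ofReal_integral_eq_lintegral_ofReal hYint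
    (Eventually.of_forall fun t => (norm_nonneg _).trans (hYle t))]
  exact lintegral_mono fun t => ENNReal.ofReal_le_ofReal (hYle t)

/-- `G`, `G'` bound the Gaussian transform and its derivative, `x`, `x'` those of the perturbation.
What the perturbation adds is split into a constant, integrated over $|t|<\tau$, and a multiple of
`x'`, which is controlled only in $L^1$. -/
theorem smoothness_add_le {β τ E G G' x x' t : ℝ} (hβ : 0 ≤ β) (hG : 0 ≤ G) (hG1 : G ≤ 1)
    (hG'0 : 0 ≤ G') (hx0 : 0 ≤ x) (hx'0 : 0 ≤ x') (hx : x ≤ E) (hE1 : E ≤ 2) (hτ : |t| < τ) {v : ℝ}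
    (hG' : G' ≤ v) :
    ((G + x) ^ 2 + (G + x) * (G' + x')) * (1 + t ^ 2) ^ β ≤
      (G ^ 2 + G * G') * (1 + t ^ 2) ^ β +
        (1 + τ ^ 2) ^ β * (E * (4 + v)) + (1 + τ ^ 2) ^ β * (3 * x') := by
  have hw : (1 + t ^ 2) ^ β ≤ (1 + τ ^ 2) ^ β := by
    refine Real.rpow_le_rpow (by positivity) ?_ hβ
    have := sq_le_sq' (by linarith [neg_abs_le t] : -τ ≤ t) (by linarith [le_abs_self t])
    linarith
  have hw0 : 0 ≤ (1 + t ^ 2) ^ β := by positivity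
  have h1 : 2 * G * x + x ^ 2 + x * G' + (G + x) * x' ≤ E * (4 + v) + 3 * x' := by
    have e1 : G * x ≤ x := mul_le_of_le_one_left hx0 hG1
    have e2 : x * x ≤ 2 * x := mul_le_mul_of_nonneg_right (hx.trans hE1) hx0
    have e3 : x * G' ≤ E * v := mul_le_mul hx hG' hG'0 (hx0.trans hx)
    have e4 : (G + x) * x' ≤ 3 * x' := mul_le_mul_of_nonneg_right (by linarith) hx'0
    nlinarith
  have h2 : (2 * G * x + x ^ 2 + x * G' + (G + x) * x') * (1 + t ^ 2) ^ β ≤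
      (E * (4 + v) + 3 * x') * (1 + τ ^ 2) ^ β :=
    mul_le_mul h1 hw hw0 (le_trans (by positivity) h1)
  nlinarith

/-- The perturbation has transform zero for $|t|\ge l+1$, where the weight would be unbounded.
Inside, it costs $O(\alpha)$ uniformly in $h\le1$ and $J$, so a small $\alpha$ keeps the functional
near that of the Gaussian. -/
theorem lintegral_smoothness_family_le (hp : IsBandlimitedDensity p K) {β s : ℝ} (hβ : 0 ≤ β)
    (hs : 0 < s) (hsint : Integrable (gaussSmoothness β s)) (hh : 0 < h) (hh1 : h ≤ 1) (hl : 0 ≤ l)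
    (hα : 0 ≤ α) (hα1 : α ≤ 1) (ha : 0 ≤ a) (haα : a ≤ α) :
    ∫⁻ t, ENNReal.ofReal (smoothness β (ft (family (gauss s) p α h J a (fun _ => l) θ)) t) ≤
      ENNReal.ofReal ((∫ t, gaussSmoothness β s t) + α * ((1 + (l + 1) ^ 2) ^ β *
        (4 * (l + 1) * (4 + (l + 1) / s ^ 2) + 6 * ∫ t, ‖deriv K t‖))) := by
  set X := perturbation K α h J a (fun _ => l) θ with hX
  set X' := perturbationDeriv K α h J a l (θ 0) with hX'
  set τ := l + 1 with hτ
  set W := (1 + τ ^ 2) ^ β with hW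
  have hτ0 : 0 < τ := by linarith
  have hW0 : 0 ≤ W := by positivity
  have hk0 : 0 ≤ ∫ t, ‖deriv K t‖ := integral_nonneg fun t => norm_nonneg _
  have hft : ft (family (gauss s) p α h J a (fun _ => l) θ) =
      fun t => ((1 - α : ℝ) : ℂ) * (Real.exp (-(t / s) ^ 2 / 2) : ℂ) + X t := by
    ext1 t
    rw [ft_family hp (isProbDensity_gauss hs) hh, ft_gauss hs]
  set G : ℝ → ℝ := fun t => Real.exp (-(t / s) ^ 2 / 2) with hG
  have hGd : ∀ t, HasDerivAt G (G t * (-(t / s ^ 2))) t := by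
    intro t
    have h1 : HasDerivAt (fun t => -(t / s) ^ 2 / 2) (-(t / s ^ 2)) t := by
      have h2 := ((((hasDerivAt_id t).div_const s).pow 2).neg).div_const 2
      refine h2.congr_deriv ?_
      simp only [id]
      norm_num
      field_simp
    exact h1.exp
  have hGsq : ∀ t, (G t ^ 2 + G t * (|t| / s ^ 2 * G t)) * (1 + t ^ 2) ^ β = gaussSmoothness β s t := by
    intro t
    have : G t ^ 2 = Real.exp (-(t / s) ^ 2) := by
      rw [hG, ← Real.exp_nat_mul]
      congr 1
      push_cast
      ring
    rw [gaussSmoothness, ← this]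
    ring
  have hXd : ∀ t, HasDerivAt X (X' t) t := hasDerivAt_perturbation_one hp
  have hGc : ∀ t, HasDerivAt (fun t => ((1 - α : ℝ) : ℂ) * (G t : ℂ))
      (((1 - α : ℝ) : ℂ) * ((G t * (-(t / s ^ 2)) : ℝ) : ℂ)) t := fun t =>
    (hGd t).ofReal_comp.const_mul _
  have hderiv : ∀ t, deriv (fun t => ((1 - α : ℝ) : ℂ) * (G t : ℂ) + X t) t =
      ((1 - α : ℝ) : ℂ) * ((G t * (-(t / s ^ 2)) : ℝ) : ℂ) + X' t := fun t =>
    ((hGc t).add (hXd t)).deriv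
  have hzero : ∀ t, τ ≤ |t| → X t = 0 := fun t ht =>
    perturbation_one_eq_zero hp hh hl (by linarith)
  have hzero' : ∀ t, τ < |t| → X' t = 0 := by
    intro t ht
    have h1 : X =ᶠ[𝓝 t] fun _ => 0 := by
      filter_upwards [(isOpen_lt continuous_const continuous_abs).mem_nhds ht] with u hu
      exact hzero u (le_of_lt hu)
    exact (hXd t).unique ((hasDerivAt_const t (0 : ℂ)).congr_of_eventuallyEq h1)
  have hGpos : ∀ t, 0 < G t := fun t => Real.exp_pos _
  have hG1 : ∀ t, G t ≤ 1 := fun t => Real.exp_le_one_iff.2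
    (div_nonpos_of_nonpos_of_nonneg (neg_nonpos.2 (sq_nonneg _)) (by norm_num))
  have hXle : ∀ t, ‖X t‖ ≤ 2 * α := fun t => by
    have := norm_perturbation_one_le (h := h) (J := J) (l := l) (θ := θ) hp hα ha t
    linarith
  have n1 : ∀ t, ‖((1 - α : ℝ) : ℂ) * (G t : ℂ) + X t‖ ≤ G t + ‖X t‖ := by
    intro t
    refine (norm_add_le _ _).trans (add_le_add_left ?_ _)
    rw [norm_mul, Complex.norm_real, Complex.norm_real, Real.norm_of_nonneg (by linarith),
      Real.norm_of_nonneg (hGpos t).le]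
    exact mul_le_of_le_one_left (hGpos t).le (by linarith)
  have n2 : ∀ t, ‖((1 - α : ℝ) : ℂ) * ((G t * (-(t / s ^ 2)) : ℝ) : ℂ) + X' t‖ ≤
      |t| / s ^ 2 * G t + ‖X' t‖ := by
    intro t
    refine (norm_add_le _ _).trans (add_le_add_left ?_ _)
    rw [norm_mul, Complex.norm_real, Complex.norm_real, Real.norm_of_nonneg (by linarith),
      Real.norm_eq_abs, abs_mul, abs_neg, abs_div, abs_of_pos (hGpos t), abs_of_nonneg (sq_nonneg s),
      mul_comm (G t)]
    have := (hGpos t).le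
    exact mul_le_of_le_one_left (by positivity) (by linarith)
  have hpt : ∀ t, |t| ≠ τ → ENNReal.ofReal (smoothness β (fun t => ((1 - α : ℝ) : ℂ) * (G t : ℂ) + X t) t) ≤
      ENNReal.ofReal (gaussSmoothness β s t) + (Set.Ioo (-τ) τ).indicator (fun _ => ENNReal.ofReal
        (W * (2 * α * (4 + τ / s ^ 2)))) t + ENNReal.ofReal (3 * W) * ENNReal.ofReal ‖X' t‖ := by
    intro t ht
    have hle : smoothness β (fun t => ((1 - α : ℝ) : ℂ) * (G t : ℂ) + X t) t ≤
        ((G t + ‖X t‖) ^ 2 + (G t + ‖X t‖) * (|t| / s ^ 2 * G t + ‖X' t‖)) * (1 + t ^ 2) ^ β := by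
      rw [smoothness, hderiv]
      have := n1 t
      have := n2 t
      have := (hGpos t).le
      gcongr
    refine (ENNReal.ofReal_le_ofReal hle).trans ?_
    have hg0 : 0 ≤ gaussSmoothness β s t := by unfold gaussSmoothness; positivity
    have h0 : 0 ≤ |t| / s ^ 2 * G t := by have := (hGpos t).le; positivity
    rcases lt_or_gt_of_ne ht with hlt | hgt
    · rw [Set.indicator_of_mem (show t ∈ Set.Ioo (-τ) τ from abs_lt.1 hlt), ← ENNReal.ofReal_add hg0
        (by positivity), ← ENNReal.ofReal_mul (by positivity),
        ← ENNReal.ofReal_add (by positivity) (by positivity)]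
      refine ENNReal.ofReal_le_ofReal ?_
      have hvb : |t| / s ^ 2 * G t ≤ τ / s ^ 2 := by
        refine (mul_le_of_le_one_right (by positivity) (hG1 t)).trans ?_
        gcongr
      refine (smoothness_add_le hβ (hGpos t).le (hG1 t) h0 (norm_nonneg _) (norm_nonneg _) (hXle t)
        (by linarith) hlt hvb).trans (le_of_eq ?_)
      rw [hGsq]
      ring
    · rw [hzero t (le_of_lt hgt), hzero' t hgt]
      simp only [norm_zero, add_zero, hGsq, ENNReal.ofReal_zero, mul_zero]
      exact le_self_add
  have hX'm : Measurable X' := by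
    have : X' = deriv X := by ext1 t; exact (hXd t).deriv.symm
    rw [this]
    exact measurable_deriv _
  have hgm : Measurable (gaussSmoothness β s) := by
    unfold gaussSmoothness
    fun_prop
  -- The derivative is seen to vanish only where the transform is locally zero, that is for
  -- $|t|>\tau$; the two boundary points form a null set.
  have hae : ∀ᵐ t : ℝ, |t| ≠ τ := by
    have : ({τ, -τ} : Set ℝ).Countable := (Set.toFinite _).countable
    filter_upwards [this.ae_notMem volume] with t ht habs
    rcases (abs_eq hτ0.le).1 habs with h1 | h1 <;> simp [h1] at ht
  rw [hft]
  refine (lintegral_mono_ae (hae.mono hpt)).trans ?_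
  rw [lintegral_add_right _ (by fun_prop), lintegral_add_left (by fun_prop),
    lintegral_const_mul _ (by fun_prop), lintegral_indicator measurableSet_Ioo, setLIntegral_const,
    Real.volume_Ioo, ← ofReal_integral_eq_lintegral_ofReal hsint (Eventually.of_forall fun t => by
      unfold gaussSmoothness; positivity)]
  have hd := lintegral_norm_perturbationDeriv_le (J := J) (l := l) hp hh hα ha (θ 0)
  calc _ ≤ ENNReal.ofReal (∫ t, gaussSmoothness β s t) +
        ENNReal.ofReal (W * (2 * α * (4 + τ / s ^ 2))) * ENNReal.ofReal (τ - -τ) +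
        ENNReal.ofReal (3 * W) * ENNReal.ofReal ((2 * α) * ∫ t, ‖deriv K t‖) := by
        gcongr
        refine hd.trans (ENNReal.ofReal_le_ofReal ?_)
        gcongr
        linarith
    _ = _ := by
        have h0 : 0 ≤ ∫ t, gaussSmoothness β s t := integral_nonneg fun t => by
          unfold gaussSmoothness; positivity
        rw [← ENNReal.ofReal_mul (by positivity), ← ENNReal.ofReal_mul (by positivity),
          ← ENNReal.ofReal_add h0 (mul_nonneg (by positivity) (by linarith)),
          ← ENNReal.ofReal_add (add_nonneg h0 (mul_nonneg (by positivity) (by linarith)))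
            (by positivity)]
        congr 1
        ring

theorem differentiable_ft_family_one (hp : IsBandlimitedDensity p K) {s : ℝ} (hs : 0 < s)
    (hh : 0 < h) : Differentiable ℝ (ft (family (gauss s) p α h J a (fun _ => l) θ)) := by
  have hft : ft (family (gauss s) p α h J a (fun _ => l) θ) = fun t => ((1 - α : ℝ) : ℂ) *
      (Real.exp (-(t / s) ^ 2 / 2) : ℂ) + perturbation K α h J a (fun _ => l) θ t := by
    ext1 t
    rw [ft_family hp (isProbDensity_gauss hs) hh, ft_gauss hs]
  rw [hft]
  refine Differentiable.add (Differentiable.const_mul ?_ _)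
    fun t => (hasDerivAt_perturbation_one hp t).differentiableAt
  exact Complex.ofRealCLM.differentiable.comp (by fun_prop)

end OneBump

end

/-! ### The rate $n^{-1/(2\mu)}$, and bounds for many separated bumps. -/

section

theorem limsup_pos_of_eventually {F : Set (ℝ → ℝ)} {g : ℝ → ℝ} {est : Estimator} {r κ : ℝ} (hκ : 0 < κ)
    (h : ∀ᶠ n : ℕ in atTop, ∀ S : ℝ≥0∞, (∀ f ∈ F, mise est f g n ≤ S) →
      ENNReal.ofReal (κ * (n : ℝ) ^ (-r)) ≤ S) :
    0 < limsup (fun n : ℕ => ⨆ f ∈ F, (n : ℝ≥0∞) ^ r * mise est f g n) atTop := by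
  refine lt_of_lt_of_le (ENNReal.ofReal_pos.2 hκ) (le_limsup_of_frequently_le' ?_)
  refine Eventually.frequently ?_
  filter_upwards [h, eventually_gt_atTop 0] with n hn hn0
  have hn0' : (0 : ℝ) < n := by exact_mod_cast hn0
  have h1 := hn (⨆ f ∈ F, mise est f g n) fun f hf => le_iSup₂ (f := fun f _ => mise est f g n) f hf
  simp_rw [← ENNReal.mul_iSup]
  calc ENNReal.ofReal κ = (n : ℝ≥0∞) ^ r * ENNReal.ofReal (κ * (n : ℝ) ^ (-r)) := by
        rw [← ENNReal.ofReal_natCast, ENNReal.ofReal_rpow_of_pos hn0', ← ENNReal.ofReal_mul (by positivity),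
          Real.rpow_neg hn0'.le]
        congr 1
        field_simp
    _ ≤ _ := by gcongr

theorem eventually_le_of_limsup_ofReal_lt_top {F : ℝ → ℝ} {l : Filter ℝ}
    (h : limsup (fun t => ENNReal.ofReal (F t)) l < ∞) : ∃ c : ℝ, 0 < c ∧ ∀ᶠ t in l, F t ≤ c := by
  obtain ⟨b, hb1, hb2⟩ := exists_between h
  have h1 := eventually_lt_of_limsup_lt hb1
  refine ⟨b.toReal + 1, by positivity, h1.mono fun t ht => ?_⟩
  have := (ENNReal.ofReal_le_iff_le_toReal hb2.ne).1 ht.le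
  linarith

/-- Puts the local hypothesis into the form $A=cr^\mu$, $A/r$ on windows of radius $r$. The bound at
$T$ itself, where the limit superior says nothing, follows by continuity of `ft g`. -/
theorem VanishesToOrder.exists_bound {g : ℝ → ℝ} (hg : Integrable g) {μ T : ℝ} (hμ : 1 ≤ μ)
    (h : VanishesToOrder g μ T) : ∃ c > 0, ∃ ε > 0, ∀ r : ℝ, 0 < r → r ≤ ε →
      (∀ t, |t - T| < r → ‖ft g t‖ ≤ c * r ^ μ) ∧
      ∀ t, |t - T| < r → t ≠ T → DifferentiableAt ℝ (ft g) t ∧ ‖deriv (ft g) t‖ ≤ c * r ^ μ / r := by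
  obtain ⟨hd, h1, h2⟩ := h
  obtain ⟨c₁, hc₁, b₁⟩ := eventually_le_of_limsup_ofReal_lt_top h1
  obtain ⟨c₂, hc₂, b₂⟩ := eventually_le_of_limsup_ofReal_lt_top h2
  have hall := (hd.and b₁).and b₂
  rw [eventually_nhdsWithin_iff, Metric.eventually_nhds_iff] at hall
  obtain ⟨ε, hε, hball⟩ := hall
  refine ⟨max c₁ c₂, lt_max_of_lt_left hc₁, ε, hε, fun r hr hrε => ?_⟩
  have hmain : ∀ t, |t - T| < r → t ≠ T → DifferentiableAt ℝ (ft g) t ∧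
      ‖ft g t‖ ≤ max c₁ c₂ * r ^ μ ∧ ‖deriv (ft g) t‖ ≤ max c₁ c₂ * r ^ μ / r := by
    intro t ht htT
    have hpos : 0 < |t - T| := abs_pos.2 (sub_ne_zero.2 htT)
    obtain ⟨⟨hdt, hb1⟩, hb2⟩ := hball (show dist t T < ε by rw [Real.dist_eq]; linarith) htT
    rw [div_le_iff₀ (by positivity)] at hb1 hb2
    refine ⟨hdt, hb1.trans ?_, hb2.trans ?_⟩
    · gcongr
      exact le_max_left _ _
    · rw [mul_div_assoc, ← Real.rpow_sub_one hr.ne']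
      have : |t - T| ^ (μ - 1) ≤ r ^ (μ - 1) := Real.rpow_le_rpow hpos.le ht.le (by linarith)
      gcongr
      exact le_max_right _ _
  refine ⟨fun t ht => ?_, fun t ht htT => ⟨(hmain t ht htT).1, (hmain t ht htT).2.2⟩⟩
  by_cases htT : t = T
  · rw [htT]
    have hlim : Tendsto (fun t => ‖ft g t‖) (𝓝[≠] T) (𝓝 ‖ft g T‖) :=
      ((continuous_ft hg).norm.tendsto T).mono_left nhdsWithin_le_nhds
    refine le_of_tendsto hlim ?_
    rw [eventually_nhdsWithin_iff, Metric.eventually_nhds_iff]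
    exact ⟨r, hr, fun u hu huT => (hmain u (by rwa [Real.dist_eq] at hu) huT).2.1⟩
  · exact (hmain t ht htT).2.1

variable {p : ℝ → ℝ} {K : ℝ → ℂ}

/-- One edge at frequency $T$ with constant amplitude $\alpha/4$: only the width $h$ shrinks, and
the risk is proportional to it. -/
theorem limsup_pos_of_vanishesToOrder (hp : IsBandlimitedDensity p K) {μ : ℝ} (hμ : 1 ≤ μ) {g : ℝ → ℝ}
    (hg : IsProbDensity g) {T : ℝ} (hT : 0 < T) (hvan : VanishesToOrder g μ T) {γ : ℝ → ℝ}
    (hγ : IsProbDensity γ) {Mγ : ℝ} (hMγ : ∀ x, γ x ≤ Mγ) {α : ℝ} (hα : 0 < α) (hα1 : α ≤ 1)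
    {F : Set (ℝ → ℝ)} (hF : ∀ (h : ℝ) (J : ℕ) (θ : Fin 1 → Bool), 0 < h → h ≤ 1 → h ≤ T →
      family γ p α h J (α / 4) (fun _ => T) θ ∈ F) (est : Estimator) :
    0 < limsup (fun n : ℕ => ⨆ f ∈ F, (n : ℝ≥0∞) ^ (1 / (2 * μ)) * mise est f g n) atTop := by
  obtain ⟨κ, hκ, hmain⟩ := family_lower_bound hp hg hγ hMγ hα hα1
  obtain ⟨c, hc, ε, hε, hbound⟩ := hvan.exists_bound hg.integrable hμ
  have hμ0 : 0 < μ := by linarith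
  -- Chosen so that $n(\alpha/4)^2(ch^\mu)^2=\kappa$ exactly for $h=\eta n^{-1/(2\mu)}$.
  set η : ℝ := (κ / ((α / 4) ^ 2 * c ^ 2)) ^ (1 / (2 * μ)) with hη
  have hη0 : 0 < η := by positivity
  have hlim : Tendsto (fun n : ℕ => η * (n : ℝ) ^ (-(1 / (2 * μ)))) atTop (𝓝 0) := by
    have := ((tendsto_rpow_neg_atTop (y := 1 / (2 * μ)) (by positivity)).comp
      tendsto_natCast_atTop_atTop).const_mul η
    simpa using this
  have hsmall := hlim.eventually (gt_mem_nhds (show 0 < min (min 1 T) ε by positivity))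
  refine limsup_pos_of_eventually (κ := κ * ((α / 4) ^ 2 * η)) (by positivity) ?_
  filter_upwards [hsmall, eventually_gt_atTop 0] with n hn hn0 S hS
  have hn0' : (0 : ℝ) < n := by exact_mod_cast hn0
  set h : ℝ := η * (n : ℝ) ^ (-(1 / (2 * μ))) with hh
  have hpos : 0 < h := by positivity
  have hmin := lt_min_iff.1 hn
  have hmin1 := lt_min_iff.1 hmin.1
  obtain ⟨b1, b2⟩ := hbound h hpos hmin.2.le
  have hhμ : (h ^ μ) ^ 2 = κ / ((α / 4) ^ 2 * c ^ 2) / n := by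
    rw [← Real.rpow_natCast, ← Real.rpow_mul hpos.le, hh, Real.mul_rpow hη0.le (by positivity), hη,
      ← Real.rpow_mul (by positivity), ← Real.rpow_mul hn0'.le]
    rw [show 1 / (2 * μ) * (μ * ((2 : ℕ) : ℝ)) = 1 by push_cast; field_simp,
      show -(1 / (2 * μ)) * (μ * ((2 : ℕ) : ℝ)) = -1 by push_cast; field_simp, Real.rpow_one,
      Real.rpow_neg_one, div_eq_mul_inv (κ / ((α / 4) ^ 2 * c ^ 2))]
  obtain ⟨J, hJ⟩ := hmain n 1 h (α / 4) (c * h ^ μ) (fun _ => T) hn0 one_pos hpos hmin1.1.le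
    (by positivity) (by simp) (fun _ => hmin1.2.le)
    (fun i j hij => absurd (Subsingleton.elim i j) hij) (fun _ => b1) (fun _ => b2) (by
      rw [mul_pow, hhμ]
      refine le_of_eq ?_
      field_simp)
  refine le_trans (le_of_eq ?_) (hJ est S fun θ => hS _ (hF h J θ hpos hmin1.1.le hmin1.2.le))
  congr 1
  rw [hh]
  push_cast
  ring

theorem mem_classF3_of_bounds {N : ℕ} {α h a s β C : ℝ} {J : ℕ} {lam : Fin N → ℝ}
    {θ : Fin N → Bool} (hp : IsBandlimitedDensity p K) (hs : 0 < s) (hh : 0 < h)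
    (ha : 0 ≤ a) (hα0 : 0 ≤ α) (hα1 : α ≤ 1) (hNa : N * a ≤ α / 4) (hlam : ∀ j, h ≤ lam j)
    (hG : ∀ t : ℝ, t ≠ 0 → Real.exp (-(t / s) ^ 2 / 2) ≤ C / 2 * |t| ^ (-β - 1 / 2))
    (hX : ∀ t : ℝ, t ≠ 0 → ‖perturbation K α h J a lam θ t‖ ≤ C / 2 * |t| ^ (-β - 1 / 2)) :
    family (gauss s) p α h J a lam θ ∈ classF3 β C := by
  refine ⟨isProbDensity_family hp (isProbDensity_gauss hs) hh ha hα0 hα1 hNa hlam θ, fun t ht => ?_⟩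
  rw [ft_family hp (isProbDensity_gauss hs) hh, ft_gauss hs]
  refine (norm_add_le _ _).trans ?_
  have h1 : ‖((1 - α : ℝ) : ℂ) * (Real.exp (-(t / s) ^ 2 / 2) : ℂ)‖ ≤ Real.exp (-(t / s) ^ 2 / 2) := by
    rw [norm_mul, Complex.norm_real, Complex.norm_real, Real.norm_of_nonneg (by linarith),
      Real.norm_of_nonneg (Real.exp_pos _).le]
    exact mul_le_of_le_one_left (Real.exp_pos _).le (by linarith)
  have h2 := hG t ht
  have h3 := hX t ht
  calc _ ≤ C / 2 * |t| ^ (-β - 1 / 2) + C / 2 * |t| ^ (-β - 1 / 2) := add_le_add (h1.trans h2) h3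
    _ = _ := by ring

theorem limsup_classF3_pos (hp : IsBandlimitedDensity p K) {β μ : ℝ} (hβ : 1 / 2 < β) (hμ : 1 ≤ μ)
    {g : ℝ → ℝ} (hg : IsProbDensity g) {T : ℝ} (hT : 0 < T) (hvan : VanishesToOrder g μ T) {C : ℝ}
    (hC : 0 < C) (est : Estimator) :
    0 < limsup (fun n : ℕ => ⨆ f ∈ classF3 β C, (n : ℝ≥0∞) ^ (1 / (2 * μ)) * mise est f g n) atTop := by
  set b : ℝ := β + 1 / 2 with hb
  have hbneg : -β - 1 / 2 = -b := by rw [hb]; ring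
  have hb0 : 0 < b := by linarith
  -- Solves $s^b(2b)^b=C/2$: the Gaussian uses half of the allowance, the perturbation the other
  -- half.
  set s : ℝ := (C / 2 / (2 * b) ^ b) ^ (1 / b) with hs
  have hs0 : 0 < s := by positivity
  have hsb : s ^ b * (2 * b) ^ b = C / 2 := by
    rw [hs, ← Real.rpow_mul (by positivity), one_div_mul_cancel hb0.ne', Real.rpow_one]
    field_simp
  -- The perturbation is at most $\alpha+\alpha/4\le2\alpha$ and is zero from $|t|=T+h\le T+1$ on,
  -- so it suffices that $2\alpha\le\frac C2(T+1)^{-b}$.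
  set α : ℝ := min 1 (C / 4 * (T + 1) ^ (-b)) with hαdef
  have hα0 : 0 < α := by positivity
  refine limsup_pos_of_vanishesToOrder hp hμ hg hT hvan (isProbDensity_gauss hs0)
    (gauss_le hs0) hα0 (min_le_left _ _) (fun h J θ hh hh1 hhT => ?_) est
  refine mem_classF3_of_bounds hp hs0 hh (by positivity) hα0.le (min_le_left _ _) (by simp)
    (fun _ => hhT) (fun t ht => ?_) fun t ht => ?_
  · rw [hbneg, ← hsb]
    exact exp_neg_sq_le (by linarith) hs0 ht
  · rw [hbneg]
    have ht' : 0 < |t| := abs_pos.2 ht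
    rcases le_or_gt (T + h) |t| with hle | hlt
    · rw [perturbation_one_eq_zero hp hh hT.le hle, norm_zero]
      positivity
    · refine (norm_perturbation_one_le hp hα0.le (by positivity) t).trans ?_
      have h1 : α ≤ C / 4 * (T + 1) ^ (-b) := min_le_right _ _
      have h2 : (T + 1) ^ (-b) ≤ |t| ^ (-b) :=
        Real.rpow_le_rpow_of_nonpos ht' (by linarith) (by linarith)
      have h3 : C / 4 * (T + 1) ^ (-b) ≤ C / 4 * |t| ^ (-b) := by gcongr
      linarith

theorem limsup_classF2_pos (hp : IsBandlimitedDensity p K) {β μ : ℝ} (hβ : 1 / 2 < β) (hμ : 1 ≤ μ)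
    {g : ℝ → ℝ} (hg : IsProbDensity g) {T : ℝ} (hT : 0 < T) (hvan : VanishesToOrder g μ T) {C : ℝ}
    (hC : 1 < C) (est : Estimator) :
    0 < limsup (fun n : ℕ => ⨆ f ∈ classF2 β C, (n : ℝ≥0∞) ^ (1 / (2 * μ)) * mise est f g n) atTop := by
  obtain ⟨s, hs0, hsint, hsC⟩ := exists_gaussSmoothness_lt hβ.le hC
  set E : ℝ := (1 + (T + 1) ^ 2) ^ β *
    (4 * (T + 1) * (4 + (T + 1) / s ^ 2) + 6 * ∫ t, ‖deriv K t‖) with hE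
  have hk0 : 0 ≤ ∫ t, ‖deriv K t‖ := integral_nonneg fun t => norm_nonneg _
  have hE0 : 0 < E := by positivity
  -- `E` is the cost per unit of $\alpha$; the second entry spends at most the gap between `C` and
  -- the Gaussian functional.
  set α : ℝ := min 1 ((C - ∫ t, gaussSmoothness β s t) / E) with hαdef
  have hα0 : 0 < α := lt_min one_pos (div_pos (by linarith) hE0)
  have hα1 : α ≤ 1 := min_le_left _ _
  refine limsup_pos_of_vanishesToOrder hp hμ hg hT hvan (isProbDensity_gauss hs0)
    (gauss_le hs0) hα0 hα1 (fun h J θ hh hh1 hhT => ?_) est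
  refine ⟨isProbDensity_family hp (isProbDensity_gauss hs0) hh (by positivity) hα0.le hα1
    (by simp) (fun _ => hhT) θ, differentiable_ft_family_one hp hs0 hh, ?_⟩
  refine (lintegral_smoothness_family_le hp (by linarith) hs0 hsint hh hh1 hT.le hα0.le hα1
    (by positivity) (by linarith)).trans (ENNReal.ofReal_le_ofReal ?_)
  have h1 : α ≤ (C - ∫ t, gaussSmoothness β s t) / E := min_le_right _ _
  rw [le_div_iff₀ hE0] at h1
  linarith

/-- The translates of `K` vanish outside disjoint open intervals of length 2, so at most one term is
nonzero. -/
theorem sum_norm_le_one_of_separated (hp : IsBandlimitedDensity p K) {N : ℕ} {c : Fin N → ℝ}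
    (hc : ∀ i j, i ≠ j → 2 ≤ |c i - c j|) (t : ℝ) : ∑ j, ‖K (t - c j)‖ ≤ 1 := by
  by_cases hex : ∃ j, |t - c j| < 1
  · obtain ⟨j, hj⟩ := hex
    rw [Finset.sum_eq_single j]
    · exact hp.norm_le_one _
    · intro i _ hij
      rw [hp.eq_zero, norm_zero]
      have h1 := hc j i (Ne.symm hij)
      have h2 : |c j - c i| ≤ |t - c j| + |t - c i| := by
        rw [abs_sub_comm t (c j)]
        calc |c j - c i| = |(c j - t) + (t - c i)| := by congr 1; ring
          _ ≤ _ := abs_add_le _ _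
      linarith
    · simp
  · push Not at hex
    rw [Finset.sum_eq_zero fun j _ => ?_]
    · exact zero_le_one
    · rw [hp.eq_zero _ (hex j), norm_zero]

/-- The mixture part lives on $|t|<1$, where $|t|^{-b}\ge1$; the bumps live on $|t|<L$, where
$L^b|t|^{-b}\ge1$. -/
theorem norm_perturbation_le_of_separated (hp : IsBandlimitedDensity p K) {N : ℕ} {α a : ℝ} {J : ℕ}
    {lam : Fin N → ℝ} {θ : Fin N → Bool} (hα : 0 ≤ α) (ha : 0 ≤ a)
    (hsep : ∀ i j, i ≠ j → 2 ≤ |lam i - lam j|) {L : ℝ} (hL0 : 0 < L)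
    (hL : ∀ j, 0 ≤ lam j ∧ lam j + 1 ≤ L) {b : ℝ}
    (hb : 0 ≤ b) {t : ℝ} (ht : t ≠ 0) :
    ‖perturbation K α 1 J a lam θ t‖ ≤ (α + a * L ^ b) * |t| ^ (-b) := by
  have ht' : 0 < |t| := abs_pos.2 ht
  rw [add_mul]
  refine (norm_add_le _ _).trans (add_le_add ?_ ?_)
  · rcases le_or_gt 1 |t| with h1 | h1
    · rw [mix_part_eq_zero hp one_pos h1, norm_zero]
      positivity
    · refine (norm_mix_part_le hp hα t).trans (le_mul_of_one_le_right hα ?_)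
      exact Real.one_le_rpow_of_pos_of_le_one_of_nonpos ht' h1.le (by linarith)
  · rcases le_or_gt L |t| with h1 | h1
    · rw [Finset.sum_eq_zero fun j _ => ?_, norm_zero]
      · positivity
      · have h2 := bump_part_eq_zero hp one_pos (t := t) (l := lam j) (by
          rw [abs_of_nonneg (hL j).1]
          exact le_trans (by linarith [(hL j).2]) (le_abs_self _))
        rw [h2.1, h2.2]
        simp
    · have h2 : ‖∑ j, if θ j then (a : ℂ) * ((K ((t - lam j) / (1 : ℝ)) + K ((t + lam j) / (1 : ℝ))) / 2) else 0‖ ≤ a := by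
        refine (norm_sum_le _ _).trans ?_
        calc _ ≤ ∑ j, a / 2 * (‖K (t - lam j)‖ + ‖K (t - -lam j)‖) := by
              refine Finset.sum_le_sum fun j _ => ?_
              split_ifs
              · rw [norm_mul, Complex.norm_real, Real.norm_of_nonneg ha, norm_div, Complex.norm_ofNat,
                  div_one, div_one, sub_neg_eq_add]
                have := norm_add_le (K (t - lam j)) (K (t + lam j))
                calc a * (‖K (t - lam j) + K (t + lam j)‖ / 2)
                    ≤ a * ((‖K (t - lam j)‖ + ‖K (t + lam j)‖) / 2) := by gcongr
                  _ = _ := by ring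
              · rw [norm_zero]; positivity
          _ = a / 2 * (∑ j, ‖K (t - lam j)‖ + ∑ j, ‖K (t - -lam j)‖) := by
              rw [← Finset.mul_sum, Finset.sum_add_distrib]
          _ ≤ a / 2 * (1 + 1) := by
              gcongr
              · exact sum_norm_le_one_of_separated hp hsep t
              · refine sum_norm_le_one_of_separated hp (c := fun j => -lam j) (fun i j hij => ?_) t
                rw [← neg_sub', abs_neg]
                exact hsep i j hij
          _ = a := by ring
      refine h2.trans ?_
      rw [mul_assoc]
      refine le_mul_of_one_le_right ha ?_
      rw [Real.rpow_neg ht'.le, ← div_eq_mul_inv, one_le_div (by positivity)]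
      exact Real.rpow_le_rpow ht'.le h1.le hb

end

/-! ### The rate $n^{-2\beta/(2\beta+2\nu+1)}$. -/

section

variable {p : ℝ → ℝ} {K : ℝ → ℂ}

/-- Unit windows, `M` of them. The condition on `C` collects the Gaussian ($(2b)^b$ with $s=1$), the
mixture ($\alpha=1/2$) and the bumps ($a(4M)^b=4^b/8$). -/
theorem limsup_classF3_pos_of_mem_classG (hp : IsBandlimitedDensity p K) {β ν lam₀ : ℝ} (hβ : 1 / 2 < β)
    (hν : 0 < ν) {μ : ℝ} (hμ : 0 ≤ μ) {g : ℝ → ℝ} (hg : g ∈ classG ν μ lam₀)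
    {c : ℝ} (hc : 0 < c) (hder : ∀ t : ℝ, t ≠ 0 →
      DifferentiableAt ℝ (ft g) t ∧ ‖deriv (ft g) t‖ ≤ c * |t| ^ (-ν)) {C : ℝ}
    (hC : 2 * ((2 * (β + 1 / 2)) ^ (β + 1 / 2) + 1 / 2 + 4 ^ (β + 1 / 2)) ≤ C) (est : Estimator) :
    0 < limsup (fun n : ℕ => ⨆ f ∈ classF3 β C,
      (n : ℝ≥0∞) ^ (2 * β / (2 * β + 2 * ν + 1)) * mise est f g n) atTop := by
  obtain ⟨hgd, C₁, C₂, S₀, hC₁, hC₁₂, -, hG, -⟩ := hg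
  obtain ⟨κ, hκ, hmain⟩ := family_lower_bound hp hgd (isProbDensity_gauss one_pos)
    (gauss_le one_pos) (α := 1 / 2) (by norm_num) (by norm_num)
  set b : ℝ := β + 1 / 2 with hb
  have hbneg : -β - 1 / 2 = -b := by rw [hb]; ring
  have hb0 : 0 < b := by linarith
  set e : ℝ := 2 * β + 2 * ν + 1 with he
  have he0 : 0 < e := by linarith
  set c₁ : ℝ := max C₂ c with hc₁
  have hc₁0 : 0 < c₁ := lt_max_of_lt_right hc
  -- Large enough for $M\ge Bn^{1/e}$ to give $n\,a^2A^2\le\kappa$; the maximum with 1 also puts `M`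
  -- beyond `S₀` for large $n$.
  set B : ℝ := max (((1 / 8) ^ 2 * c₁ ^ 2 / κ) ^ (1 / e)) 1 with hB
  have hB1 : 1 ≤ B := le_max_right _ _
  have hlim : Tendsto (fun n : ℕ => (n : ℝ) ^ (1 / e)) atTop atTop :=
    (tendsto_rpow_atTop (by positivity)).comp tendsto_natCast_atTop_atTop
  refine limsup_pos_of_eventually (κ := κ * (1 / 64 * (2 * B) ^ (-(2 * β)))) (by positivity) ?_
  filter_upwards [hlim.eventually_gt_atTop S₀, eventually_gt_atTop 0] with n hnS hn0 S hS
  have hn1 : (1 : ℝ) ≤ n := by exact_mod_cast hn0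
  have hx1 : 1 ≤ (n : ℝ) ^ (1 / e) := Real.one_le_rpow hn1 (by positivity)
  set x : ℝ := (n : ℝ) ^ (1 / e) with hx
  have hxe : x ^ e = n := by
    rw [hx, ← Real.rpow_mul (by positivity), one_div_mul_cancel he0.ne', Real.rpow_one]
  set M : ℕ := ⌈B * x⌉₊ with hM
  have hBx : 1 ≤ B * x := one_le_mul_of_one_le_of_one_le hB1 hx1
  have hM1 : B * x ≤ M := Nat.le_ceil _
  have hM2 : (M : ℝ) ≤ 2 * B * x := by
    have := Nat.ceil_lt_add_one (show 0 ≤ B * x by linarith)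
    linarith
  have hMge : (1 : ℝ) ≤ M := hBx.trans hM1
  have hMpos : 0 < M := by exact_mod_cast (by linarith : (0 : ℝ) < M)
  have hMS : S₀ < M := hnS.trans_le ((le_mul_of_one_le_left (by linarith) hB1).trans hM1)
  have hMe : (M : ℝ) ^ (-e) * ((1 / 8) ^ 2 * c₁ ^ 2) * n ≤ κ := by
    have h1 : (1 / 8) ^ 2 * c₁ ^ 2 / κ * n ≤ (M : ℝ) ^ e := by
      calc (1 / 8) ^ 2 * c₁ ^ 2 / κ * n
          = (((1 / 8) ^ 2 * c₁ ^ 2 / κ) ^ (1 / e)) ^ e * x ^ e := by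
            rw [hxe, ← Real.rpow_mul (by positivity), one_div_mul_cancel he0.ne', Real.rpow_one]
        _ ≤ B ^ e * x ^ e := by
            gcongr
            exact le_max_left _ _
        _ = (B * x) ^ e := (Real.mul_rpow (by linarith) (by linarith)).symm
        _ ≤ (M : ℝ) ^ e := by gcongr
    rw [div_mul_eq_mul_div, div_le_iff₀ hκ] at h1
    rw [Real.rpow_neg (by linarith), mul_assoc, inv_mul_le_iff₀ (by positivity)]
    exact h1
  set a : ℝ := 1 / 8 * (M : ℝ) ^ (-b) with ha
  have ha0 : 0 < a := by positivity
  have hasq : M * a ^ 2 = 1 / 64 * (M : ℝ) ^ (-(2 * β)) := by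
    rw [show -(2 * β) = 1 + (-b) * (2 : ℕ) by rw [hb]; push_cast; ring, Real.rpow_add (by linarith),
      Real.rpow_one, Real.rpow_mul (by linarith), Real.rpow_natCast, ha]
    ring
  have hNa : M * a ≤ 1 / 2 / 4 := by
    have h1 : M * a = 1 / 8 * (M : ℝ) ^ (1 + -b) := by
      rw [Real.rpow_add (by linarith), Real.rpow_one, ha]
      ring
    have h2 : (M : ℝ) ^ (1 + -b) ≤ 1 := Real.rpow_le_one_of_one_le_of_nonpos hMge (by linarith)
    rw [h1]
    linarith
  -- Frequencies in $[2M,4M-2]$ with spacing 2. Every window lies beyond $2M-1\ge M$, which gives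
  -- $A\asymp M^{-\nu}$, and below $4M$, which bounds the cost in smoothness.
  set lam : Fin M → ℝ := fun j => 2 * (M + (j : ℕ)) with hlam
  have hlow : ∀ j, 2 * (M : ℝ) ≤ lam j := fun j => by
    have : (0 : ℝ) ≤ (j : ℕ) := Nat.cast_nonneg _
    simp only [hlam]
    linarith
  have hup : ∀ j, lam j + 1 ≤ 4 * (M : ℝ) := fun j => by
    have : ((j : ℕ) : ℝ) + 1 ≤ M := by exact_mod_cast j.2
    simp only [hlam]
    linarith
  have hsep : ∀ i j, i ≠ j → 2 ≤ |lam i - lam j| := fun i j hij => by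
    have h1 : (1 : ℝ) ≤ |(((i : ℕ) : ℤ) : ℝ) - (((j : ℕ) : ℤ) : ℝ)| := by
      rw [← Int.cast_sub, ← Int.cast_abs]
      have : ((i : ℕ) : ℤ) - ((j : ℕ) : ℤ) ≠ 0 := by
        rw [sub_ne_zero]
        exact_mod_cast fun h => hij (Fin.ext h)
      exact_mod_cast Int.one_le_abs this
    simp only [Int.cast_natCast] at h1
    have h2 : lam i - lam j = 2 * (((i : ℕ) : ℝ) - ((j : ℕ) : ℝ)) := by
      simp only [hlam]
      ring
    rw [h2, abs_mul, abs_two]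
    linarith
  have ht : ∀ j t, |t - lam j| < 1 → (M : ℝ) < t := fun j t h => by
    have := (abs_lt.1 h).1
    have := hlow j
    linarith
  have htν : ∀ t : ℝ, (M : ℝ) < t → |t| ^ (-ν) ≤ (M : ℝ) ^ (-ν) := fun t h =>
    Real.rpow_le_rpow_of_nonpos (by linarith) (h.le.trans (le_abs_self t)) (by linarith)
  obtain ⟨J, hJ⟩ := hmain n M 1 a (c₁ * (M : ℝ) ^ (-ν)) lam hn0 hMpos one_pos le_rfl ha0 hNa
    (fun j => by linarith [hlow j]) (fun i j hij => by linarith [hsep i j hij])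
    (fun j t h => by
      have h1 := ht j t h
      refine (hG t ((hMS.trans h1).trans_le (le_abs_self t))).2.trans ?_
      have h2 : |Real.sin (lam₀ * t)| ^ μ ≤ 1 :=
        Real.rpow_le_one (abs_nonneg _) (Real.abs_sin_le_one _) hμ
      have h3 : C₂ * |Real.sin (lam₀ * t)| ^ μ ≤ c₁ :=
        (mul_le_of_le_one_right (by linarith) h2).trans (le_max_left _ _)
      exact mul_le_mul h3 (htν t h1) (by positivity) hc₁0.le)
    (fun j t h _ => by
      have h1 := ht j t h
      refine ⟨(hder t (by linarith)).1, (hder t (by linarith)).2.trans ?_⟩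
      rw [div_one]
      exact mul_le_mul (le_max_right _ _) (htν t h1) (by positivity) hc₁0.le)
    (by
      refine le_trans (le_of_eq ?_) hMe
      rw [ha, show -e = (-b) * (2 : ℕ) + (-ν) * (2 : ℕ) by rw [he, hb]; push_cast; ring,
        Real.rpow_add (by linarith), Real.rpow_mul (by linarith), Real.rpow_mul (by linarith),
        Real.rpow_natCast, Real.rpow_natCast]
      ring)
  refine le_trans (ENNReal.ofReal_le_ofReal ?_) (hJ est S fun θ => hS _ ?_)
  · rw [hasq, mul_one, mul_assoc, mul_assoc]
    gcongr
    calc (2 * B) ^ (-(2 * β)) * (n : ℝ) ^ (-(2 * β / e)) = (2 * B * x) ^ (-(2 * β)) := by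
          rw [Real.mul_rpow (x := 2 * B) (y := x) (by linarith) (by linarith), hx, ← Real.rpow_mul (by linarith)]
          congr 2
          ring
      _ ≤ (M : ℝ) ^ (-(2 * β)) :=
          Real.rpow_le_rpow_of_nonpos (by linarith) hM2 (by linarith)
  · have h4 : (0 : ℝ) < 4 ^ b := by positivity
    have h2b : (0 : ℝ) < (2 * b) ^ b := by positivity
    refine mem_classF3_of_bounds hp one_pos one_pos ha0.le (by norm_num) (by norm_num) hNa
      (fun j => by linarith [hlow j]) (fun t ht => ?_) fun t ht => ?_
    · rw [hbneg]
      refine (exp_neg_sq_le (b := b) (by linarith) one_pos ht).trans ?_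
      rw [Real.one_rpow, one_mul]
      gcongr
      linarith
    · rw [hbneg]
      refine (norm_perturbation_le_of_separated hp (by norm_num) ha0.le hsep
        (L := 4 * M) (by linarith) (fun j => ⟨by linarith [hlow j], hup j⟩) hb0.le ht).trans ?_
      gcongr
      have h1 : a * (4 * M) ^ b = 1 / 8 * 4 ^ b := by
        rw [ha, Real.mul_rpow (by norm_num) (by linarith), Real.rpow_neg (by linarith)]
        field_simp
      rw [h1]
      linarith

end

end Deconvolution

theorem theorem4p3 (β μ : ℝ) (hβ : 1 / 2 < β) (hμ : 1 ≤ μ)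
    (fδ : ℝ → ℝ) (hfδ : IsProbDensity fδ)
    (T : ℝ) (hT : 0 < T) (hvan : VanishesToOrder fδ μ T) :
    (∀ C : ℝ, 0 < C → ∀ est : Estimator,
      ((classF2 β C).Nonempty →
        0 < limsup (fun n : ℕ => ⨆ f ∈ classF2 β C,
          (n : ℝ≥0∞) ^ (1 / (2 * μ)) * mise est f fδ n) atTop) ∧
      0 < limsup (fun n : ℕ => ⨆ f ∈ classF3 β C,
          (n : ℝ≥0∞) ^ (1 / (2 * μ)) * mise est f fδ n) atTop) ∧
    (∀ ν lam : ℝ, 0 < ν → 0 < lam → fδ ∈ classG ν μ lam →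
      (∃ c : ℝ, 0 < c ∧ ∀ t : ℝ, t ≠ 0 →
        DifferentiableAt ℝ (ft fδ) t ∧ ‖deriv (ft fδ) t‖ ≤ c * |t| ^ (-ν)) →
      ∃ C₀ : ℝ, 0 < C₀ ∧ ∀ C : ℝ, C₀ ≤ C → ∀ est : Estimator,
        0 < limsup (fun n : ℕ => ⨆ f ∈ classF3 β C,
          (n : ℝ≥0∞) ^ (2 * β / (2 * β + 2 * ν + 1)) * mise est f fδ n) atTop) := by
  obtain ⟨p, K, hp⟩ := exists_isBandlimitedDensity
  refine ⟨fun C hC est => ⟨fun ⟨f, hf⟩ => ?_, ?_⟩, fun ν lam hν _ hG ⟨c, hc, hder⟩ => ?_⟩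
  · exact limsup_classF2_pos hp hβ hμ hfδ hT hvan (one_lt_of_mem_classF2 (by linarith) hf) est
  · exact limsup_classF3_pos hp hβ hμ hfδ hT hvan hC est
  -- The threshold is the constant in the condition on `C` of the lemma; it depends on $\beta$ only.
  · exact ⟨_, by positivity, fun C hC est =>
      limsup_classF3_pos_of_mem_classG hp hβ hν (by linarith) hG hc hder hC est⟩
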